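/- Let $\mathbb K$ be a field, let $m,n\ge 2$, and let $S=\mathbb K[x_{i,j} : i\in[m],\, j\in[n]]$. For a simple graph $H$ on $[n]$ let $\mathcal J_{K_m,H}\subseteq S$ be the ideal generated by the $2$-minors $[i,j\,|\,k,l]=x_{i,k}x_{j,l}-x_{i,l}x_{j,k}$ with $1\le i<j\le m$, $k<l$ and $\{k,l\}\in E(H)$. Let $G$ be a connected graph on $[n]$ that is closed with respect to the given labelling (if $i<j<k$ and $\{i,k\}\in E(G)$, then $\{i,j\},\{j,k\}\in E(G)$) and Cohen–Macaulay (the ring $\mathbb K[x_{i,j}: i\in[2],\,j\in[n]]/\mathcal J_{K_2,G}$ is Cohen–Macaulay). Then the maximal cliques of $G$ are intervals $[b_{i-1},b_i]$, $1\le i\le t$, with $1=b_0<b_1<\dots<b_t=n$. Let $T$ be a cut set of $G$, i.e. a set of vertices (possibly empty) such that every $v\in T$ is a cut vertex of $G\setminus(T\setminus\{v\})$; then $T\subseteq\{b_1,\dots,b_{t-1}\}$. Let $\mathfrak P_T=(x_{i,j}: i\in[m],\, j\in T)+\sum_{C}\mathcal J_{K_m,\widetilde C}$, where $C$ runs over the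 connected components of $G\setminus T$ and $\widetilde C$ is the complete graph on the vertices of $C$. For homogeneous ideals $I$ and $P$ of $S$ put $\mathrm v_{P}(I)=\min\{d\ge 0 : (I:f)=P \text{ for some homogeneous } f\in S \text{ of degree } d\}$. Define a graph $L(T)$ as follows. For $\tau=b_l\in T$ put $\alpha_\tau=b_{l-1}$ if $b_{l-1}\notin T$ and $\alpha_\tau=b_{l-1}+1$ otherwise; put $\beta_\tau=b_{l+1}$ if $b_{l+1}\notin T$ and $\beta_\tau=b_l+1$ otherwise. The edges of $L(T)$ are the pairs $\{\alpha_\tau,\beta_\tau\}$, $\tau\in T$. Let $V_0$ be the set $\{b_0,\dots,b_t\}\setminus T$, with $b_0$ removed if $b_1\notin T$ and $b_t$ removed if $b_{t-1}\notin T$. The vertices of $L(T)$ are all $\alpha_\tau,\beta_\tau$ together with the elements of $V_0$ that lie in no interval $[\alpha_\tau,\beta_\tau]$. Thus $L(T)$ is a disjoint union of paths and isolated vertices. A partition $\mathcal P$ of $E(L(T))$ is called $m$-compatible if every block is the edge set of a path of length at most $m-1$ in $L(T)$; the vertex sets $\{c_1<\dots<c_\ell\}$ of these paths ($2\le \ell\le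 m$) are the slices of $\mathcal P$. Let $$f_{\mathcal P}=\prod_{\text{slices }\{c_1<\dots<c_\ell\}}\det\bigl(x_{i,c_j}\bigr)_{1\le i,j\le \ell}\ \cdot\prod_{v\text{ an isolated vertex of }L(T)}x_{1,v}.$$ Then some homogeneous $f\in S$ satisfies $(\mathcal J_{K_m,G}:f)=\mathfrak P_T$, and $$\mathrm v_{\mathfrak P_T}(\mathcal J_{K_m,G})=\min\{\deg f_{\mathcal P} : \mathcal P\text{ is an }m\text{-compatible partition of }E(L(T))\}.$$ -/

import Mathlib

namespace GenBinomialEdge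

noncomputable section

open scoped Classical

/-! ### Commutative algebra -/

/-- A commutative ring is Cohen-Macaulay if it is Noetherian and each of its local rings `A` has
depth equal to its dimension, i.e. contains an `A`-regular sequence of length `dim A`
(the elements of a regular sequence lie in the maximal ideal because `A / (rs) ≠ 0`). -/
def IsCohenMacaulayRing (R : Type*) [CommRing R] : Prop :=
  IsNoetherianRing R ∧
    ∀ (p : Ideal R) [p.IsPrime], ∃ rs : List (Localization.AtPrime p),
      RingTheory.Sequence.IsRegular (Localization.AtPrime p) rs ∧
        ((rs.length : ℕ∞) : WithBot ℕ∞) = ringKrullDim (Localization.AtPrime p)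

/-- The degrees `d` for which some homogeneous `f` of degree `d` satisfies `(I : f) = P`. -/
def vDegrees {σ K : Type*} [Field K] (I P : Ideal (MvPolynomial σ K)) : Set ℕ :=
  {d | ∃ f : MvPolynomial σ K, f.IsHomogeneous d ∧ I.colon {f} = P}

/-- The local v-number of `I` at `P` : the least element of `vDegrees I P`
(with value `0` if that set is empty, which does not happen for associated primes). -/
def localVNumber {σ K : Type*} [Field K] (I P : Ideal (MvPolynomial σ K)) : ℕ :=
  sInf (vDegrees I P)

/-! ### Binomial edge ideals of pairs of graphs -/

/-- The minor `[i, j | k, l] = x_{i,k} x_{j,l} - x_{i,l} x_{j,k}` of the generic matrix. -/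
def minor (K : Type*) [Field K] {m n : ℕ} (i j : Fin m) (k l : Fin n) :
    MvPolynomial (Fin m × Fin n) K :=
  MvPolynomial.X (i, k) * MvPolynomial.X (j, l) - MvPolynomial.X (i, l) * MvPolynomial.X (j, k)

/-- The binomial edge ideal `J_{G₁, G₂}` of a pair of graphs. For `G₁ = ⊤ = K_m` it is the
generalized binomial edge ideal `J_{K_m, G₂}`. -/
def edgeIdeal (K : Type*) [Field K] {m n : ℕ} (G₁ : SimpleGraph (Fin m))
    (G₂ : SimpleGraph (Fin n)) : Ideal (MvPolynomial (Fin m × Fin n) K) :=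
  Ideal.span {p | ∃ i j : Fin m, ∃ k l : Fin n,
    G₁.Adj i j ∧ i < j ∧ G₂.Adj k l ∧ k < l ∧ p = minor K i j k l}

/-- The complete graph on a set `s` of vertices; no edge meets the complement of `s`. -/
def completeOn {V : Type*} (s : Set V) : SimpleGraph V where
  Adj u v := u ∈ s ∧ v ∈ s ∧ u ≠ v
  symm := ⟨fun _ _ h => ⟨h.2.1, h.1, h.2.2.symm⟩⟩
  loopless := ⟨fun _ h => h.2.2 rfl⟩

/-- The graph `G \ T`, the induced subgraph on the vertices outside `T`. -/
abbrev removeVerts {n : ℕ} (G : SimpleGraph (Fin n)) (T : Finset (Fin n)) :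
    SimpleGraph {v : Fin n | v ∉ T} :=
  G.induce {v : Fin n | v ∉ T}

/-- The ideal `P_T(K_m, G)`: the variables in the columns of `T`, plus the generalized binomial
edge ideals of the complete graphs on the connected components of `G \ T`. -/
def primeOfCutSet (K : Type*) [Field K] (m : ℕ) {n : ℕ} (G : SimpleGraph (Fin n))
    (T : Finset (Fin n)) : Ideal (MvPolynomial (Fin m × Fin n) K) :=
  Ideal.span {p | ∃ i : Fin m, ∃ j ∈ T, p = MvPolynomial.X (i, j)} ⊔
    ⨆ c : (removeVerts G T).ConnectedComponent,
      edgeIdeal K (⊤ : SimpleGraph (Fin m)) (completeOn (Subtype.val '' c.supp))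

/-! ### Cut sets, closed graphs -/

/-- The number `c(T)` of connected components of `G \ T`. -/
def numComponents {n : ℕ} (G : SimpleGraph (Fin n)) (T : Finset (Fin n)) : ℕ :=
  Nat.card (removeVerts G T).ConnectedComponent

/-- `T` is a cut set of `G`: each `v ∈ T` is a cut vertex of `G \ (T \ {v})`. -/
def IsCutSet {n : ℕ} (G : SimpleGraph (Fin n)) (T : Finset (Fin n)) : Prop :=
  ∀ v ∈ T, numComponents G (T.erase v) < numComponents G T

/-- `G` is closed with respect to the given labelling of its vertices. -/
def IsClosedGraph {n : ℕ} (G : SimpleGraph (Fin n)) : Prop :=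
  ∀ i j k : Fin n, i < j → j < k → G.Adj i k → G.Adj i j ∧ G.Adj j k

/-! ### The graph `L(T)`

For a connected Cohen-Macaulay closed graph the maximal cliques are the intervals
`[b_{i-1}, b_i]`, `1 ≤ i ≤ t`, with `b_0 < b_1 < ⋯ < b_t` the first and last vertex being
`b_0` and `b_t`. -/

/-- The set `{b_0, …, b_t}` of vertices of the spine: all endpoints (smallest and largest
elements) of maximal cliques. -/
def spine {n : ℕ} (G : SimpleGraph (Fin n)) : Finset (Fin n) :=
  Finset.univ.filter fun v => ∃ F : Set (Fin n), Maximal (fun s => G.IsClique s) F ∧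
    (IsLeast F v ∨ IsGreatest F v)

/-- The preceding spine vertex, `b_l ↦ b_{l-1}` (and `v ↦ v` if there is none). -/
def spinePrev {n : ℕ} (G : SimpleGraph (Fin n)) (v : Fin n) : Fin n :=
  if h : ((spine G).filter (· < v)).Nonempty then ((spine G).filter (· < v)).max' h else v

/-- The following spine vertex, `b_l ↦ b_{l+1}` (and `v ↦ v` if there is none). -/
def spineNext {n : ℕ} (G : SimpleGraph (Fin n)) (v : Fin n) : Fin n :=
  if h : ((spine G).filter (v < ·)).Nonempty then ((spine G).filter (v < ·)).min' h else v

/-- The vertex `α` attached to `τ = b_l ∈ T`: it is `b_{l-1}` if `b_{l-1} ∉ T`, and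
`b_{l-1} + 1` otherwise. -/
def alpha {n : ℕ} (G : SimpleGraph (Fin n)) (T : Finset (Fin n)) (τ : Fin n) : Fin n :=
  if spinePrev G τ ∈ T then Order.succ (spinePrev G τ) else spinePrev G τ

/-- The vertex `β` attached to `τ = b_l ∈ T`: it is `b_{l+1}` if `b_{l+1} ∉ T`, and
`b_l + 1` otherwise. -/
def beta {n : ℕ} (G : SimpleGraph (Fin n)) (T : Finset (Fin n)) (τ : Fin n) : Fin n :=
  if spineNext G τ ∈ T then Order.succ τ else spineNext G τ

/-- The set `V₀`: the spine vertices outside `T`, without the first vertex `b_0` unless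
`b_1 ∈ T`, and without the last vertex `b_t` unless `b_{t-1} ∈ T`. -/
def innerSpine {n : ℕ} (G : SimpleGraph (Fin n)) (T : Finset (Fin n)) : Finset (Fin n) :=
  (spine G).filter fun v => v ∉ T ∧ (v.val = 0 → spineNext G v ∈ T) ∧
    (v.val + 1 = n → spinePrev G v ∈ T)

/-- The graph `L(T)`, as a graph with vertex set contained in `Fin n`. Its vertices are the `α`s,
the `β`s and the elements of `V₀` that lie in none of the intervals `[α, β]`; its edges are the
pairs `{α, β}`, one for each element of `T`. -/
def pathForest {n : ℕ} (G : SimpleGraph (Fin n)) (T : Finset (Fin n)) :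
    (⊤ : SimpleGraph (Fin n)).Subgraph where
  verts := {v | (v ∈ innerSpine G T ∧ ∀ τ ∈ T, v ∉ Set.Icc (alpha G T τ) (beta G T τ)) ∨
    ∃ τ ∈ T, v = alpha G T τ ∨ v = beta G T τ}
  Adj u v := u ≠ v ∧ ∃ τ ∈ T, s(u, v) = s(alpha G T τ, beta G T τ)
  adj_sub h := h.1
  edge_vert := by
    rintro u v ⟨-, τ, hτ, h⟩
    refine Or.inr ⟨τ, hτ, ?_⟩
    rcases Sym2.eq_iff.mp h with h | h
    · exact Or.inl h.1
    · exact Or.inr h.1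
  symm := ⟨by
    rintro u v ⟨hne, τ, hτ, h⟩
    exact ⟨hne.symm, τ, hτ, by rw [Sym2.eq_swap]; exact h⟩⟩

/-- The edge set `E(L(T))`. -/
def forestEdges {n : ℕ} (G : SimpleGraph (Fin n)) (T : Finset (Fin n)) :
    Finset (Sym2 (Fin n)) :=
  Finset.univ.filter fun e => e ∈ (pathForest G T).edgeSet

/-- The isolated vertices of `L(T)`. -/
def isolatedVerts {n : ℕ} (G : SimpleGraph (Fin n)) (T : Finset (Fin n)) : Finset (Fin n) :=
  Finset.univ.filter fun v => v ∈ (pathForest G T).verts ∧ ∀ u, ¬ (pathForest G T).Adj v u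

/-! ### Compatible partitions and the polynomials `f_P` -/

/-- A partition of `E(L(T))` is `m`-compatible if each block is the edge set of a path in `L(T)`
of length at most `m - 1`. -/
def IsCompatible (m : ℕ) {n : ℕ} {G : SimpleGraph (Fin n)} {T : Finset (Fin n)}
    (P : Finpartition (forestEdges G T)) : Prop :=
  ∀ p ∈ P.parts, ∃ u v : Fin n, ∃ w : (pathForest G T).spanningCoe.Walk u v,
    w.IsPath ∧ w.length + 1 ≤ m ∧ w.edges.toFinset = p

/-- The vertex set of a slice, given by its set `p` of edges. -/
def sliceVerts {n : ℕ} (p : Finset (Sym2 (Fin n))) : Finset (Fin n) :=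
  Finset.univ.filter fun v => ∃ e ∈ p, v ∈ e

theorem IsCompatible.card_sliceVerts_le {m n : ℕ} {G : SimpleGraph (Fin n)} {T : Finset (Fin n)}
    {P : Finpartition (forestEdges G T)} (hP : IsCompatible m P) {p : Finset (Sym2 (Fin n))}
    (hp : p ∈ P.parts) : (sliceVerts p).card ≤ m := by
  obtain ⟨u, v, w, -, hl, rfl⟩ := hP p hp
  have hsub : sliceVerts w.edges.toFinset ⊆ w.support.toFinset := by
    intro x hx
    obtain ⟨e, he, hxe⟩ := (Finset.mem_filter.mp hx).2
    rw [List.mem_toFinset] at he ⊢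
    exact w.mem_support_of_mem_edges he hxe
  calc (sliceVerts w.edges.toFinset).card ≤ w.support.toFinset.card := Finset.card_le_card hsub
    _ ≤ w.support.length := List.toFinset_card_le _
    _ = w.length + 1 := w.length_support
    _ ≤ m := hl

/-- The maximal minor of a slice with vertices `c_1 < ⋯ < c_ℓ`, `ℓ ≤ m`: the determinant of the
`ℓ × ℓ` matrix with entries `x_{i, c_j}`. -/
def sliceMinor (K : Type*) [Field K] {m n : ℕ} (c : Finset (Fin n)) (hc : c.card ≤ m) :
    MvPolynomial (Fin m × Fin n) K :=
  Matrix.det (Matrix.of fun i j : Fin c.card =>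
    (MvPolynomial.X (Fin.castLE hc i, c.orderEmbOfFin rfl j) : MvPolynomial (Fin m × Fin n) K))

/-- The polynomial `f_P` of an `m`-compatible partition `P` of `E(L(T))`: the product of the
minors of its slices and of the variables `x_{1,v}`, `v` an isolated vertex of `L(T)`. -/
def partitionPoly (K : Type*) [Field K] {m n : ℕ} (hm : 2 ≤ m) {G : SimpleGraph (Fin n)}
    {T : Finset (Fin n)} (P : Finpartition (forestEdges G T)) (hP : IsCompatible m P) :
    MvPolynomial (Fin m × Fin n) K :=
  (∏ p ∈ P.parts.attach, sliceMinor K (sliceVerts p.1) (hP.card_sliceVerts_le p.2)) *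
    ∏ v ∈ isolatedVerts G T, MvPolynomial.X (⟨0, Nat.lt_of_lt_of_le Nat.zero_lt_two hm⟩, v)

end

end GenBinomialEdge

/-!
A connected closed graph whose binomial edge ring is Cohen-Macaulay is a chain of cliques: there is
a set `B` of gluing vertices such that two vertices are adjacent unless an element of `B` lies
strictly between them (`IsCliqueChain`). If two overlapping cliques met in more than one vertex,
then the local ring at the prime of rank-one matrices vanishing on the overlap would have dimension
at least two, while its maximal ideal is a sum of two nonzero ideals with zero product. By
`length_le_one_of_isRegular`, a form of Hartshorne's connectedness theorem, its depth is at most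
one, which contradicts the Cohen-Macaulay property (`IsClosedGraph.adj_of_isCohenMacaulayRing`). A
cut set `T` is then a subset of `B` without consecutive integers (`IsSparse`), and the components
of `G \ T` are the fibres outside `T` of `color T`, the number of elements of `T` to the left of a
vertex.

For `T` contained in `B`, the ideal `P_T` is the kernel of the Segre parametrization `x_{i,j} ↦
z_{k,i} y_j`, where `k` is the colour of `j`, and `x_{i,j} ↦ 0` for `j ∈ T`
(`IsCliqueChain.primeOfCutSet_eq_segreIdeal`); in particular it is prime, and it contains `J =
J_{K_m,G}`.

Upper bound. For every compatible partition, `P_T * f_P ⊆ J`: a variable in the column `τ ∈ T`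
times a `2`-minor in the columns `α_τ`, `β_τ` lies in `J`, and a `2`-minor in two columns of a
component times one variable for each gluing vertex between these columns lies in `J`; the vertices
of `L(T)` provide these factors, as a slice meets each component at most once. Moreover `f_P ∉
P_T`. As `P_T` is a prime containing `J`, this gives `(J : f_P) = P_T`
(`IsCliqueChain.colon_partitionPoly`).

Lower bound. If `(J : f) = P_T`, then `f ∉ P_T`, while `f` lies in the primes of all other subsets
`T'` of `B` for which `P_T` is not contained in that prime. These ideals are homogeneous in the
column degrees, so some part of `f` of a fixed column degree `D`, as a function of the vectors
`z_k` and the scalars `y_j`, is nonzero, vanishes when `z_k = z_{k+1}` and vanishes when `y_v = 0`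
for a gluing vertex `v ∉ T`. Hence `D v ≥ 1` for these `v`, every component next to an element of
`T` has positive degree, and on a run of components whose inner ones have degree one the function
is alternating enough that the run has at most `m` components (`sub_add_one_le_of_ne_zero`,
`IsCliqueChain.exists_colDegree`). Cutting the paths of `L(T)` at the components of degree
different from one therefore yields a compatible partition (`IsCliqueChain.exists_isCompatible`),
and counting degrees component by component shows that its polynomial has degree at most `deg f`
(`IsCliqueChain.card_add_card_add_card_le_sum`).
-/

namespace GenBinomialEdge

open scoped Classical
open MvPolynomial

/-! ### Local rings with disconnected punctured spectrum -/

open scoped Pointwise in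
/-- A form of Hartshorne's connectedness theorem: if the maximal ideal is a sum of two nonzero
ideals with zero product, then regular sequences have length at most one. -/
theorem length_le_one_of_isRegular {A : Type*} [CommRing A] [IsLocalRing A] {I I' : Ideal A}
    (hmul : ∀ x ∈ I, ∀ y ∈ I', x * y = 0) (hsup : IsLocalRing.maximalIdeal A ≤ I ⊔ I')
    (hI : I ≠ ⊥) (hI' : I' ≠ ⊥) {rs : List A} (hrs : RingTheory.Sequence.IsRegular A rs) :
    rs.length ≤ 1 := by
  have hmax : ∀ r ∈ rs, r ∈ IsLocalRing.maximalIdeal A := by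
    intro r hr
    by_contra h
    have hu : IsUnit r := by simpa using h
    apply hrs.top_ne_smul
    have htop : Ideal.ofList rs = ⊤ :=
      Ideal.eq_top_of_isUnit_mem _ (Ideal.subset_span hr) hu
    rw [htop, Submodule.top_smul]
  match rs, hrs, hmax with
  | [], _, _ => simp
  | [_], _, _ => simp
  | a :: b :: rs, hrs, hmax =>
    exfalso
    obtain ⟨ha, hrs'⟩ := (RingTheory.Sequence.isRegular_cons_iff A a (b :: rs)).mp hrs
    obtain ⟨hb, -⟩ := (RingTheory.Sequence.isRegular_cons_iff _ b rs).mp hrs'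
    have hb' := (isSMulRegular_quotient_iff_mem_of_smul_mem _ b).mp hb
    obtain ⟨a₁, ha₁, a₂, ha₂, rfl⟩ := Submodule.mem_sup.mp (hsup (hmax a (by simp)))
    obtain ⟨b₁, hb₁, b₂, hb₂, rfl⟩ := Submodule.mem_sup.mp (hsup (hmax b (by simp)))
    have hreg : ∀ x, (a₁ + a₂) * x = 0 → x = 0 := fun x hx => by
      apply ha
      simpa using hx
    have key : a₂ ∈ (a₁ + a₂) • (⊤ : Submodule A A) := by
      apply hb'
      rw [Submodule.mem_smul_pointwise_iff_exists]
      refine ⟨b₂, trivial, ?_⟩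
      have h1 := hmul _ ha₁ _ hb₂
      have h2 := hmul _ hb₁ _ ha₂
      simp only [smul_eq_mul]
      linear_combination h1 - h2
    obtain ⟨c, -, hc⟩ := (Submodule.mem_smul_pointwise_iff_exists _ _ _).mp key
    simp only [smul_eq_mul] at hc
    have h1 : ∀ x ∈ I, c * x = 0 := fun x hx => by
      apply hreg
      have := hmul x hx a₂ ha₂
      linear_combination x * hc + this
    have h2 : ∀ x ∈ I', (1 - c) * x = 0 := fun x hx => by
      apply hreg
      have := hmul a₁ ha₁ x hx
      linear_combination -x * hc + this
    rcases IsLocalRing.isUnit_or_isUnit_one_sub_self c with hu | hu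
    · exact hI ((Submodule.eq_bot_iff _).mpr fun x hx => (hu.mul_right_eq_zero).mp (h1 x hx))
    · exact hI' ((Submodule.eq_bot_iff _).mpr fun x hx => (hu.mul_right_eq_zero).mp (h2 x hx))

/-! ### Closed graphs -/

theorem IsClosedGraph.adj_of_le {n : ℕ} {G : SimpleGraph (Fin n)} (hG : IsClosedGraph G)
    {u a b w : Fin n} (h : G.Adj u w) (hua : u ≤ a) (hab : a < b) (hbw : b ≤ w) : G.Adj a b := by
  have h1 : G.Adj a w := by
    rcases hua.eq_or_lt with rfl | hua
    · exact h
    · exact (hG u a w hua (hab.trans_le hbw) h).2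
  rcases hbw.eq_or_lt with rfl | hbw
  · exact h1
  · exact (hG a b w hab hbw h1).1

theorem IsClosedGraph.adj_of_val_add_one {n : ℕ} {G : SimpleGraph (Fin n)} (hG : IsClosedGraph G)
    (hc : G.Connected) {u w : Fin n} (h : u.val + 1 = w.val) : G.Adj u w := by
  obtain ⟨p⟩ := hc.preconnected u w
  obtain ⟨d, -, hd, hd'⟩ := p.exists_boundary_dart {x | x ≤ u} (by simp)
    (by rw [Set.mem_ofPred_eq, Fin.le_def]; omega)
  simp only [Set.mem_ofPred_eq, not_le] at hd hd'
  refine hG.adj_of_le d.adj hd ?_ ?_ <;> simp only [Fin.lt_def, Fin.le_def] at * <;> omega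

/-- If two overlapping cliques of a closed graph meet in more than one vertex, then there are
nonadjacent vertices `a` and `d` with at least two vertices strictly between them, all of which are
adjacent to both. -/
theorem IsClosedGraph.exists_separating_interval {n : ℕ} {G : SimpleGraph (Fin n)}
    (hG : IsClosedGraph G) {a b c d : Fin n} (hab : a < b) (hbc : b < c) (hcd : c < d)
    (hac : G.Adj a c) (hbd : G.Adj b d) (had : ¬ G.Adj a d) :
    ∃ a d : Fin n, a.val + 3 ≤ d.val ∧ ¬ G.Adj a d ∧
      ∀ x, a < x → x < d → G.Adj a x ∧ G.Adj x d := by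
  let s : Finset (Fin n) := Finset.univ.filter fun x => c < x ∧ ¬ G.Adj a x
  have hs : s.Nonempty := ⟨d, by simp [s, hcd, had]⟩
  obtain ⟨d', hd', hmin⟩ := s.exists_min_image id hs
  let t : Finset (Fin n) := Finset.univ.filter fun x => x < b ∧ ¬ G.Adj x d'
  simp only [s, Finset.mem_filter, Finset.mem_univ, true_and, id] at hd' hmin
  have hd'd : d' ≤ d := hmin d ⟨hcd, had⟩
  have ht : t.Nonempty := ⟨a, by simp [t, hab, hd'.2]⟩
  obtain ⟨a', ha', hmax⟩ := t.exists_max_image id ht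
  simp only [t, Finset.mem_filter, Finset.mem_univ, true_and, id] at ha' hmax
  have haa' : a ≤ a' := hmax a ⟨hab, hd'.2⟩
  have hbd' : G.Adj b d' := hG.adj_of_le hbd le_rfl (hbc.trans hd'.1) hd'd
  refine ⟨a', d', ?_, ha'.2, fun x hax hxd => ⟨?_, ?_⟩⟩
  · have := ha'.1; have := hd'.1
    simp only [Fin.lt_def] at *; omega
  · have hax' : G.Adj a x := by
      rcases le_or_gt x c with hxc | hxc
      · exact hG.adj_of_le hac le_rfl (haa'.trans_lt hax) hxc
      · by_contra h
        exact absurd (hmin x ⟨hxc, h⟩) (not_le.mpr hxd)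
    exact hG.adj_of_le hax' haa' hax le_rfl
  · rcases lt_or_ge x b with hxb | hxb
    · by_contra h
      exact absurd (hmax x ⟨hxb, h⟩) (not_le.mpr hax)
    · exact hG.adj_of_le hbd' hxb hxd le_rfl

/-! ### Cohen-Macaulay closed graphs -/

/-- The rank-one `2 × n` matrices in which the columns in `U` vanish and the slope of column `j`
is the variable `w_{g j}`. -/
noncomputable def slopeMap (K : Type*) [Field K] {n : ℕ} (U : Set (Fin n)) (g : Fin n → Bool) :
    MvPolynomial (Fin 2 × Fin n) K →ₐ[K] MvPolynomial (Fin n ⊕ Bool) K :=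
  aeval fun p => if p.2 ∈ U then 0 else
    if p.1 = 0 then X (Sum.inl p.2) else X (Sum.inr (g p.2)) * X (Sum.inl p.2)

theorem edgeIdeal_le_ker_slopeMap (K : Type*) [Field K] {n : ℕ} {G : SimpleGraph (Fin n)}
    {U : Set (Fin n)} {g : Fin n → Bool}
    (h : ∀ k l, G.Adj k l → k ∉ U → l ∉ U → g k = g l) :
    edgeIdeal K (⊤ : SimpleGraph (Fin 2)) G ≤ RingHom.ker (slopeMap K U g) := by
  refine Ideal.span_le.mpr ?_
  rintro _ ⟨i, j, k, l, -, hij, hkl, -, rfl⟩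
  have hi : i = 0 := by omega
  have hj : j = 1 := by omega
  subst hi hj
  simp only [SetLike.mem_coe, RingHom.mem_ker, minor, slopeMap, map_sub, map_mul, aeval_X]
  by_cases hk : k ∈ U
  · simp [hk]
  · by_cases hl : l ∈ U
    · simp [hl]
    · simp [hk, hl, h k l hkl hk hl]; ring

/-- Setting the columns in a larger set to zero, and possibly identifying the slopes, shrinks the
family of matrices parametrized by `slopeMap`. -/
theorem ker_slopeMap_le (K : Type*) [Field K] {n : ℕ} {U U' : Set (Fin n)} (hU : U ⊆ U')
    (g : Fin n → Bool) :
    RingHom.ker (slopeMap K U g) ≤ RingHom.ker (slopeMap K U' fun _ => true) := by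
  let e : MvPolynomial (Fin n ⊕ Bool) K →ₐ[K] MvPolynomial (Fin n ⊕ Bool) K :=
    aeval (Sum.elim (fun j => if j ∈ U' then 0 else X (Sum.inl j)) fun _ => X (Sum.inr true))
  have he : e.comp (slopeMap K U g) = slopeMap K U' fun _ => true := by
    ext ⟨i, j⟩
    by_cases hj : j ∈ U
    · simp [slopeMap, hj, hU hj]
    · by_cases hj' : j ∈ U'
      · by_cases hi : i = 0 <;> simp [slopeMap, hj, hj', e, hi]
      · by_cases hi : i = 0 <;> simp [slopeMap, hj, hj', e, hi]
  intro f hf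
  rw [RingHom.mem_ker] at hf ⊢
  rw [← he, AlgHom.comp_apply, hf, map_zero]

/-- The local ring `A` of the binomial edge ideal at the rank-one matrices vanishing on the
interval `(a, d)` of common neighbours of the nonadjacent vertices `a < d`: all columns up to `d`
have the slope `u` of column `a`, all columns from `a` on have the slope `u'` of column `d`, so that
the ideals `(u - u')` and `(x_{0,τ} : a < τ < d)` disconnect its punctured spectrum. -/
theorem length_le_one_of_separating_interval {K : Type*} [Field K] {n : ℕ}
    {G : SimpleGraph (Fin n)} (hG : IsClosedGraph G) (hconn : G.Connected) {a d : Fin n}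
    (hgap : a.val + 2 ≤ d.val) (hT : ∀ x, a < x → x < d → G.Adj a x ∧ G.Adj x d)
    {A : Type*} [CommRing A] [IsLocalRing A] (ι : MvPolynomial (Fin 2 × Fin n) K →+* A)
    (hz : ∀ s ∈ edgeIdeal K (⊤ : SimpleGraph (Fin 2)) G, ι s = 0)
    (hunit : ∀ j, j ∉ Set.Ioo a d → IsUnit (ι (X (0, j))))
    (hmax : IsLocalRing.maximalIdeal A ≤
      Ideal.map ι (RingHom.ker (slopeMap K (Set.Ioo a d) fun _ => true)))
    (hne : ∀ s, slopeMap K ∅ (fun _ => true) s ≠ 0 → ι s ≠ 0)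
    (hne' : ∀ s, slopeMap K (Set.Ioo a d) (fun j => decide (j ≤ a)) s ≠ 0 → ι s ≠ 0)
    {rs : List A} (hrs : RingTheory.Sequence.IsRegular A rs) : rs.length ≤ 1 := by
  set T : Set (Fin n) := Set.Ioo a d
  let side : Fin n → Bool := fun j => decide (j ≤ a)
  have haT : a ∉ T := by simp [T]
  have hdT : d ∉ T := by simp [T]
  have hrel (k l) (h : G.Adj k l) :
      ι (X (0, k)) * ι (X (1, l)) = ι (X (0, l)) * ι (X (1, k)) := by
    rw [← sub_eq_zero, ← map_mul, ← map_mul]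
    rw [← map_sub ι]
    rcases h.ne.lt_or_gt with h' | h'
    · exact hz _ (Ideal.subset_span ⟨0, 1, k, l, by simp, by simp, h, h', rfl⟩)
    · rw [← neg_sub, map_neg, neg_eq_zero]
      exact hz _ (Ideal.subset_span ⟨0, 1, l, k, by simp, by simp, h.symm, h', rfl⟩)
  have hstep (u : A) (k l) (hk : k ∉ T) (h : G.Adj k l)
      (hu : ι (X (1, k)) = u * ι (X (0, k))) : ι (X (1, l)) = u * ι (X (0, l)) := by
    apply (hunit k hk).mul_left_cancel
    rw [hrel k l h, hu]; ring
  obtain ⟨u, hu⟩ : ∃ u, ι (X (1, a)) = u * ι (X (0, a)) := by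
    obtain ⟨v, hv⟩ := (hunit a haT).exists_left_inv
    exact ⟨ι (X (1, a)) * v, by rw [mul_assoc, hv, mul_one]⟩
  obtain ⟨u', hu'⟩ : ∃ u, ι (X (1, d)) = u * ι (X (0, d)) := by
    obtain ⟨v, hv⟩ := (hunit d hdT).exists_left_inv
    exact ⟨ι (X (1, d)) * v, by rw [mul_assoc, hv, mul_one]⟩
  have hleft : ∀ (r : ℕ) (j : Fin n), j.val + r = a.val → ι (X (1, j)) = u * ι (X (0, j)) := by
    intro r
    induction r with
    | zero =>
      intro j hj
      obtain rfl : j = a := Fin.ext hj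
      exact hu
    | succ r ih =>
      intro j hj
      refine hstep u ⟨j.val + 1, by omega⟩ j ?_ ?_ (ih _ (by simp only; omega))
      · intro h
        have := h.1
        simp only [Fin.lt_def] at this
        omega
      · exact (hG.adj_of_val_add_one hconn rfl).symm
  have hright : ∀ (r : ℕ) (j : Fin n), d.val + r = j.val → ι (X (1, j)) = u' * ι (X (0, j)) := by
    intro r
    induction r with
    | zero =>
      intro j hj
      obtain rfl : d = j := Fin.ext hj
      exact hu'
    | succ r ih =>
      intro j hj
      refine hstep u' ⟨j.val - 1, by omega⟩ j ?_ ?_ (ih _ (by simp only; omega))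
      · intro h
        have := h.2
        simp only [Fin.lt_def] at this
        omega
      · exact hG.adj_of_val_add_one hconn (by simp only; omega)
  have hmidl (τ) (h : τ ∈ T) : ι (X (1, τ)) = u * ι (X (0, τ)) :=
    hstep u a τ haT (hT τ h.1 h.2).1 hu
  have hmidr (τ) (h : τ ∈ T) : ι (X (1, τ)) = u' * ι (X (0, τ)) :=
    hstep u' d τ hdT (hT τ h.1 h.2).2.symm hu'
  let I : Ideal A := Ideal.span {u - u'}
  let I' : Ideal A := Ideal.span {x | ∃ τ ∈ T, x = ι (X (0, τ))}
  refine length_le_one_of_isRegular (I := I) (I' := I') ?_ ?_ ?_ ?_ hrs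
  · intro x hx y hy
    obtain ⟨r, rfl⟩ := Ideal.mem_span_singleton'.mp hx
    suffices h : (u - u') * y = 0 by rw [mul_assoc, h, mul_zero]
    have : I' ≤ (⊥ : Ideal A).colon {u - u'} := by
      refine Ideal.span_le.mpr ?_
      rintro _ ⟨τ, hτ, rfl⟩
      rw [SetLike.mem_coe, Submodule.mem_colon_singleton, Submodule.mem_bot, smul_eq_mul]
      linear_combination hmidr τ hτ - hmidl τ hτ
    have := this hy
    rw [Submodule.mem_colon_singleton, Submodule.mem_bot, smul_eq_mul] at this
    rw [mul_comm, this]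
  · refine hmax.trans (Ideal.map_le_iff_le_comap.mpr fun s hs => ?_)
    rw [Ideal.mem_comap]
    rw [← Ideal.Quotient.eq_zero_iff_mem]
    let κ := (Ideal.Quotient.mk (I ⊔ I')).comp ι
    let e : MvPolynomial (Fin n ⊕ Bool) K →+* A ⧸ (I ⊔ I') :=
      eval₂Hom (κ.comp C) (Sum.elim (fun j => κ (X (0, j))) fun _ => Ideal.Quotient.mk _ u)
    have hI'0 (τ) (h : τ ∈ T) : κ (X (0, τ)) = 0 :=
      Ideal.Quotient.eq_zero_iff_mem.mpr (Ideal.mem_sup_right (Ideal.subset_span ⟨τ, h, rfl⟩))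
    have hκ1 (j) : κ (X (1, j)) = Ideal.Quotient.mk _ u * κ (X (0, j)) := by
      simp only [κ, RingHom.comp_apply]
      rw [← map_mul, Ideal.Quotient.eq]
      rcases le_or_gt j a with hj | hj
      · rw [hleft (a.val - j.val) j (by simp only [Fin.le_def] at hj; omega), sub_self]
        exact zero_mem _
      rcases lt_or_ge j d with hj' | hj'
      · rw [hmidl j ⟨hj, hj'⟩, sub_self]
        exact zero_mem _
      · rw [hright (j.val - d.val) j (by simp only [Fin.le_def] at hj'; omega), ← sub_mul]
        refine Ideal.mem_sup_left (Ideal.mul_mem_right _ _ ?_)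
        rw [← neg_sub]
        exact neg_mem (Ideal.subset_span rfl)
    have hκ : κ = e.comp (slopeMap K T fun _ => true).toRingHom := by
      refine MvPolynomial.ringHom_ext (fun r => ?_) ?_
      · simp [e]
      · rintro ⟨i, j⟩
        by_cases hj : j ∈ T
        · have : κ (X (i, j)) = 0 := by
            fin_cases i
            · exact hI'0 j hj
            · change κ (X (1, j)) = 0
              rw [hκ1, hI'0 j hj, mul_zero]
          simpa [slopeMap, hj] using this
        · fin_cases i
          · simp [slopeMap, hj, e]
          · simpa [slopeMap, hj, e] using hκ1 j
    change κ s = 0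
    rw [hκ, RingHom.comp_apply]
    exact (congrArg e (RingHom.mem_ker.mp hs)).trans (map_zero e)
  · intro h
    have h0 : u - u' = 0 := by
      rw [← Ideal.span_singleton_eq_bot]; exact h
    refine hne' (X (0, d) * X (1, a) - X (0, a) * X (1, d)) ?_ ?_
    · have h1 : side a = true := by simp [side]
      have h2 : side d = false := decide_eq_false (by rw [Fin.le_def]; omega)
      simp only [slopeMap, map_sub, map_mul, aeval_X, haT, hdT, if_false, side] at h1 h2 ⊢
      simp only [h1, h2]
      simp only [one_ne_zero, if_false, if_true]
      intro h
      have h3 := congrArg (aeval (R := K) (Sum.elim (fun _ => (1 : K))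
        fun b => if b then 1 else 0)) h
      simp at h3
    · rw [map_sub, map_mul, map_mul, hu, hu', sub_eq_zero.mp h0]
      ring
  · intro h
    let t : Fin n := ⟨a.val + 1, by omega⟩
    have htT : t ∈ T := by constructor <;> simp only [Fin.lt_def, t] <;> omega
    have h1 : ι (X (0, t)) ∈ I' := Ideal.subset_span ⟨t, htT, rfl⟩
    rw [h, Submodule.mem_bot] at h1
    refine hne (X (0, t)) ?_ h1
    simp [slopeMap]

/-- The Cohen-Macaulay property forces consecutive cliques to meet in one vertex: otherwise the
local ring at the prime of rank-one matrices vanishing on the overlap would violate Hartshorne's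
connectedness theorem. -/
theorem IsClosedGraph.adj_of_isCohenMacaulayRing {K : Type*} [Field K] {n : ℕ}
    {G : SimpleGraph (Fin n)} (hG : IsClosedGraph G) (hconn : G.Connected)
    (hCM : IsCohenMacaulayRing (MvPolynomial (Fin 2 × Fin n) K ⧸
      edgeIdeal K (⊤ : SimpleGraph (Fin 2)) G))
    {a b c d : Fin n} (hab : a < b) (hbc : b < c) (hcd : c < d)
    (hac : G.Adj a c) (hbd : G.Adj b d) : G.Adj a d := by
  by_contra had
  obtain ⟨a, d, hgap, had, hT⟩ := hG.exists_separating_interval hab hbc hcd hac hbd had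
  clear hab hbc hcd hac hbd b c
  set J := edgeIdeal K (⊤ : SimpleGraph (Fin 2)) G
  let T : Set (Fin n) := Set.Ioo a d
  let t : Fin n := ⟨a.val + 1, by omega⟩
  let t' : Fin n := ⟨a.val + 2, by omega⟩
  have htT : t ∈ T := by constructor <;> simp only [Fin.lt_def, t] <;> omega
  have ht'T : t' ∈ T := by constructor <;> simp only [Fin.lt_def, t'] <;> omega
  have htt' : t' ≠ t := by simp [t, t']
  let side : Fin n → Bool := fun j => decide (j ≤ a)
  let L (U : Set (Fin n)) : (MvPolynomial (Fin 2 × Fin n) K ⧸ J) →+*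
      MvPolynomial (Fin n ⊕ Bool) K :=
    Ideal.Quotient.lift J (slopeMap K U fun _ => true).toRingHom fun x hx =>
      edgeIdeal_le_ker_slopeMap K (fun _ _ _ _ _ => rfl) hx
  have hside : J ≤ RingHom.ker (slopeMap K T side) := by
    apply edgeIdeal_le_ker_slopeMap
    have : ∀ k l, G.Adj k l → k ≤ a → d ≤ l → False := fun k l hkl hk hl =>
      had (hG.adj_of_le hkl hk (by simp only [Fin.lt_def]; omega) hl)
    intro k l hkl hk hl
    simp only [side, decide_eq_decide]
    constructor
    · intro h
      by_contra h'
      exact this k l hkl h (not_lt.mp fun h'' => hl ⟨not_le.mp h', h''⟩)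
    · intro h
      by_contra h'
      exact this l k hkl.symm h (not_lt.mp fun h'' => hk ⟨not_le.mp h', h''⟩)
  let Lψ : (MvPolynomial (Fin 2 × Fin n) K ⧸ J) →+* MvPolynomial (Fin n ⊕ Bool) K :=
    Ideal.Quotient.lift J (slopeMap K T side).toRingHom fun x hx => hside hx
  have hL (U s) : L U (Ideal.Quotient.mk J s) = slopeMap K U (fun _ => true) s := rfl
  have hLψ (s) : Lψ (Ideal.Quotient.mk J s) = slopeMap K T side s := rfl
  have hmono {U U' : Set (Fin n)} (h : U ⊆ U') : RingHom.ker (L U) ≤ RingHom.ker (L U') := by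
    intro r hr
    obtain ⟨s, rfl⟩ := Ideal.Quotient.mk_surjective r
    rw [RingHom.mem_ker, hL] at hr ⊢
    exact RingHom.mem_ker.mp (ker_slopeMap_le K h _ (RingHom.mem_ker.mpr hr))
  have hmonoψ : RingHom.ker Lψ ≤ RingHom.ker (L T) := by
    intro r hr
    obtain ⟨s, rfl⟩ := Ideal.Quotient.mk_surjective r
    rw [RingHom.mem_ker, hL]
    rw [RingHom.mem_ker, hLψ] at hr
    exact RingHom.mem_ker.mp (ker_slopeMap_le K subset_rfl _ (RingHom.mem_ker.mpr hr))
  have hlt {U U' : Set (Fin n)} (h : U ⊆ U') {j : Fin n} (hj : j ∈ U') (hj' : j ∉ U) :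
      RingHom.ker (L U) < RingHom.ker (L U') := by
    refine lt_of_le_not_ge (hmono h) fun hle => ?_
    have h1 : Ideal.Quotient.mk J (X (0, j)) ∈ RingHom.ker (L U') := by
      rw [RingHom.mem_ker, hL]; simp [slopeMap, hj]
    have h2 := hle h1
    rw [RingHom.mem_ker, hL] at h2
    simp [slopeMap, hj'] at h2
  have hp (U) : (RingHom.ker (L U)).IsPrime := RingHom.ker_isPrime _
  let p := RingHom.ker (L T)
  have : p.IsPrime := hp T
  obtain ⟨rs, hrs, hdim⟩ := hCM.2 p
  -- The chain of primes obtained by killing no column, one column and all columns of the overlap.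
  have hheight : (2 : ℕ∞) ≤ p.height := by
    have := hp ∅
    have := hp {t}
    have h1 := Ideal.height_add_one_le_of_lt_of_isPrime
      (hlt (Set.empty_subset {t}) (Set.mem_singleton t) (Set.notMem_empty t))
    have h2 := Ideal.height_add_one_le_of_lt_of_isPrime
      (hlt (Set.singleton_subset_iff.mpr htT) ht'T (by simpa using htt'))
    calc (2 : ℕ∞) ≤ (RingHom.ker (L ∅)).height + 1 + 1 := by
          rw [add_assoc, one_add_one_eq_two]; exact le_add_self
      _ ≤ _ := (add_le_add_left h1 1).trans h2
  rw [IsLocalization.AtPrime.ringKrullDim_eq_height p, WithBot.coe_inj] at hdim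
  have hlen : 2 ≤ rs.length := by
    rw [← hdim] at hheight
    exact_mod_cast hheight
  have hnz (φ : (MvPolynomial (Fin 2 × Fin n) K ⧸ J) →+*
      MvPolynomial (Fin n ⊕ Bool) K) (hφ : RingHom.ker φ ≤ p) (s)
      (hs : φ (Ideal.Quotient.mk J s) ≠ 0) :
      (algebraMap _ (Localization.AtPrime p)).comp (Ideal.Quotient.mk J) s ≠ 0 := by
    intro h
    obtain ⟨⟨w, hw⟩, hws⟩ := (IsLocalization.map_eq_zero_iff p.primeCompl (Localization.AtPrime p) _).mp h
    have h1 := congrArg φ hws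
    rw [map_mul, map_zero] at h1
    exact hw (hφ ((mul_eq_zero.mp h1).resolve_right hs))
  refine absurd (length_le_one_of_separating_interval (a := a) (d := d) hG hconn (by omega) hT
    ((algebraMap _ (Localization.AtPrime p)).comp (Ideal.Quotient.mk J)) ?_ ?_ ?_ ?_ ?_ hrs)
    (by omega)
  · intro s hs
    rw [RingHom.comp_apply, Ideal.Quotient.eq_zero_iff_mem.mpr hs, map_zero]
  · intro j hj
    refine IsLocalization.map_units (Localization.AtPrime p)
      (⟨Ideal.Quotient.mk J (X (0, j)), ?_⟩ : p.primeCompl)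
    change _ ∉ RingHom.ker (L T)
    rw [RingHom.mem_ker, hL]
    have hj' : j ∉ T := hj
    simp [slopeMap, hj']
  · rw [← Localization.AtPrime.map_eq_maximalIdeal, Ideal.map_le_iff_le_comap]
    intro r hr
    obtain ⟨s, rfl⟩ := Ideal.Quotient.mk_surjective r
    exact Ideal.mem_map_of_mem ((algebraMap _ (Localization.AtPrime p)).comp
      (Ideal.Quotient.mk J)) (RingHom.mem_ker.mpr ((hL T s).symm.trans hr))
  · exact fun s hs => hnz (L ∅) (hmono (Set.empty_subset _)) s hs
  · exact fun s hs => hnz Lψ hmonoψ s hs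

/-! ### Chains of cliques -/

/-- The graph `G` is a chain of cliques, consecutive ones glued along the vertices in `B`: two
vertices are adjacent unless some gluing vertex lies strictly between them. -/
structure IsCliqueChain {n : ℕ} (G : SimpleGraph (Fin n)) (B : Finset (Fin n)) : Prop where
  pos : ∀ b ∈ B, 0 < b.val
  lt : ∀ b ∈ B, b.val + 1 < n
  adj_iff : ∀ u w, u < w → (G.Adj u w ↔ ∀ b ∈ B, ¬ (u < b ∧ b < w))

/-- The set `T` consists of gluing vertices, no two of which are consecutive integers; this
describes the cut sets of a chain of cliques. -/
structure IsSparse {n : ℕ} (B T : Finset (Fin n)) : Prop where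
  subset : T ⊆ B
  ne : ∀ σ ∈ T, ∀ τ ∈ T, σ.val + 1 ≠ τ.val

/-- A connected closed graph whose cliques overlap in at most one vertex is a chain of cliques. The
gluing vertices `b` are those for which `b - 1` and `b + 1` are not adjacent. -/
theorem IsClosedGraph.exists_isCliqueChain {n : ℕ} {G : SimpleGraph (Fin n)}
    (hG : IsClosedGraph G) (hconn : G.Connected)
    (h4 : ∀ a b c d : Fin n, a < b → b < c → c < d → G.Adj a c → G.Adj b d → G.Adj a d) :
    ∃ B, IsCliqueChain G B := by
  let B : Finset (Fin n) := Finset.univ.filter fun b =>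
    ∃ u w : Fin n, u.val + 1 = b.val ∧ b.val + 1 = w.val ∧ ¬ G.Adj u w
  have hB : ∀ b, b ∈ B ↔ ∃ u w : Fin n, u.val + 1 = b.val ∧ b.val + 1 = w.val ∧ ¬ G.Adj u w := by
    simp [B]
  refine ⟨B, ?_, ?_, ?_⟩
  · intro b hb
    obtain ⟨u, w, h1, -⟩ := (hB b).mp hb
    omega
  · intro b hb
    obtain ⟨u, w, -, h2, -⟩ := (hB b).mp hb
    omega
  · intro u w huw
    constructor
    · rintro h b hb ⟨hub, hbw⟩
      obtain ⟨x, y, h1, h2, h3⟩ := (hB b).mp hb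
      refine h3 (hG.adj_of_le h ?_ ?_ ?_) <;> simp only [Fin.lt_def, Fin.le_def] at * <;> omega
    · suffices H : ∀ (r : ℕ) (w : Fin n), u.val + 1 + r = w.val →
          (∀ b ∈ B, ¬ (u < b ∧ b < w)) → G.Adj u w from
        H (w.val - (u.val + 1)) w (by simp only [Fin.lt_def] at huw; omega)
      intro r
      induction r with
      | zero => exact fun w hw _ => hG.adj_of_val_add_one hconn hw
      | succ r ih =>
        intro w hw hb
        let v : Fin n := ⟨w.val - 1, by omega⟩
        let x : Fin n := ⟨w.val - 2, by omega⟩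
        have huv : G.Adj u v := by
          refine ih v (by simp only [v]; omega) fun b hbB hub => hb b hbB ⟨hub.1, hub.2.trans ?_⟩
          simp only [v, Fin.lt_def]; omega
        have hxw : G.Adj x w := by
          by_contra hxw
          refine hb v ((hB v).mpr ⟨x, w, ?_, ?_, hxw⟩) ⟨?_, ?_⟩ <;>
            simp only [v, x, Fin.lt_def] <;> omega
        rcases r.eq_zero_or_pos with rfl | hr
        · convert hxw using 1
          ext; simp only [x]; omega
        · exact h4 u x v w (by simp only [x, Fin.lt_def]; omega)
            (by simp only [x, v, Fin.lt_def]; omega) (by simp only [v, Fin.lt_def]; omega) huv hxw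

namespace IsCliqueChain

variable {n : ℕ} {G : SimpleGraph (Fin n)} {B T : Finset (Fin n)}

theorem mem_spine_iff (h : IsCliqueChain G B) (v : Fin n) :
    v ∈ spine G ↔ v ∈ B ∨ v.val = 0 ∨ v.val + 1 = n := by
  have hadj := h.adj_iff
  constructor
  · intro hv
    obtain ⟨F, hF, hl | hg⟩ := (Finset.mem_filter.mp hv).2
    · by_contra! hcon
      let x : Fin n := ⟨v.val - 1, by omega⟩
      have hx : ∀ y ∈ F, x ≠ y → G.Adj x y := by
        intro y hy _
        have hvy : v ≤ y := hl.2 hy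
        rw [hadj x y (by simp only [x, Fin.lt_def, Fin.le_def] at *; omega)]
        rintro b hb ⟨hxb, hby⟩
        have hne : v ≠ b := by rintro rfl; exact hcon.1 hb
        have hvb : v < b := by
          simp only [x, Fin.lt_def, ne_eq, Fin.ext_iff] at *; omega
        exact (hadj v y (hvb.trans hby)).mp
          (hF.1 hl.1 hy (hvb.trans hby).ne) b hb ⟨hvb, hby⟩
      have hins : insert x F ≤ F :=
        hF.2 (hF.1.insert hx) (Set.subset_insert x F)
      have := hl.2 (hins (Set.mem_insert x F))
      simp only [x, Fin.le_def] at this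
      omega
    · by_contra! hcon
      have := v.isLt
      let x : Fin n := ⟨v.val + 1, by omega⟩
      have hx : ∀ y ∈ F, x ≠ y → G.Adj x y := by
        intro y hy _
        have hvy : y ≤ v := hg.2 hy
        refine G.adj_symm ?_
        rw [hadj y x (by simp only [x, Fin.lt_def, Fin.le_def] at *; omega)]
        rintro b hb ⟨hyb, hbx⟩
        have hne : v ≠ b := by rintro rfl; exact hcon.1 hb
        have hbv : b < v := by
          simp only [x, Fin.lt_def, ne_eq, Fin.ext_iff] at *; omega
        exact (hadj y v (hyb.trans hbv)).mp
          (hF.1 hy hg.1 (hyb.trans hbv).ne) b hb ⟨hyb, hbv⟩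
      have hins : insert x F ≤ F :=
        hF.2 (hF.1.insert hx) (Set.subset_insert x F)
      have := hg.2 (hins (Set.mem_insert x F))
      simp only [x, Fin.le_def] at this
      omega
  · intro hv
    refine Finset.mem_filter.mpr ⟨Finset.mem_univ _, ?_⟩
    rcases Nat.lt_or_ge (v.val + 1) n with hvn | hvn
    · let F : Set (Fin n) := {w | w = v ∨ (v < w ∧ G.Adj v w)}
      let x : Fin n := ⟨v.val + 1, hvn⟩
      have hvx : v < x := by simp only [x, Fin.lt_def]; omega
      have hxF : x ∈ F := by
        refine Or.inr ⟨hvx, (hadj v x hvx).mpr ?_⟩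
        rintro b - ⟨h1, h2⟩
        simp only [x, Fin.lt_def] at h1 h2
        omega
      refine ⟨F, ⟨?_, ?_⟩, Or.inl ⟨Or.inl rfl, ?_⟩⟩
      · have key : ∀ y z, y ∈ F → z ∈ F → y < z → G.Adj y z := by
          rintro y z hy (rfl | ⟨hvz, hz⟩) hyz
          · rcases hy with rfl | ⟨hvy, -⟩
            · exact absurd hyz (lt_irrefl _)
            · exact absurd hyz hvy.not_gt
          · refine (hadj y z hyz).mpr ?_
            rintro b hb ⟨h1, h2⟩
            refine (hadj v z hvz).mp hz b hb ⟨lt_of_le_of_lt ?_ h1, h2⟩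
            rcases hy with rfl | ⟨hvy, -⟩
            · exact le_rfl
            · exact hvy.le
        intro y hy z hz hne
        rcases hne.lt_or_gt with hyz | hyz
        · exact key y z hy hz hyz
        · exact (key z y hz hy hyz).symm
      · intro F' hF' hle y hy
        by_cases hyv : y = v
        · exact Or.inl hyv
        have hvy := hF' (hle (Or.inl rfl)) hy (Ne.symm hyv)
        rcases lt_or_gt_of_ne hyv with hlt | hlt
        · exfalso
          have hyx := hF' hy (hle hxF) (hlt.trans hvx).ne
          rcases hv with hv | hv | hv
          · exact (hadj y x (hlt.trans hvx)).mp hyx v hv ⟨hlt, hvx⟩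
          · simp only [Fin.lt_def] at hlt; omega
          · omega
        · exact Or.inr ⟨hlt, hvy⟩
      · rintro y (rfl | ⟨hy, -⟩)
        · exact le_rfl
        · exact hy.le
    · have hmax : ∀ y, y ≠ v → y < v := by
        intro y hy
        have := y.isLt
        simp only [ne_eq, Fin.ext_iff, Fin.lt_def] at *
        omega
      let F : Set (Fin n) := {w | w = v ∨ G.Adj w v}
      refine ⟨F, ⟨?_, ?_⟩, Or.inr ⟨Or.inl rfl, ?_⟩⟩
      · have key : ∀ y z, y ∈ F → z ∈ F → y < z → G.Adj y z := by
          rintro y z (rfl | hy) hz hyz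
          · rcases eq_or_ne z y with rfl | hne
            · exact absurd hyz (lt_irrefl _)
            · exact absurd hyz (hmax z hne).not_gt
          · refine (hadj y z hyz).mpr ?_
            rintro b hb ⟨h1, h2⟩
            refine (hadj y v (hmax y hy.ne)).mp hy b hb ⟨h1, ?_⟩
            rcases hz with rfl | hz
            · exact h2
            · exact h2.trans (hmax z hz.ne)
        intro y hy z hz hne
        rcases hne.lt_or_gt with hyz | hyz
        · exact key y z hy hz hyz
        · exact (key z y hz hy hyz).symm
      · intro F' hF' hle y hy
        by_cases hyv : y = v
        · exact Or.inl hyv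
        · exact Or.inr (hF' hy (hle (Or.inl rfl)) hyv)
      · intro y _
        rcases eq_or_ne y v with rfl | hne
        · exact le_rfl
        · exact (hmax y hne).le

theorem adj_of_val_add_one (h : IsCliqueChain G B) {u w : Fin n} (huw : u.val + 1 = w.val) :
    G.Adj u w := by
  refine (h.adj_iff u w (by simp only [Fin.lt_def]; omega)).mpr ?_
  rintro b - ⟨h1, h2⟩
  simp only [Fin.lt_def] at h1 h2
  omega

end IsCliqueChain

/-! ### Cut sets of a chain of cliques -/

/-- Deleting a vertex whose remaining neighbours are pairwise adjacent does not increase the number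
of connected components. -/
theorem numComponents_le_of_pairwise_adj {n : ℕ} {G : SimpleGraph (Fin n)} {T : Finset (Fin n)}
    {v : Fin n} (h : ∀ x y, x ∉ T → y ∉ T → G.Adj v x → G.Adj v y → x ≠ y → G.Adj x y) :
    numComponents G T ≤ numComponents G (T.erase v) := by
  let φ : removeVerts G T →g removeVerts G (T.erase v) :=
    ⟨fun x => ⟨x.1, fun hx => x.2 (Finset.mem_of_mem_erase hx)⟩, fun {x y} hxy => hxy⟩
  have hinj : Function.Injective
      (SimpleGraph.ConnectedComponent.map φ) := by
    -- Colour each vertex other than `v` by its component, and `v` by the component of its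
    -- neighbours.
    have hsubst : ∀ p q : Fin n, p = v → G.Adj p q → G.Adj v q := fun p q hp hpq => hp ▸ hpq
    let near (y : Fin n) (c : (removeVerts G T).ConnectedComponent) : Prop :=
      ∃ x, ∃ hx : x ∉ T, ((y ∉ T ∧ x = y) ∨ (y = v ∧ G.Adj v x)) ∧
        c = (removeVerts G T).connectedComponentMk ⟨x, hx⟩
    have huniq : v ∈ T → ∀ y c c', near y c → near y c' → c = c' := by
      rintro hv y c c' ⟨x, hx, hxy, rfl⟩ ⟨x', hx', hxy', rfl⟩
      rcases hxy with ⟨hy, rfl⟩ | ⟨rfl, hxv⟩ <;> rcases hxy' with ⟨hy', rfl⟩ | ⟨hyv, hxv'⟩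
      · rfl
      · exact absurd (hyv ▸ hv) hy
      · exact absurd hv hy'
      · rcases eq_or_ne x x' with rfl | hne
        · rfl
        · exact SimpleGraph.ConnectedComponent.sound
            (SimpleGraph.Adj.reachable (h x x' hx hx' hxv hxv' hne))
    intro c c'
    refine SimpleGraph.ConnectedComponent.ind₂ (fun x y hxy => ?_) c c'
    by_cases hv : v ∈ T
    · obtain ⟨p⟩ := SimpleGraph.ConnectedComponent.exact hxy
      suffices H : ∀ (a b : {u : Fin n | u ∉ T.erase v}) (_ : (removeVerts G (T.erase v)).Walk a b)
          (c c' : (removeVerts G T).ConnectedComponent), near a c → near b c' → c = c' from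
        H _ _ p _ _ ⟨x.1, x.2, Or.inl ⟨x.2, rfl⟩, rfl⟩ ⟨y.1, y.2, Or.inl ⟨y.2, rfl⟩, rfl⟩
      intro a b p
      induction p with
      | nil => exact fun c c' => huniq hv _ c c'
      | @cons a b d hab p ih =>
        have hab' : G.Adj a.1 b.1 := hab
        intro c c' hc hc'
        have hT (z : {u : Fin n | u ∉ T.erase v}) (hz : z.1 ≠ v) : z.1 ∉ T := fun hzT =>
          z.2 (Finset.mem_erase.mpr ⟨hz, hzT⟩)
        by_cases ha : a.1 = v
        · have hb : b.1 ∉ T := hT b fun hb => hab'.ne (ha.trans hb.symm)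
          refine ih c c' ?_ hc'
          have h1 : near a.1 ((removeVerts G T).connectedComponentMk ⟨b.1, hb⟩) :=
            ⟨b.1, hb, Or.inr ⟨ha, hsubst _ _ ha hab'⟩, rfl⟩
          exact ⟨b.1, hb, Or.inl ⟨hb, rfl⟩, huniq hv _ _ _ hc h1⟩
        · have haT := hT a ha
          have hca : c = (removeVerts G T).connectedComponentMk ⟨a.1, haT⟩ :=
            huniq hv _ _ _ hc ⟨a.1, haT, Or.inl ⟨haT, rfl⟩, rfl⟩
          refine ih c c' ?_ hc'
          by_cases hb : b.1 = v
          · exact ⟨a.1, haT, Or.inr ⟨hb, hsubst _ _ hb hab'.symm⟩, hca⟩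
          · have hbT := hT b hb
            refine ⟨b.1, hbT, Or.inl ⟨hbT, rfl⟩, hca.trans ?_⟩
            exact SimpleGraph.ConnectedComponent.sound (SimpleGraph.Adj.reachable hab')
    · obtain ⟨p⟩ := SimpleGraph.ConnectedComponent.exact hxy
      have hT : ∀ z, z ∉ T.erase v → z ∉ T := fun z hz hzT =>
        hz (by rwa [Finset.erase_eq_of_notMem hv])
      let ψ : removeVerts G (T.erase v) →g removeVerts G T :=
        ⟨fun x => ⟨x.1, hT x.1 x.2⟩, fun {x y} hxy => hxy⟩
      exact SimpleGraph.ConnectedComponent.sound ⟨p.map ψ⟩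
  exact Nat.card_le_card_of_injective _ hinj

theorem IsCliqueChain.isSparse_of_isCutSet {n : ℕ} {G : SimpleGraph (Fin n)}
    {B T : Finset (Fin n)} (h : IsCliqueChain G B) (hT : IsCutSet G T) : IsSparse B T := by
  have key : ∀ v ∈ T, ∃ x y, x ∉ T ∧ y ∉ T ∧ G.Adj v x ∧ G.Adj v y ∧ x < y ∧ ¬ G.Adj x y := by
    intro v hv
    by_contra! hcon
    refine absurd (numComponents_le_of_pairwise_adj (T := T) (v := v) ?_) (not_le.mpr (hT v hv))
    intro x y hx hy hvx hvy hne
    rcases hne.lt_or_gt with hlt | hlt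
    · exact hcon x y hx hy hvx hvy hlt
    · exact (hcon y x hy hx hvy hvx hlt).symm
  -- Nonadjacent neighbours of `v` lie on different sides of it, and `v` separates them.
  have key' : ∀ v ∈ T, v ∈ B ∧ ∃ x y, x ∉ T ∧ y ∉ T ∧ G.Adj x v ∧ G.Adj v y ∧ x < v ∧ v < y := by
    intro v hv
    obtain ⟨x, y, hx, hy, hvx, hvy, hxy, hnadj⟩ := key v hv
    rw [h.adj_iff x y hxy] at hnadj
    push Not at hnadj
    obtain ⟨b, hb, hxb, hby⟩ := hnadj
    have hxv : x < v := by
      by_contra hle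
      have hlt := lt_of_le_of_ne (not_lt.mp hle) hvx.ne
      exact (h.adj_iff v y (hlt.trans hxy)).mp hvy b hb ⟨hlt.trans hxb, hby⟩
    have hyv : v < y := by
      by_contra hle
      have hlt := lt_of_le_of_ne (not_lt.mp hle) hvy.ne'
      exact (h.adj_iff x v hxv).mp hvx.symm b hb ⟨hxb, hby.trans hlt⟩
    obtain rfl : b = v := by
      rcases lt_trichotomy b v with hlt | heq | hlt
      · exact absurd ⟨hxb, hlt⟩ ((h.adj_iff x v hxv).mp hvx.symm b hb)
      · exact heq
      · exact absurd ⟨hlt, hby⟩ ((h.adj_iff v y hyv).mp hvy b hb)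
    exact ⟨hb, x, y, hx, hy, hvx.symm, hvy, hxv, hyv⟩
  refine ⟨fun v hv => (key' v hv).1, fun σ hσ τ hτ hστ => ?_⟩
  obtain ⟨-, x, y, -, hy, -, hadj, -, hlt⟩ := key' σ hσ
  have hne : y ≠ τ := by rintro rfl; exact hy hτ
  refine (h.adj_iff σ y hlt).mp hadj τ (key' τ hτ).1 ⟨?_, ?_⟩ <;>
    simp only [Fin.lt_def, ne_eq, Fin.ext_iff] at * <;> omega

/-! ### Components after deleting a cut set -/

/-- The number of elements of `T` below `j`. For `j ∉ T` in a chain of cliques, this is the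
index, from left to right, of the connected component of `j` in `G \ T`. -/
noncomputable def color {n : ℕ} (T : Finset (Fin n)) (j : Fin n) : ℕ := (T.filter (· < j)).card

section color

variable {n : ℕ} {T : Finset (Fin n)} {i j τ : Fin n}

theorem color_mono (h : i ≤ j) : color T i ≤ color T j :=
  Finset.card_le_card (Finset.monotone_filter_right T fun _ _ hx => lt_of_lt_of_le hx h)

theorem color_lt (hτ : τ ∈ T) (hi : i ≤ τ) (hj : τ < j) : color T i < color T j := by
  refine Finset.card_lt_card ⟨Finset.monotone_filter_right T fun x _ hx => hx.trans_le
    (hi.trans hj.le), fun hle => ?_⟩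
  have := Finset.mem_filter.mp (hle (Finset.mem_filter.mpr ⟨hτ, hj⟩))
  exact absurd this.2 hi.not_gt

theorem color_eq_iff (hij : i ≤ j) : color T i = color T j ↔ ∀ τ ∈ T, i ≤ τ → j ≤ τ := by
  constructor
  · intro h τ hτ hi
    by_contra hj
    exact (color_lt hτ hi (not_le.mp hj)).ne h
  · intro h
    refine congrArg Finset.card (Finset.filter_congr fun τ hτ => ⟨fun hi => hi.trans_le hij,
      fun hj => ?_⟩)
    by_contra hi
    exact (h τ hτ (not_lt.mp hi)).not_gt hj

theorem color_succ (hτ : τ ∈ T) (hj : τ < j) (h : ∀ σ ∈ T, τ < σ → j ≤ σ) :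
    color T j = color T τ + 1 := by
  have : T.filter (· < j) = insert τ (T.filter (· < τ)) := by
    ext σ
    simp only [Finset.mem_filter, Finset.mem_insert]
    constructor
    · rintro ⟨hσ, hσj⟩
      rcases lt_trichotomy σ τ with h1 | h1 | h1
      · exact Or.inr ⟨hσ, h1⟩
      · exact Or.inl h1
      · exact absurd hσj (h σ hσ h1).not_gt
    · rintro (rfl | ⟨hσ, hlt⟩)
      · exact ⟨hτ, hj⟩
      · exact ⟨hσ, hlt.trans hj⟩
  rw [color, this, Finset.card_insert_of_notMem (by simp)]
  rfl

theorem color_injOn : Set.InjOn (color T) T := by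
  intro σ hσ τ hτ h
  rcases lt_trichotomy σ τ with h1 | h1 | h1
  · exact absurd h (color_lt hσ le_rfl h1).ne
  · exact h1
  · exact absurd h (color_lt hτ le_rfl h1).ne'

theorem lt_of_color_lt (h : color T i < color T j) : i < j := by
  by_contra hle
  exact (color_mono (not_lt.mp hle)).not_gt h

theorem color_lt_card (hτ : τ ∈ T) : color T τ < T.card :=
  Finset.card_lt_card (Finset.filter_ssubset.mpr ⟨τ, hτ, lt_irrefl _⟩)

theorem exists_color_eq {k : ℕ} (hk : k < T.card) : ∃ τ ∈ T, color T τ = k := by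
  have himg : T.image (color T) = Finset.range T.card := by
    apply Finset.eq_of_subset_of_card_le
    · intro k hk
      obtain ⟨τ, hτ, rfl⟩ := Finset.mem_image.mp hk
      exact Finset.mem_range.mpr (color_lt_card hτ)
    · rw [Finset.card_image_of_injOn color_injOn, Finset.card_range]
  have := himg ▸ Finset.mem_range.mpr hk
  exact Finset.mem_image.mp this

end color

namespace IsCliqueChain

variable {n : ℕ} {G : SimpleGraph (Fin n)} {B T : Finset (Fin n)}

theorem color_eq_of_adj (h : IsCliqueChain G B) (hT : T ⊆ B) {u w : Fin n} (hadj : G.Adj u w)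
    (hu : u ∉ T) (hw : w ∉ T) : color T u = color T w := by
  have key : ∀ u w, u < w → G.Adj u w → u ∉ T → color T u = color T w := by
    intro u w huw hadj hu
    refine (color_eq_iff huw.le).mpr fun τ hτ huτ => ?_
    by_contra hlt
    exact (h.adj_iff u w huw).mp hadj τ (hT hτ)
      ⟨lt_of_le_of_ne huτ fun e => hu (e ▸ hτ), not_le.mp hlt⟩
  rcases hadj.ne.lt_or_gt with hlt | hlt
  · exact key u w hlt hadj hu
  · exact (key w u hlt hadj.symm hw).symm

theorem reachable_iff (h : IsCliqueChain G B) (hT : T ⊆ B) (x y : {v : Fin n | v ∉ T}) :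
    (removeVerts G T).Reachable x y ↔ color T x = color T y := by
  constructor
  · rintro ⟨p⟩
    induction p with
    | nil => rfl
    | @cons a b c hab p ih => exact (h.color_eq_of_adj hT hab a.2 b.2).trans ih
  · have key : ∀ (r : ℕ) (x y : {v : Fin n | v ∉ T}), x.1.val + r = y.1.val →
        color T x = color T y → (removeVerts G T).Reachable x y := by
      intro r
      induction r with
      | zero =>
        intro x y hxy _
        obtain rfl : x = y := Subtype.ext (Fin.ext hxy)
        exact SimpleGraph.Reachable.refl _
      | succ r ih =>
        intro x y hxy hc
        have hle : x.1 ≤ y.1 := by rw [Fin.le_def]; omega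
        have hyn := y.1.isLt
        let z : Fin n := ⟨x.1.val + 1, by omega⟩
        have hz : z ∉ T := by
          intro hz
          have hyz := (color_eq_iff hle).mp hc z hz (by rw [Fin.le_def]; simp only [z]; omega)
          have : y.1 = z := by
            ext
            rw [Fin.le_def] at hyz
            simp only [z] at hyz ⊢
            omega
          exact y.2 (this ▸ hz)
        have hxz : (removeVerts G T).Adj x ⟨z, hz⟩ := h.adj_of_val_add_one rfl
        refine hxz.reachable.trans (ih ⟨z, hz⟩ y (by simp only [z]; omega) ?_)
        exact (h.color_eq_of_adj hT hxz x.2 hz).symm.trans hc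
    intro hc
    rcases le_total x.1 y.1 with hle | hle
    · exact key (y.1.val - x.1.val) x y (by rw [Fin.le_def] at hle; omega) hc
    · exact (key (x.1.val - y.1.val) y x (by rw [Fin.le_def] at hle; omega) hc.symm).symm

/-! ### The graph `L(T)` of a chain of cliques -/

theorem spinePrev_spec (h : IsCliqueChain G B) {τ : Fin n} (hτ : 0 < τ.val) :
    spinePrev G τ ∈ spine G ∧ spinePrev G τ < τ ∧
      ∀ s ∈ spine G, ¬ (spinePrev G τ < s ∧ s < τ) := by
  have hne : ((spine G).filter (· < τ)).Nonempty := by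
    refine ⟨⟨0, by omega⟩, Finset.mem_filter.mpr ⟨?_, ?_⟩⟩
    · exact (h.mem_spine_iff _).mpr (Or.inr (Or.inl rfl))
    · rw [Fin.lt_def]; exact hτ
  rw [spinePrev, dif_pos hne]
  have hmem := Finset.mem_filter.mp (Finset.max'_mem _ hne)
  refine ⟨hmem.1, hmem.2, fun s hs hlt => ?_⟩
  exact (Finset.le_max' _ s (Finset.mem_filter.mpr ⟨hs, hlt.2⟩)).not_gt hlt.1

theorem spineNext_spec (h : IsCliqueChain G B) {τ : Fin n} (hτ : τ.val + 1 < n) :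
    spineNext G τ ∈ spine G ∧ τ < spineNext G τ ∧
      ∀ s ∈ spine G, ¬ (τ < s ∧ s < spineNext G τ) := by
  have hne : ((spine G).filter (τ < ·)).Nonempty := by
    refine ⟨⟨n - 1, by omega⟩, Finset.mem_filter.mpr ⟨?_, ?_⟩⟩
    · exact (h.mem_spine_iff _).mpr (Or.inr (Or.inr (by simp only; omega)))
    · rw [Fin.lt_def]; simp only; omega
  rw [spineNext, dif_pos hne]
  have hmem := Finset.mem_filter.mp (Finset.min'_mem _ hne)
  refine ⟨hmem.1, hmem.2, fun s hs hlt => ?_⟩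
  exact (Finset.min'_le _ s (Finset.mem_filter.mpr ⟨hs, hlt.1⟩)).not_gt hlt.2

theorem spineNext_eq (h : IsCliqueChain G B) {s τ : Fin n} (hτ : τ ∈ spine G) (hlt : s < τ)
    (hgap : ∀ x ∈ spine G, ¬ (s < x ∧ x < τ)) : spineNext G s = τ := by
  obtain ⟨h1, h2, h3⟩ := h.spineNext_spec (τ := s) (by have := τ.isLt; rw [Fin.lt_def] at hlt; omega)
  rcases lt_trichotomy (spineNext G s) τ with h4 | h4 | h4
  · exact absurd ⟨h2, h4⟩ (hgap _ h1)
  · exact h4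
  · exact absurd ⟨hlt, h4⟩ (h3 _ hτ)

theorem spinePrev_eq (h : IsCliqueChain G B) {s τ : Fin n} (hs : s ∈ spine G) (hlt : s < τ)
    (hgap : ∀ x ∈ spine G, ¬ (s < x ∧ x < τ)) : spinePrev G τ = s := by
  obtain ⟨h1, h2, h3⟩ := h.spinePrev_spec (τ := τ) (by rw [Fin.lt_def] at hlt; omega)
  rcases lt_trichotomy (spinePrev G τ) s with h4 | h4 | h4
  · exact absurd ⟨h4, hlt⟩ (h3 _ hs)
  · exact h4
  · exact absurd ⟨h4, h2⟩ (hgap _ h1)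

end IsCliqueChain

theorem val_succ_of_lt {n : ℕ} {p q : Fin n} (h : p < q) : (Order.succ p).val = p.val + 1 := by
  have h1 : p < Order.succ p := Order.lt_succ_of_not_isMax fun hm => hm.not_lt h
  have h2 : Order.succ p ≤ ⟨p.val + 1, by have := q.isLt; rw [Fin.lt_def] at h; omega⟩ :=
    Order.succ_le_of_lt (by rw [Fin.lt_def]; simp)
  rw [Fin.lt_def] at h1
  rw [Fin.le_def] at h2
  simp only at h2
  omega

section links

variable {n : ℕ} {G : SimpleGraph (Fin n)} {B T : Finset (Fin n)} {τ : Fin n}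

namespace IsCliqueChain

theorem subset_spine (h : IsCliqueChain G B) : B ⊆ spine G :=
  fun _ hb => (h.mem_spine_iff _).mpr (Or.inl hb)

theorem alpha_lt (h : IsCliqueChain G B) (hT : IsSparse B T) (hτ : τ ∈ T) :
    alpha G T τ < τ := by
  obtain ⟨-, h2, -⟩ := h.spinePrev_spec (h.pos τ (hT.subset hτ))
  rw [alpha]
  split_ifs with hp
  · have h4 := hT.ne _ hp _ hτ
    have h5 := val_succ_of_lt h2
    rw [Fin.lt_def] at h2 ⊢
    omega
  · exact h2

theorem lt_beta (h : IsCliqueChain G B) (hT : IsSparse B T) (hτ : τ ∈ T) :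
    τ < beta G T τ := by
  obtain ⟨-, h2, -⟩ := h.spineNext_spec (h.lt τ (hT.subset hτ))
  rw [beta]
  split_ifs with hp
  · have h5 := val_succ_of_lt h2
    rw [Fin.lt_def]
    omega
  · exact h2

theorem alpha_gap (h : IsCliqueChain G B) (hT : IsSparse B T) (hτ : τ ∈ T) :
    ∀ b ∈ B, ¬ (alpha G T τ < b ∧ b < τ) := by
  obtain ⟨-, h2, h3⟩ := h.spinePrev_spec (h.pos τ (hT.subset hτ))
  rintro b hb ⟨hb1, hb2⟩
  rw [alpha] at hb1
  refine h3 b (h.subset_spine hb) ⟨?_, hb2⟩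
  split_ifs at hb1 with hp
  · exact (Order.le_succ _).trans_lt hb1
  · exact hb1

theorem beta_gap (h : IsCliqueChain G B) (hT : IsSparse B T) (hτ : τ ∈ T) :
    ∀ b ∈ B, ¬ (τ < b ∧ b < beta G T τ) := by
  obtain ⟨-, h2, h3⟩ := h.spineNext_spec (h.lt τ (hT.subset hτ))
  rintro b hb ⟨hb1, hb2⟩
  rw [beta] at hb2
  split_ifs at hb2 with hp
  · have h5 := val_succ_of_lt h2
    rw [Fin.lt_def] at hb1 hb2
    omega
  · exact h3 b (h.subset_spine hb) ⟨hb1, hb2⟩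

theorem alpha_notMem (h : IsCliqueChain G B) (hT : IsSparse B T) (hτ : τ ∈ T) :
    alpha G T τ ∉ T := by
  obtain ⟨-, h2, -⟩ := h.spinePrev_spec (h.pos τ (hT.subset hτ))
  rw [alpha]
  split_ifs with hp
  · exact fun h4 => hT.ne _ hp _ h4 (val_succ_of_lt h2).symm
  · exact hp

theorem beta_notMem (h : IsCliqueChain G B) (hT : IsSparse B T) (hτ : τ ∈ T) :
    beta G T τ ∉ T := by
  obtain ⟨-, h2, -⟩ := h.spineNext_spec (h.lt τ (hT.subset hτ))
  rw [beta]
  split_ifs with hp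
  · exact fun h4 => hT.ne _ hτ _ h4 (val_succ_of_lt h2).symm
  · exact hp

theorem color_alpha (h : IsCliqueChain G B) (hT : IsSparse B T) (hτ : τ ∈ T) :
    color T (alpha G T τ) = color T τ := by
  refine (color_eq_iff (h.alpha_lt hT hτ).le).mpr fun σ hσ hle => ?_
  by_contra hlt
  exact h.alpha_gap hT hτ σ (hT.subset hσ)
    ⟨lt_of_le_of_ne hle fun e => h.alpha_notMem hT hτ (e ▸ hσ), not_le.mp hlt⟩

theorem color_beta (h : IsCliqueChain G B) (hT : IsSparse B T) (hτ : τ ∈ T) :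
    color T (beta G T τ) = color T τ + 1 := by
  refine color_succ hτ (h.lt_beta hT hτ) fun σ hσ hlt => ?_
  by_contra hlt'
  exact h.beta_gap hT hτ σ (hT.subset hσ) ⟨hlt, not_le.mp hlt'⟩

theorem adj_alpha (h : IsCliqueChain G B) (hT : IsSparse B T) (hτ : τ ∈ T) :
    G.Adj (alpha G T τ) τ :=
  (h.adj_iff _ _ (h.alpha_lt hT hτ)).mpr (h.alpha_gap hT hτ)

theorem adj_beta (h : IsCliqueChain G B) (hT : IsSparse B T) (hτ : τ ∈ T) :
    G.Adj τ (beta G T τ) :=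
  (h.adj_iff _ _ (h.lt_beta hT hτ)).mpr (h.beta_gap hT hτ)

theorem alpha_lt_beta (h : IsCliqueChain G B) (hT : IsSparse B T) (hτ : τ ∈ T) :
    alpha G T τ < beta G T τ :=
  (h.alpha_lt hT hτ).trans (h.lt_beta hT hτ)

theorem alpha_cases (h : IsCliqueChain G B) (hT : IsSparse B T) (hτ : τ ∈ T) :
    alpha G T τ ∈ B ∨ (alpha G T τ).val = 0 ∨
      ∃ σ ∈ T, color T σ + 1 = color T τ ∧ beta G T σ = alpha G T τ := by
  obtain ⟨h1, h2, h3⟩ := h.spinePrev_spec (h.pos τ (hT.subset hτ))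
  by_cases hp : spinePrev G τ ∈ T
  · refine Or.inr (Or.inr ⟨_, hp, ?_, ?_⟩)
    · refine (color_succ hp h2 fun σ hσ hlt => ?_).symm
      by_contra hlt'
      exact h3 σ (h.subset_spine (hT.subset hσ)) ⟨hlt, not_le.mp hlt'⟩
    · have : spineNext G (spinePrev G τ) = τ :=
        h.spineNext_eq (h.subset_spine (hT.subset hτ)) h2 h3
      rw [beta, this, if_pos hτ, alpha, if_pos hp]
  · rw [alpha, if_neg hp]
    rcases (h.mem_spine_iff _).mp h1 with h4 | h4 | h4
    · exact Or.inl h4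
    · exact Or.inr (Or.inl h4)
    · have := τ.isLt
      rw [Fin.lt_def] at h2
      omega

theorem beta_cases (h : IsCliqueChain G B) (hT : IsSparse B T) (hτ : τ ∈ T) :
    beta G T τ ∈ B ∨ (beta G T τ).val + 1 = n ∨
      ∃ σ ∈ T, color T τ + 1 = color T σ ∧ alpha G T σ = beta G T τ := by
  obtain ⟨h1, h2, h3⟩ := h.spineNext_spec (h.lt τ (hT.subset hτ))
  by_cases hp : spineNext G τ ∈ T
  · refine Or.inr (Or.inr ⟨_, hp, ?_, ?_⟩)
    · refine (color_succ hτ h2 fun σ hσ hlt => ?_).symm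
      by_contra hlt'
      exact h3 σ (h.subset_spine (hT.subset hσ)) ⟨hlt, not_le.mp hlt'⟩
    · have : spinePrev G (spineNext G τ) = τ :=
        h.spinePrev_eq (h.subset_spine (hT.subset hτ)) h2 h3
      rw [alpha, this, if_pos hτ, beta, if_pos hp]
  · rw [beta, if_neg hp]
    rcases (h.mem_spine_iff _).mp h1 with h4 | h4 | h4
    · exact Or.inl h4
    · rw [Fin.lt_def] at h2
      omega
    · exact Or.inr (Or.inl h4)

theorem pathForest_adj_iff (h : IsCliqueChain G B) (hT : IsSparse B T) {u v : Fin n} :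
    (pathForest G T).Adj u v ↔ ∃ τ ∈ T, s(u, v) = s(alpha G T τ, beta G T τ) := by
  refine ⟨fun huv => huv.2, fun ⟨τ, hτ, he⟩ => ⟨?_, τ, hτ, he⟩⟩
  rintro rfl
  have hlt := h.alpha_lt_beta hT hτ
  rcases Sym2.eq_iff.mp he with ⟨h1, h2⟩ | ⟨h1, h2⟩ <;> rw [← h1, ← h2] at hlt <;>
    exact lt_irrefl _ hlt

theorem mem_forestEdges_iff (h : IsCliqueChain G B) (hT : IsSparse B T) {e : Sym2 (Fin n)} :
    e ∈ forestEdges G T ↔ ∃ τ ∈ T, e = s(alpha G T τ, beta G T τ) := by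
  induction e with
  | _ u v =>
    rw [forestEdges, Finset.mem_filter, SimpleGraph.Subgraph.mem_edgeSet,
      h.pathForest_adj_iff hT]
    simp

/-- The isolated vertices of `L(T)` are the gluing vertices outside `T` not next to an element of
`T`. -/
theorem mem_isolatedVerts_iff (h : IsCliqueChain G B) (hT : IsSparse B T) {v : Fin n} :
    v ∈ isolatedVerts G T ↔
      v ∈ B ∧ v ∉ T ∧ ∀ τ ∈ T, v ≠ alpha G T τ ∧ v ≠ beta G T τ := by
  rw [isolatedVerts, Finset.mem_filter]
  constructor
  · rintro ⟨-, hv, hiso⟩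
    have hne : ∀ τ ∈ T, v ≠ alpha G T τ ∧ v ≠ beta G T τ := by
      refine fun τ hτ => ⟨?_, ?_⟩
      · rintro rfl
        exact hiso _ ((h.pathForest_adj_iff hT).mpr ⟨τ, hτ, rfl⟩)
      · rintro rfl
        exact hiso (alpha G T τ) ((h.pathForest_adj_iff hT).mpr ⟨τ, hτ, Sym2.eq_swap⟩)
    rcases hv with ⟨hin, -⟩ | ⟨τ, hτ, hv⟩
    · obtain ⟨hs, hvT, h0, h1⟩ := Finset.mem_filter.mp hin
      refine ⟨?_, hvT, hne⟩
      rcases (h.mem_spine_iff _).mp hs with h2 | h2 | h2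
      · exact h2
      · exfalso
        have hn := h0 h2
        have h3 := h.lt _ (hT.subset hn)
        have h4 := h.pos _ (hT.subset hn)
        obtain ⟨-, h5, h6⟩ := h.spineNext_spec (τ := v) (by omega)
        have h7 := h.spinePrev_eq hs h5 h6
        exact (hne _ hn).1 (by rw [alpha, h7, if_neg hvT])
      · exfalso
        have hn := h1 h2
        have h3 := h.lt _ (hT.subset hn)
        have h4 := h.pos _ (hT.subset hn)
        obtain ⟨-, h5, h6⟩ := h.spinePrev_spec (τ := v) (by omega)
        have h7 := h.spineNext_eq hs h5 h6
        exact (hne _ hn).2 (by rw [beta, h7, if_neg hvT])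
    · rcases hv with hv | hv
      · exact absurd hv (hne τ hτ).1
      · exact absurd hv (hne τ hτ).2
  · rintro ⟨hB, hvT, hne⟩
    have hpos := h.pos v hB
    have hlt := h.lt v hB
    refine ⟨Finset.mem_univ _, Or.inl ⟨Finset.mem_filter.mpr ⟨h.subset_spine hB, hvT,
      fun _ => by omega, fun _ => by omega⟩, ?_⟩, ?_⟩
    · rintro τ hτ ⟨h1, h2⟩
      have h1' := lt_of_le_of_ne h1 (hne τ hτ).1.symm
      have h2' := lt_of_le_of_ne h2 (hne τ hτ).2
      rcases lt_trichotomy v τ with h3 | h3 | h3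
      · exact h.alpha_gap hT hτ v hB ⟨h1', h3⟩
      · exact hvT (h3 ▸ hτ)
      · exact h.beta_gap hT hτ v hB ⟨h3, h2'⟩
    · intro u hu
      obtain ⟨τ, hτ, he⟩ := (h.pathForest_adj_iff hT).mp hu
      rcases Sym2.eq_iff.mp he with ⟨h1, -⟩ | ⟨h1, -⟩
      · exact (hne τ hτ).1 h1
      · exact (hne τ hτ).2 h1

end IsCliqueChain

end links

/-! ### The prime of a cut set as the kernel of a monomial map -/

/-- The entry `(i, j)` of the generic matrix whose columns in `T` vanish and whose other columns
are multiples `y_j z_k` of a vector `z_k` depending only on the component `k` of `j`. -/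
noncomputable def segreEntry (K : Type*) [Field K] (m : ℕ) {n : ℕ} (T : Finset (Fin n))
    (p : Fin m × Fin n) : MvPolynomial ((ℕ × Fin m) ⊕ Fin n) K :=
  if p.2 ∈ T then 0 else X (Sum.inl (color T p.2, p.1)) * X (Sum.inr p.2)

/-- The parametrization of the variety of `P_T` by a product of Segre embeddings, on coordinate
rings. -/
noncomputable def segreMap (K : Type*) [Field K] (m : ℕ) {n : ℕ} (T : Finset (Fin n)) :
    MvPolynomial (Fin m × Fin n) K →ₐ[K] MvPolynomial ((ℕ × Fin m) ⊕ Fin n) K :=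
  aeval (segreEntry K m T)

/-- The vanishing ideal of the image of the Segre parametrization. It is prime for trivial reasons,
and equal to `P_T` when `T` is a cut set of a chain of cliques. -/
noncomputable def segreIdeal (K : Type*) [Field K] (m : ℕ) {n : ℕ} (T : Finset (Fin n)) :
    Ideal (MvPolynomial (Fin m × Fin n) K) :=
  RingHom.ker (segreMap K m T)

section segre

variable {K : Type*} [Field K] {m n : ℕ} {T : Finset (Fin n)}

instance : (segreIdeal K m T).IsPrime := RingHom.ker_isPrime _

theorem mem_segreIdeal {f : MvPolynomial (Fin m × Fin n) K} :
    f ∈ segreIdeal K m T ↔ segreMap K m T f = 0 := RingHom.mem_ker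

/-- Elements of the Segre ideal vanish at every matrix, over any commutative algebra, whose columns
in `T` vanish and whose nonzero columns in each component are multiples of a common vector. -/
theorem aeval_eq_zero_of_mem_segreIdeal {A : Type*} [CommRing A] [Algebra K A]
    {f : MvPolynomial (Fin m × Fin n) K} (hf : f ∈ segreIdeal K m T)
    (ζ : Fin n → Fin m → A) (y : Fin n → A) (hy : ∀ j ∈ T, y j = 0)
    (hζ : ∀ j j', j < j' → y j ≠ 0 → y j' ≠ 0 → (∀ τ ∈ T, j ≤ τ → j' ≤ τ) → ζ j = ζ j') :
    aeval (fun p : Fin m × Fin n => ζ p.2 p.1 * y p.2) f = 0 := by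
  have hex : ∀ k : ℕ, ∃ z : Fin m → A, ∀ j, y j ≠ 0 → color T j = k → ζ j = z := by
    intro k
    by_cases h : ∃ j, y j ≠ 0 ∧ color T j = k
    · obtain ⟨j, hj, rfl⟩ := h
      refine ⟨ζ j, fun j' hj' hc => ?_⟩
      rcases lt_trichotomy j j' with h1 | rfl | h1
      · exact (hζ j j' h1 hj hj' ((color_eq_iff h1.le).mp hc.symm)).symm
      · rfl
      · exact hζ j' j h1 hj' hj ((color_eq_iff h1.le).mp hc)
    · push Not at h
      exact ⟨0, fun j hj hc => absurd hc (h j hj)⟩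
  choose z hz using hex
  let e : MvPolynomial ((ℕ × Fin m) ⊕ Fin n) K →ₐ[K] A :=
    aeval (Sum.elim (fun q => z q.1 q.2) y)
  have he : aeval (fun p : Fin m × Fin n => ζ p.2 p.1 * y p.2) = e.comp (segreMap K m T) := by
    ext ⟨i, j⟩
    by_cases hj : j ∈ T
    · simp [segreMap, segreEntry, hj, hy j hj]
    · by_cases hyj : y j = 0
      · simp [segreMap, segreEntry, hj, e, hyj]
      · simp [segreMap, segreEntry, hj, e, hz _ j hyj rfl]
  rw [he, AlgHom.comp_apply, mem_segreIdeal.mp hf, map_zero]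

theorem minor_mem_edgeIdeal {G₁ : SimpleGraph (Fin m)} {G : SimpleGraph (Fin n)}
    {i j : Fin m} {k l : Fin n} (h₁ : G₁.Adj i j) (h : G.Adj k l) :
    minor K i j k l ∈ edgeIdeal K G₁ G := by
  have key : ∀ i j k l, i < j → k < l → G₁.Adj i j → G.Adj k l →
      minor K i j k l ∈ edgeIdeal K G₁ G := fun i j k l hij hkl h₁ h =>
    Ideal.subset_span ⟨i, j, k, l, h₁, hij, h, hkl, rfl⟩
  rcases h₁.ne.lt_or_gt with hij | hij <;> rcases h.ne.lt_or_gt with hkl | hkl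
  · exact key i j k l hij hkl h₁ h
  · have := neg_mem (key i j l k hij hkl h₁ h.symm)
    convert this using 1
    simp only [minor]; ring
  · have := neg_mem (key j i k l hij hkl h₁.symm h)
    convert this using 1
    simp only [minor]; ring
  · have := key j i l k hij hkl h₁.symm h.symm
    convert this using 1
    simp only [minor]; ring

theorem minor_mem_edgeIdeal_top {G : SimpleGraph (Fin n)} (i j : Fin m) {k l : Fin n}
    (h : G.Adj k l) : minor K i j k l ∈ edgeIdeal K (⊤ : SimpleGraph (Fin m)) G := by
  rcases eq_or_ne i j with rfl | hij
  · have : minor K i i k l = 0 := by simp only [minor]; ring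
    rw [this]
    exact zero_mem _
  · exact minor_mem_edgeIdeal hij h

theorem segreMap_minor {i j : Fin m} {k l : Fin n}
    (h : k ∉ T → l ∉ T → color T k = color T l) :
    segreMap K m T (minor K i j k l) = 0 := by
  simp only [segreMap, minor, map_sub, map_mul, aeval_X, segreEntry]
  by_cases hk : k ∈ T
  · simp [hk]
  · by_cases hl : l ∈ T
    · simp [hl]
    · simp only [hk, hl, if_false, h hk hl]
      ring

namespace IsCliqueChain

variable {G : SimpleGraph (Fin n)} {B : Finset (Fin n)}

theorem edgeIdeal_le_segreIdeal (h : IsCliqueChain G B) (hT : T ⊆ B) :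
    edgeIdeal K (⊤ : SimpleGraph (Fin m)) G ≤ segreIdeal K m T := by
  refine Ideal.span_le.mpr ?_
  rintro _ ⟨i, j, k, l, -, -, hkl, -, rfl⟩
  exact mem_segreIdeal.mpr (segreMap_minor fun hk hl => h.color_eq_of_adj hT hkl hk hl)

theorem X_mem_primeOfCutSet (G : SimpleGraph (Fin n)) (i : Fin m) {j : Fin n} (hj : j ∈ T) :
    X (i, j) ∈ primeOfCutSet K m G T :=
  Ideal.mem_sup_left (Ideal.subset_span ⟨i, j, hj, rfl⟩)

theorem minor_mem_primeOfCutSet (h : IsCliqueChain G B) (hT : T ⊆ B) (i j : Fin m) {k l : Fin n}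
    (hk : k ∉ T) (hl : l ∉ T) (hkl : color T k = color T l) :
    minor K i j k l ∈ primeOfCutSet K m G T := by
  rcases eq_or_ne k l with rfl | hne
  · have : minor K i j k k = 0 := by simp only [minor]; ring
    rw [this]
    exact zero_mem _
  let c := (removeVerts G T).connectedComponentMk ⟨k, hk⟩
  have hlc : (removeVerts G T).connectedComponentMk ⟨l, hl⟩ = c :=
    SimpleGraph.ConnectedComponent.sound ((h.reachable_iff hT ⟨l, hl⟩ ⟨k, hk⟩).mpr hkl.symm)
  refine Ideal.mem_sup_right (Ideal.mem_iSup_of_mem c (minor_mem_edgeIdeal_top i j ?_))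
  exact ⟨⟨⟨k, hk⟩, rfl, rfl⟩, ⟨⟨l, hl⟩, hlc, rfl⟩, hne⟩

theorem primeOfCutSet_le_segreIdeal (h : IsCliqueChain G B) (hT : T ⊆ B) :
    primeOfCutSet K m G T ≤ segreIdeal K m T := by
  refine sup_le (Ideal.span_le.mpr ?_) (iSup_le fun c => Ideal.span_le.mpr ?_)
  · rintro _ ⟨i, j, hj, rfl⟩
    refine mem_segreIdeal.mpr ?_
    simp [segreMap, segreEntry, hj]
  · rintro _ ⟨i, j, k, l, -, -, ⟨⟨k', hk', rfl⟩, ⟨l', hl', rfl⟩, -⟩, -, rfl⟩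
    refine mem_segreIdeal.mpr (segreMap_minor fun _ _ => ?_)
    refine (h.reachable_iff hT k' l').mp (SimpleGraph.ConnectedComponent.exact ?_)
    exact Eq.trans hk' (Eq.symm hl')

end IsCliqueChain

/-! ### Monomials modulo the prime of a cut set -/

/-- The exponent of the image under the Segre parametrization of the monomial with exponent `u`:
its row degrees in the components and its column degrees. -/
noncomputable def segreDegree {m n : ℕ} (T : Finset (Fin n)) (u : (Fin m × Fin n) →₀ ℕ) :
    ((ℕ × Fin m) ⊕ Fin n) →₀ ℕ :=
  u.mapDomain (fun p => Sum.inl (color T p.2, p.1)) + u.mapDomain fun p => Sum.inr p.2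

theorem segreDegree_add (u v : (Fin m × Fin n) →₀ ℕ) :
    segreDegree T (u + v) = segreDegree T u + segreDegree T v := by
  simp only [segreDegree, Finsupp.mapDomain_add]
  abel

theorem segreDegree_single (p : Fin m × Fin n) :
    segreDegree T (Finsupp.single p 1) =
      Finsupp.single (Sum.inl (color T p.2, p.1)) 1 + Finsupp.single (Sum.inr p.2) 1 := by
  simp [segreDegree, Finsupp.mapDomain_single]

theorem exists_mem_support_of_segreDegree {u : (Fin m × Fin n) →₀ ℕ} {q : (ℕ × Fin m) ⊕ Fin n}
    (hq : segreDegree T u q ≠ 0) :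
    ∃ p ∈ u.support, q = Sum.inl (color T p.2, p.1) ∨ q = Sum.inr p.2 := by
  have h : u.mapDomain (fun p => (Sum.inl (color T p.2, p.1) : (ℕ × Fin m) ⊕ Fin n)) q ≠ 0 ∨
      u.mapDomain (fun p => (Sum.inr p.2 : (ℕ × Fin m) ⊕ Fin n)) q ≠ 0 := by
    by_contra! h
    exact hq (by rw [segreDegree, Finsupp.add_apply, h.1, h.2])
  rcases h with h | h
  · obtain ⟨p, hp, hpq⟩ := Finset.mem_image.mp
      (Finsupp.mapDomain_support (Finsupp.mem_support_iff.mpr h))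
    exact ⟨p, hp, Or.inl hpq.symm⟩
  · obtain ⟨p, hp, hpq⟩ := Finset.mem_image.mp
      (Finsupp.mapDomain_support (Finsupp.mem_support_iff.mpr h))
    exact ⟨p, hp, Or.inr hpq.symm⟩

theorem finsupp_nat_induction {σ : Type*} {P : (σ →₀ ℕ) → Prop} (h0 : P 0)
    (h1 : ∀ u p, P u → P (u + Finsupp.single p 1)) (u : σ →₀ ℕ) : P u := by
  suffices H : ∀ v, P v → P (v + u) by simpa using H 0 h0
  induction u using Finsupp.induction_linear with
  | zero => simp
  | add f g hf hg => exact fun v hv => by rw [← add_assoc]; exact hg _ (hf v hv)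
  | single a b =>
    induction b with
    | zero => simp
    | succ b ih =>
      intro v hv
      rw [Finsupp.single_add, ← add_assoc]
      exact h1 _ _ (ih v hv)

theorem mem_support_add_single {σ : Type*} {u : σ →₀ ℕ} {p q : σ} :
    q ∈ (u + Finsupp.single p 1).support ↔ q ∈ u.support ∨ q = p := by
  rcases eq_or_ne q p with rfl | h <;> simp [*]

theorem exists_eq_add_single {σ : Type*} {u : σ →₀ ℕ} {p : σ} (hp : p ∈ u.support) :
    ∃ v, u = v + Finsupp.single p 1 := by
  refine ⟨u - Finsupp.single p 1, (tsub_add_cancel_of_le ?_).symm⟩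
  rw [Finsupp.single_le_iff]
  exact Nat.one_le_iff_ne_zero.mpr (Finsupp.mem_support_iff.mp hp)

theorem monomial_add_single_one {σ : Type*} (u : σ →₀ ℕ) (p : σ) :
    (monomial (u + Finsupp.single p 1) 1 : MvPolynomial σ K) = monomial u 1 * X p := by
  rw [monomial_add_single, pow_one]

theorem segreMap_monomial {u : (Fin m × Fin n) →₀ ℕ} (hu : ∀ p ∈ u.support, p.2 ∉ T) :
    segreMap K m T (monomial u 1) = monomial (segreDegree T u) 1 := by
  induction u using finsupp_nat_induction with
  | h0 => simp [segreDegree]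
  | h1 u p ih =>
    have hp := hu p (mem_support_add_single.mpr (Or.inr rfl))
    rw [monomial_add_single_one, map_mul, ih fun q hq => hu q
      (mem_support_add_single.mpr (Or.inl hq)), segreDegree_add, segreDegree_single, ← add_assoc,
      monomial_add_single_one, monomial_add_single_one, mul_assoc]
    simp [segreMap, segreEntry, hp]

namespace IsCliqueChain

variable {G : SimpleGraph (Fin n)} {B : Finset (Fin n)}

/-- A monomial in which column `j` and, within the component of `j`, row `i` occur is congruent to
one divisible by `x_{i,j}`, by an exchange of two column indices. -/
theorem exists_monomial_congr (h : IsCliqueChain G B) (hT : T ⊆ B)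
    {u : (Fin m × Fin n) →₀ ℕ} (hu : ∀ p ∈ u.support, p.2 ∉ T) {i : Fin m} {j : Fin n}
    (hr : segreDegree T u (Sum.inl (color T j, i)) ≠ 0)
    (hc : segreDegree T u (Sum.inr j) ≠ 0) :
    ∃ w : (Fin m × Fin n) →₀ ℕ,
      (∀ p ∈ (w + Finsupp.single (i, j) 1).support, p.2 ∉ T) ∧
      segreDegree T (w + Finsupp.single (i, j) 1) = segreDegree T u ∧
      monomial u (1 : K) - monomial (w + Finsupp.single (i, j) 1) 1 ∈ primeOfCutSet K m G T := by
  obtain ⟨⟨i₁, j₁⟩, h₁, h₁'⟩ := exists_mem_support_of_segreDegree hr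
  obtain ⟨⟨i₂, j₂⟩, h₂, h₂'⟩ := exists_mem_support_of_segreDegree hc
  simp only [Sum.inl.injEq, Prod.mk.injEq, reduceCtorEq, or_false] at h₁'
  simp only [Sum.inr.injEq, reduceCtorEq, false_or] at h₂'
  obtain ⟨hcol, rfl⟩ := h₁'
  subst h₂'
  by_cases hij : (i, j) ∈ u.support
  · obtain ⟨w, rfl⟩ := exists_eq_add_single hij
    exact ⟨w, hu, rfl, by simp⟩
  · have hne : (i, j₁) ≠ (i₂, j) := by
      rintro h
      simp only [Prod.mk.injEq] at h
      exact hij (h.2 ▸ h₁)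
    have hj := hu _ h₂
    have hj₁ := hu _ h₁
    obtain ⟨v, rfl⟩ := exists_eq_add_single h₂
    obtain ⟨w, rfl⟩ := exists_eq_add_single ((mem_support_add_single.mp h₁).resolve_right hne)
    refine ⟨w + Finsupp.single (i₂, j₁) 1, ?_, ?_, ?_⟩
    · intro p hp
      rcases mem_support_add_single.mp hp with hp | rfl
      · rcases mem_support_add_single.mp hp with hp | rfl
        · exact hu p (mem_support_add_single.mpr (Or.inl (mem_support_add_single.mpr (Or.inl hp))))
        · exact hj₁
      · exact hj
    · simp only [segreDegree_add, segreDegree_single, hcol]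
      abel
    · simp only [monomial_add_single_one]
      have := Ideal.mul_mem_left _ (monomial w (1 : K))
        (h.minor_mem_primeOfCutSet (K := K) hT i i₂ hj₁ hj hcol.symm)
      convert this using 1
      simp only [minor]
      ring

theorem monomial_sub_monomial_mem (h : IsCliqueChain G B) (hT : T ⊆ B)
    {u u' : (Fin m × Fin n) →₀ ℕ} (hu : ∀ p ∈ u.support, p.2 ∉ T)
    (hu' : ∀ p ∈ u'.support, p.2 ∉ T) (hd : segreDegree T u = segreDegree T u') :
    monomial u (1 : K) - monomial u' 1 ∈ primeOfCutSet K m G T := by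
  induction u using finsupp_nat_induction generalizing u' with
  | h0 =>
    have : u' = 0 := by
      by_contra hne
      obtain ⟨p, hp⟩ := Finsupp.support_nonempty_iff.mpr hne
      obtain ⟨w, rfl⟩ := exists_eq_add_single hp
      have := DFunLike.congr_fun hd (Sum.inr p.2)
      simp [segreDegree_add, segreDegree_single] at this
      simp [segreDegree] at this
    simp [this]
  | h1 u p ih =>
    obtain ⟨i, j⟩ := p
    obtain ⟨w, hw, hwd, hwm⟩ := h.exists_monomial_congr (K := K) hT hu' (i := i) (j := j)
      (by rw [← hd]; simp [segreDegree_add, segreDegree_single])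
      (by rw [← hd]; simp [segreDegree_add, segreDegree_single])
    have hsub : ∀ v : (Fin m × Fin n) →₀ ℕ, (∀ p ∈ (v + Finsupp.single (i, j) 1).support, p.2 ∉ T) →
        ∀ p ∈ v.support, p.2 ∉ T := fun v hv p hp => hv p (mem_support_add_single.mpr (Or.inl hp))
    have h2 := ih (hsub u hu) (hsub w hw) (by
      rw [← hwd, segreDegree_add, segreDegree_add] at hd
      exact add_right_cancel hd)
    have h3 := sub_mem (Ideal.mul_mem_right (X (i, j)) _ h2) hwm
    convert h3 using 1
    rw [monomial_add_single_one, monomial_add_single_one]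
    ring

/-- The `2`-minors generate the ideal of a product of Segre embeddings: modulo `P_T`, a monomial is
determined by its image under the parametrization, which therefore has a linear section. -/
theorem primeOfCutSet_eq_segreIdeal (h : IsCliqueChain G B) (hT : T ⊆ B) :
    primeOfCutSet K m G T = segreIdeal K m T := by
  refine le_antisymm (h.primeOfCutSet_le_segreIdeal hT) fun f hf => ?_
  let P := primeOfCutSet K m G T
  let good (u : (Fin m × Fin n) →₀ ℕ) : Prop := ∀ p ∈ u.support, p.2 ∉ T
  let s : MvPolynomial ((ℕ × Fin m) ⊕ Fin n) K →ₗ[K] MvPolynomial (Fin m × Fin n) K ⧸ P :=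
    (basisMonomials _ K).constr K fun e =>
      if he : ∃ u, good u ∧ segreDegree T u = e then Ideal.Quotient.mk P (monomial he.choose 1)
      else 0
  have hs (e) : s (monomial e 1) = if he : ∃ u, good u ∧ segreDegree T u = e then
      Ideal.Quotient.mk P (monomial he.choose 1) else 0 := by
    have := (basisMonomials ((ℕ × Fin m) ⊕ Fin n) K).constr_basis K (fun e =>
      if he : ∃ u, good u ∧ segreDegree T u = e then Ideal.Quotient.mk P (monomial he.choose 1)
      else 0) e
    rwa [coe_basisMonomials] at this
  have hcomp : s ∘ₗ (segreMap K m T).toLinearMap = (Ideal.Quotient.mkₐ K P).toLinearMap := by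
    refine (basisMonomials _ K).ext fun u => ?_
    simp only [coe_basisMonomials, LinearMap.comp_apply, AlgHom.toLinearMap_apply,
      Ideal.Quotient.mkₐ_eq_mk]
    by_cases hu : good u
    · have he : ∃ u', good u' ∧ segreDegree T u' = segreDegree T u := ⟨u, hu, rfl⟩
      rw [segreMap_monomial hu, hs, dif_pos he, Ideal.Quotient.eq]
      exact h.monomial_sub_monomial_mem hT he.choose_spec.1 hu he.choose_spec.2
    · simp only [good] at hu
      push Not at hu
      obtain ⟨⟨i, j⟩, hp, hj⟩ := hu
      obtain ⟨w, rfl⟩ := exists_eq_add_single hp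
      have hmem : monomial (w + Finsupp.single (i, j) 1) (1 : K) ∈ P := by
        rw [monomial_add_single_one]
        exact Ideal.mul_mem_left _ _ (X_mem_primeOfCutSet G i hj)
      rw [mem_segreIdeal.mp (h.primeOfCutSet_le_segreIdeal hT hmem), map_zero,
        Ideal.Quotient.eq_zero_iff_mem.mpr hmem]
  have := LinearMap.congr_fun hcomp f
  simp only [LinearMap.comp_apply, AlgHom.toLinearMap_apply, Ideal.Quotient.mkₐ_eq_mk,
    mem_segreIdeal.mp hf, map_zero] at this
  exact Ideal.Quotient.eq_zero_iff_mem.mp this.symm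

end IsCliqueChain

end segre

/-! ### Slices -/

section slices

variable {n : ℕ} {G : SimpleGraph (Fin n)} {B T : Finset (Fin n)}

namespace IsCliqueChain

theorem lt_alpha (h : IsCliqueChain G B) (hT : IsSparse B T) {σ τ : Fin n} (hσ : σ ∈ T)
    (hτ : τ ∈ T) (hlt : σ < τ) : σ < alpha G T τ := by
  by_contra hle
  exact h.alpha_gap hT hτ σ (hT.subset hσ)
    ⟨lt_of_le_of_ne (not_lt.mp hle) fun e => h.alpha_notMem hT hτ (e ▸ hσ), hlt⟩

theorem beta_le_alpha (h : IsCliqueChain G B) (hT : IsSparse B T) {σ τ : Fin n} (hσ : σ ∈ T)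
    (hτ : τ ∈ T) (hlt : σ < τ) : beta G T σ ≤ alpha G T τ := by
  have hc := color_lt hσ le_rfl hlt
  rcases (Nat.succ_le_of_lt hc).eq_or_lt with heq | hc'
  · rcases h.alpha_cases hT hτ with hB | h0 | ⟨ρ, hρ, hcρ, he⟩
    · by_contra hgt
      exact h.beta_gap hT hσ _ hB ⟨h.lt_alpha hT hσ hτ hlt, not_le.mp hgt⟩
    · have := h.lt_alpha hT hσ hτ hlt
      rw [Fin.lt_def] at this
      omega
    · obtain rfl : ρ = σ := color_injOn hρ hσ (by omega)
      exact he.le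
  · refine (lt_of_color_lt (T := T) ?_).le
    rw [h.color_beta hT hσ, h.color_alpha hT hτ]
    exact hc'

/-- Distinct vertices of the same connected component of `L(T)` lie in distinct components of
`G \ T`: the edges of `L(T)` on either side of the gap `[β_σ, α_τ]` are not connected. -/
theorem eq_of_reachable_of_color_eq (h : IsCliqueChain G B) (hT : IsSparse B T)
    {v w σ τ : Fin n} (hσ : σ ∈ T) (hτ : τ ∈ T)
    (hv : v = alpha G T σ ∨ v = beta G T σ) (hw : w = alpha G T τ ∨ w = beta G T τ)
    (hvw : (pathForest G T).spanningCoe.Reachable v w) (hc : color T v = color T w) : v = w := by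
  have key : ∀ σ ∈ T, ∀ τ ∈ T, color T (beta G T σ) = color T (alpha G T τ) →
      (pathForest G T).spanningCoe.Reachable (beta G T σ) (alpha G T τ) →
      beta G T σ = alpha G T τ := by
    intro σ hσ τ hτ hc hr
    rw [h.color_beta hT hσ, h.color_alpha hT hτ] at hc
    have hστ : σ < τ := lt_of_color_lt (T := T) (by omega)
    refine le_antisymm (h.beta_le_alpha hT hσ hτ hστ) ?_
    by_contra hgt
    rw [not_le] at hgt
    have hinv : ∀ ρ ∈ T, (alpha G T τ ≤ alpha G T ρ ↔ alpha G T τ ≤ beta G T ρ) := by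
      intro ρ hρ
      have hρlt := h.alpha_lt_beta hT hρ
      rcases lt_or_ge ρ τ with hlt | hge
      · have hle : beta G T ρ ≤ beta G T σ := by
          have hc' := color_lt hρ le_rfl hlt
          rcases (show color T ρ ≤ color T σ by omega).eq_or_lt with he | hl
          · rw [color_injOn hρ hσ he]
          · exact (h.beta_le_alpha hT hρ hσ (lt_of_color_lt hl)).trans (h.alpha_lt_beta hT hσ).le
        have := hle.trans_lt hgt
        constructor
        · exact fun h' => absurd h' ((hρlt.trans this).not_ge)
        · exact fun h' => absurd h' this.not_ge
      · have hle : alpha G T τ ≤ alpha G T ρ := by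
          rcases hge.eq_or_lt with rfl | hl
          · exact le_rfl
          · exact (h.alpha_lt_beta hT hτ).le.trans (h.beta_le_alpha hT hτ hρ hl)
        exact ⟨fun _ => hle.trans hρlt.le, fun _ => hle⟩
    obtain ⟨p⟩ := hr
    suffices H : ∀ (a b : Fin n) (_ : (pathForest G T).spanningCoe.Walk a b),
        alpha G T τ ≤ b → alpha G T τ ≤ a from (H _ _ p le_rfl).not_gt hgt
    intro a b p
    induction p with
    | nil => exact id
    | @cons a b c hab p ih =>
      intro hle
      have hb := ih hle
      obtain ⟨ρ, hρ, he⟩ := (h.pathForest_adj_iff hT).mp hab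
      rcases Sym2.eq_iff.mp he with ⟨h1, h2⟩ | ⟨h1, h2⟩
      · rw [h1, hinv ρ hρ, ← h2]; exact hb
      · rw [h1, ← hinv ρ hρ, ← h2]; exact hb
  rcases hv with rfl | rfl <;> rcases hw with rfl | rfl
  · rw [h.color_alpha hT hσ, h.color_alpha hT hτ] at hc
    rw [color_injOn hσ hτ hc]
  · exact (key τ hτ σ hσ hc.symm hvw.symm).symm
  · exact key σ hσ τ hτ hc hvw
  · rw [h.color_beta hT hσ, h.color_beta hT hτ] at hc
    rw [color_injOn hσ hτ (by omega)]

variable {m : ℕ} {P : Finpartition (forestEdges G T)}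

theorem mem_sliceVerts (h : IsCliqueChain G B) (hT : IsSparse B T) {p : Finset (Sym2 (Fin n))}
    (hp : p ∈ P.parts) {v : Fin n} (hv : v ∈ sliceVerts p) :
    ∃ τ ∈ T, s(alpha G T τ, beta G T τ) ∈ p ∧ (v = alpha G T τ ∨ v = beta G T τ) := by
  obtain ⟨e, he, hve⟩ := (Finset.mem_filter.mp hv).2
  obtain ⟨τ, hτ, rfl⟩ := (h.mem_forestEdges_iff hT).mp (P.le hp he)
  exact ⟨τ, hτ, he, Sym2.mem_iff.mp hve⟩

theorem notMem_of_mem_sliceVerts (h : IsCliqueChain G B) (hT : IsSparse B T)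
    {p : Finset (Sym2 (Fin n))} (hp : p ∈ P.parts) {v : Fin n} (hv : v ∈ sliceVerts p) :
    v ∉ T := by
  obtain ⟨τ, hτ, -, rfl | rfl⟩ := h.mem_sliceVerts hT hp hv
  · exact h.alpha_notMem hT hτ
  · exact h.beta_notMem hT hτ

theorem color_injOn_sliceVerts (h : IsCliqueChain G B) (hT : IsSparse B T)
    (hP : IsCompatible m P) {p : Finset (Sym2 (Fin n))} (hp : p ∈ P.parts) :
    Set.InjOn (color T) (sliceVerts p) := by
  intro v hv w hw hc
  obtain ⟨σ, hσ, heσ, hvσ⟩ := h.mem_sliceVerts hT hp hv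
  obtain ⟨τ, hτ, heτ, hwτ⟩ := h.mem_sliceVerts hT hp hw
  obtain ⟨x, y, q, -, -, rfl⟩ := hP p hp
  rw [List.mem_toFinset] at heσ heτ
  have hr : ∀ z ∈ q.support, (pathForest G T).spanningCoe.Reachable x z :=
    fun z hz => ⟨q.takeUntil z hz⟩
  refine h.eq_of_reachable_of_color_eq hT hσ hτ hvσ hwτ ?_ hc
  refine (hr v (q.mem_support_of_mem_edges heσ ?_)).symm.trans
    (hr w (q.mem_support_of_mem_edges heτ ?_))
  · exact Sym2.mem_iff.mpr hvσ
  · exact Sym2.mem_iff.mpr hwτ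

end IsCliqueChain

end slices

/-! ### Minors -/

section minors

variable {K : Type*} [Field K] {m n : ℕ}

/-- If `x` multiplies all `2 × 2` minors in two fixed columns into an ideal, then it also multiplies
the determinant into it, as the terms of the determinant cancel in pairs. -/
theorem mul_det_mem {R ι : Type*} [CommRing R] [Fintype ι] [DecidableEq ι] (J : Ideal R)
    (M : Matrix ι ι R) (x : R) {c d : ι} (hcd : c ≠ d)
    (hM : ∀ a b, x * (M a c * M b d - M b c * M a d) ∈ J) : x * M.det ∈ J := by
  rw [← Ideal.Quotient.eq_zero_iff_mem, Matrix.det_apply', Finset.mul_sum, map_sum]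
  refine Finset.sum_involution (fun σ _ => σ * Equiv.swap c d) ?_ ?_ (fun _ _ => Finset.mem_univ _)
    (fun σ _ => by rw [mul_assoc, Equiv.swap_mul_self, mul_one])
  · intro σ _
    rw [← map_add, Ideal.Quotient.eq_zero_iff_mem]
    have hsplit : ∀ ρ : Equiv.Perm ι, ∏ i, M (ρ i) i =
        M (ρ c) c * (M (ρ d) d * ∏ i ∈ (Finset.univ.erase c).erase d, M (ρ i) i) := by
      intro ρ
      rw [Finset.mul_prod_erase _ (fun i => M (ρ i) i)
        (Finset.mem_erase.mpr ⟨hcd.symm, Finset.mem_univ d⟩),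
        Finset.mul_prod_erase _ (fun i => M (ρ i) i) (Finset.mem_univ c)]
    have hrest : ∏ i ∈ (Finset.univ.erase c).erase d, M ((σ * Equiv.swap c d) i) i =
        ∏ i ∈ (Finset.univ.erase c).erase d, M (σ i) i := by
      refine Finset.prod_congr rfl fun i hi => ?_
      simp only [Finset.mem_erase] at hi
      rw [Equiv.Perm.mul_apply, Equiv.swap_apply_of_ne_of_ne hi.2.1 hi.1]
    rw [hsplit, hsplit, hrest, Equiv.Perm.sign_mul, Equiv.Perm.sign_swap hcd]
    simp only [Equiv.Perm.mul_apply, Equiv.swap_apply_left, Equiv.swap_apply_right]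
    have := Ideal.mul_mem_left J
      (((Equiv.Perm.sign σ : ℤ) : R) * ∏ i ∈ (Finset.univ.erase c).erase d, M (σ i) i)
      (hM (σ c) (σ d))
    convert this using 1
    push_cast
    ring
  · intro σ _ _ he
    have := congrArg (· c) (mul_left_cancel (he.trans (mul_one σ).symm))
    simp only [Equiv.swap_apply_left, Equiv.Perm.one_apply] at this
    exact hcd this.symm

theorem X_mul_minor (a i j : Fin m) (k v l : Fin n) :
    X (a, v) * minor K i j k l =
      X (i, k) * minor K a j v l - X (j, k) * minor K a i v l + X (a, l) * minor K i j k v := by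
  simp only [minor]
  ring

variable {s : Finset (Fin n)}

theorem isHomogeneous_sliceMinor (hs : s.card ≤ m) :
    (sliceMinor K s hs).IsHomogeneous s.card := by
  rw [sliceMinor, Matrix.det_apply]
  refine IsHomogeneous.sum _ _ _ fun σ _ => ?_
  have hprod := IsHomogeneous.prod Finset.univ
    (fun i => Matrix.of (fun i j : Fin s.card =>
      (X (Fin.castLE hs i, s.orderEmbOfFin rfl j) : MvPolynomial (Fin m × Fin n) K)) (σ i) i)
    (fun _ => 1) (fun i _ => isHomogeneous_X _ _)
  simp only [Finset.sum_const, Finset.card_univ, Fintype.card_fin, smul_eq_mul, mul_one] at hprod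
  rcases Int.units_eq_one_or (Equiv.Perm.sign σ) with h | h
  · rw [h, one_smul]; exact hprod
  · rw [h, Units.neg_smul, one_smul]; exact hprod.neg

theorem sliceMinor_mem_span (hs : s.card ≤ m) {v : Fin n} (hv : v ∈ s) :
    sliceMinor K s hs ∈ Ideal.span (Set.range fun i : Fin m =>
      (X (i, v) : MvPolynomial (Fin m × Fin n) K)) := by
  rw [← Ideal.Quotient.eq_zero_iff_mem, sliceMinor, RingHom.map_det]
  obtain ⟨j, hj⟩ : v ∈ Set.range (s.orderEmbOfFin rfl) := by
    rw [Finset.range_orderEmbOfFin]; exact hv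
  refine Matrix.det_eq_zero_of_column_eq_zero j fun i => ?_
  rw [RingHom.mapMatrix_apply, Matrix.map_apply, Matrix.of_apply, hj,
    Ideal.Quotient.eq_zero_iff_mem]
  exact Ideal.subset_span ⟨_, rfl⟩

theorem X_mul_sliceMinor_mem (hs : s.card ≤ m) {G : SimpleGraph (Fin n)} {u v τ : Fin n}
    (hu : u ∈ s) (hv : v ∈ s) (huv : u ≠ v) (h₁ : G.Adj u τ) (h₂ : G.Adj τ v) (i : Fin m) :
    X (i, τ) * sliceMinor K s hs ∈ edgeIdeal K (⊤ : SimpleGraph (Fin m)) G := by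
  obtain ⟨a, ha⟩ : u ∈ Set.range (s.orderEmbOfFin rfl) := by
    rw [Finset.range_orderEmbOfFin]; exact hu
  obtain ⟨b, hb⟩ : v ∈ Set.range (s.orderEmbOfFin rfl) := by
    rw [Finset.range_orderEmbOfFin]; exact hv
  refine mul_det_mem _ _ _ (c := a) (d := b) ?_ fun c d => ?_
  · rintro rfl
    exact huv (ha.symm.trans hb)
  · simp only [Matrix.of_apply, ha, hb]
    have := X_mul_minor (K := K) i (Fin.castLE hs c) (Fin.castLE hs d) u τ v
    have hmem : X (i, τ) * minor K (Fin.castLE hs c) (Fin.castLE hs d) u v ∈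
        edgeIdeal K (⊤ : SimpleGraph (Fin m)) G := by
      rw [this]
      exact add_mem (sub_mem (Ideal.mul_mem_left _ _ (minor_mem_edgeIdeal_top _ _ h₂))
        (Ideal.mul_mem_left _ _ (minor_mem_edgeIdeal_top _ _ h₂)))
        (Ideal.mul_mem_left _ _ (minor_mem_edgeIdeal_top _ _ h₁))
    convert hmem using 1
    simp only [minor]
    ring

theorem sliceMinor_notMem_segreIdeal (hs : s.card ≤ m) {T : Finset (Fin n)}
    (hsT : ∀ v ∈ s, v ∉ T) (hinj : Set.InjOn (color T) s) :
    sliceMinor K s hs ∉ segreIdeal K m T := by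
  intro hmem
  -- The columns of the slice become the first unit vectors.
  have h0 := aeval_eq_zero_of_mem_segreIdeal (A := K) hmem
    (fun j i => if ∃ a : Fin s.card, s.orderEmbOfFin rfl a = j ∧ i = Fin.castLE hs a then 1 else 0)
    (fun j => if j ∈ s then 1 else 0) (fun j hj => if_neg fun hjs => hsT j hjs hj) (by
      intro j j' hlt hj hj' hT
      have hjs : j ∈ s := by by_contra hn; exact hj (if_neg hn)
      have hjs' : j' ∈ s := by by_contra hn; exact hj' (if_neg hn)
      exact absurd (hinj hjs hjs' ((color_eq_iff hlt.le).mpr hT)) hlt.ne)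
  rw [sliceMinor, AlgHom.map_det] at h0
  refine one_ne_zero (α := K) (Eq.trans (Eq.trans (Matrix.det_one (n := Fin s.card)).symm ?_) h0)
  congr 1
  ext i j
  have hj : s.orderEmbOfFin rfl j ∈ s := s.orderEmbOfFin_mem rfl j
  simp only [AlgHom.mapMatrix_apply, Matrix.map_apply, Matrix.of_apply, aeval_X, hj, if_true,
    mul_one, Matrix.one_apply]
  congr 1
  rw [eq_iff_iff]
  constructor
  · rintro rfl
    exact ⟨i, rfl, rfl⟩
  · rintro ⟨a, ha, hi⟩
    rw [(s.orderEmbOfFin rfl).injective ha] at hi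
    exact Fin.castLE_injective hs hi

namespace IsCliqueChain

variable {G : SimpleGraph (Fin n)} {B : Finset (Fin n)}

/-- The minors in two columns `k < l` are multiplied into the binomial edge ideal by a product of
one linear form for each column of a gluing vertex between `k` and `l`. -/
theorem prod_mul_minor_mem (h : IsCliqueChain G B) (F : Fin n → MvPolynomial (Fin m × Fin n) K)
    {k l : Fin n} (hkl : k < l)
    (hF : ∀ v ∈ B.filter (fun v => k < v ∧ v < l), F v ∈ Ideal.span (Set.range fun i : Fin m =>
      (X (i, v) : MvPolynomial (Fin m × Fin n) K))) (i j : Fin m) :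
    (∏ v ∈ B.filter (fun v => k < v ∧ v < l), F v) * minor K i j k l ∈
      edgeIdeal K (⊤ : SimpleGraph (Fin m)) G := by
  induction l using WellFoundedLT.induction with
  | ind l ih =>
  rcases (B.filter (fun v => k < v ∧ v < l)).eq_empty_or_nonempty with hV | hV
  · refine Ideal.mul_mem_left _ _ (minor_mem_edgeIdeal_top i j ((h.adj_iff k l hkl).mpr ?_))
    exact fun b hb hlt => Finset.notMem_empty b (hV ▸ Finset.mem_filter.mpr ⟨hb, hlt⟩)
  · obtain ⟨v, hv, hmax⟩ := Finset.exists_max_image _ id hV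
    obtain ⟨hvB, hkv, hvl⟩ := Finset.mem_filter.mp hv
    have hins : B.filter (fun x => k < x ∧ x < l) =
        insert v (B.filter (fun x => k < x ∧ x < v)) := by
      ext x
      simp only [Finset.mem_filter, Finset.mem_insert]
      constructor
      · rintro ⟨hx, hkx, hxl⟩
        rcases (show x ≤ v from hmax x (Finset.mem_filter.mpr ⟨hx, hkx, hxl⟩)).eq_or_lt with e | e
        · exact Or.inl e
        · exact Or.inr ⟨hx, hkx, e⟩
      · rintro (rfl | ⟨hx, hkx, hxl⟩)
        · exact ⟨hvB, hkv, hvl⟩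
        · exact ⟨hx, hkx, hxl.trans hvl⟩
    have hadj : G.Adj v l := by
      refine (h.adj_iff v l hvl).mpr fun b hb hlt => ?_
      exact (hmax b (Finset.mem_filter.mpr ⟨hb, hkv.trans hlt.1, hlt.2⟩)).not_gt hlt.1
    have hIH := ih v hvl hkv fun x hx => hF x (hins ▸ Finset.mem_insert_of_mem hx)
    rw [hins, Finset.prod_insert (by simp), mul_assoc, mul_comm, ← smul_eq_mul,
      smul_eq_mul, mul_comm]
    have hle : Ideal.span (Set.range fun i : Fin m =>
        (X (i, v) : MvPolynomial (Fin m × Fin n) K)) ≤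
        (edgeIdeal K (⊤ : SimpleGraph (Fin m)) G).colon
          {(∏ x ∈ B.filter (fun x => k < x ∧ x < v), F x) * minor K i j k l} := by
      refine Ideal.span_le.mpr ?_
      rintro _ ⟨a, rfl⟩
      rw [SetLike.mem_coe, Submodule.mem_colon_singleton, smul_eq_mul, mul_left_comm, X_mul_minor,
        mul_add]
      refine add_mem (Ideal.mul_mem_left _ _ (sub_mem ?_ ?_)) ?_
      · exact Ideal.mul_mem_left _ _ (minor_mem_edgeIdeal_top _ _ hadj)
      · exact Ideal.mul_mem_left _ _ (minor_mem_edgeIdeal_top _ _ hadj)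
      · rw [mul_left_comm]
        exact Ideal.mul_mem_left _ _ hIH
    exact Submodule.mem_colon_singleton.mp (hle (hF v hv))

variable {T : Finset (Fin n)} {P : Finpartition (forestEdges G T)}

theorem mul_partitionPoly_mem (h : IsCliqueChain G B) (hT : IsSparse B T) (hm : 2 ≤ m)
    (hP : IsCompatible m P) {g : MvPolynomial (Fin m × Fin n) K}
    (hg : g ∈ primeOfCutSet K m G T) :
    g * partitionPoly K hm P hP ∈ edgeIdeal K (⊤ : SimpleGraph (Fin m)) G := by
  suffices H : primeOfCutSet K m G T ≤
      (edgeIdeal K (⊤ : SimpleGraph (Fin m)) G).colon {partitionPoly K hm P hP} from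
    Submodule.mem_colon_singleton.mp (H hg)
  refine sup_le (Ideal.span_le.mpr ?_) (iSup_le fun c => Ideal.span_le.mpr ?_)
  · rintro _ ⟨i, τ, hτ, rfl⟩
    rw [SetLike.mem_coe, Submodule.mem_colon_singleton, smul_eq_mul]
    have he := (h.mem_forestEdges_iff hT).mpr ⟨τ, hτ, rfl⟩
    obtain ⟨p, hp, hep⟩ := P.exists_mem he
    have hdvd : sliceMinor K (sliceVerts p) (hP.card_sliceVerts_le hp) ∣ partitionPoly K hm P hP :=
      (Finset.dvd_prod_of_mem (fun p : {x // x ∈ P.parts} =>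
        sliceMinor K (sliceVerts p.1) (hP.card_sliceVerts_le p.2))
        (Finset.mem_attach _ ⟨p, hp⟩)).mul_right _
    refine Ideal.mem_of_dvd _ (mul_dvd_mul_left _ hdvd) (X_mul_sliceMinor_mem _ ?_ ?_
      (h.alpha_lt_beta hT hτ).ne (h.adj_alpha hT hτ) (h.adj_beta hT hτ) i)
    · exact Finset.mem_filter.mpr ⟨Finset.mem_univ _, _, hep, Sym2.mem_mk_left _ _⟩
    · exact Finset.mem_filter.mpr ⟨Finset.mem_univ _, _, hep, Sym2.mem_mk_right _ _⟩
  · rintro _ ⟨i, j, k, l, -, -, ⟨⟨k', hk', rfl⟩, ⟨l', hl', rfl⟩, -⟩, hkl, rfl⟩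
    have hc : color T k' = color T l' :=
      (h.reachable_iff hT.subset k' l').mp (SimpleGraph.ConnectedComponent.exact
        (Eq.trans hk' (Eq.symm hl')))
    rw [SetLike.mem_coe, Submodule.mem_colon_singleton, smul_eq_mul, mul_comm]
    set V := B.filter (fun v => k'.1 < v ∧ v < l'.1) with hV
    have hVT : ∀ v ∈ V, v ∉ T ∧ color T v = color T k'.1 := by
      intro v hv
      obtain ⟨-, h1, h2⟩ := Finset.mem_filter.mp hv
      have hcut := (color_eq_iff hkl.le).mp hc
      refine ⟨fun hvT => (hcut v hvT h1.le).not_gt h2, le_antisymm ?_ (color_mono h1.le)⟩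
      exact (color_mono h2.le).trans hc.symm.le
    have hex : ∀ v ∈ V.filter (· ∉ isolatedVerts G T), ∃ p : {x // x ∈ P.parts},
        v ∈ sliceVerts p.1 := by
      intro v hv
      obtain ⟨hv, hiso⟩ := Finset.mem_filter.mp hv
      rw [h.mem_isolatedVerts_iff hT] at hiso
      push Not at hiso
      obtain ⟨τ, hτ, hvτ⟩ := hiso (Finset.mem_filter.mp hv).1 (hVT v hv).1
      obtain ⟨p, hp, hep⟩ := P.exists_mem ((h.mem_forestEdges_iff hT).mpr ⟨τ, hτ, rfl⟩)
      refine ⟨⟨p, hp⟩, Finset.mem_filter.mpr ⟨Finset.mem_univ _, _, hep, ?_⟩⟩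
      by_cases hva : v = alpha G T τ
      · rw [hva]; exact Sym2.mem_mk_left _ _
      · rw [hvτ hva]; exact Sym2.mem_mk_right _ _
    choose q hq using hex
    let M (p : {x // x ∈ P.parts}) := sliceMinor K (sliceVerts p.1) (hP.card_sliceVerts_le p.2)
    let F : Fin n → MvPolynomial (Fin m × Fin n) K := fun v =>
      if hv : v ∈ V.filter (· ∉ isolatedVerts G T) then M (q v hv)
      else X (⟨0, Nat.lt_of_lt_of_le Nat.zero_lt_two hm⟩, v)
    have hmem := h.prod_mul_minor_mem F hkl (fun v hv => by
      by_cases hv' : v ∈ V.filter (· ∉ isolatedVerts G T)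
      · simp only [F, dif_pos hv']
        exact sliceMinor_mem_span _ (hq v hv')
      · simp only [F, dif_neg hv']
        exact Ideal.subset_span ⟨_, rfl⟩) i j
    refine Ideal.mem_of_dvd _ (mul_dvd_mul_right ?_ _) hmem
    rw [← hV, ← Finset.prod_filter_mul_prod_filter_not V (· ∉ isolatedVerts G T) F]
    refine mul_dvd_mul ?_ ?_
    · -- Distinct vertices between `k` and `l` lie in distinct slices.
      have h1 : ∏ v ∈ V.filter (· ∉ isolatedVerts G T), F v =
          ∏ v ∈ (V.filter (· ∉ isolatedVerts G T)).attach, M (q v.1 v.2) := by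
        rw [← Finset.prod_attach]
        refine Finset.prod_congr rfl fun v _ => ?_
        simp only [F, dif_pos v.2]
      rw [h1, ← Finset.prod_image (g := fun v : {x // x ∈ V.filter (· ∉ isolatedVerts G T)} =>
        q v.1 v.2) (f := M)]
      · exact Finset.prod_dvd_prod_of_subset _ _ _ fun x _ => Finset.mem_attach _ x
      · intro v _ w _ hvw
        have hw := hq w.1 w.2
        simp only at hvw
        rw [← hvw] at hw
        refine Subtype.ext (h.color_injOn_sliceVerts hT hP (q v.1 v.2).2 (hq v.1 v.2) hw ?_)
        rw [(hVT _ (Finset.mem_filter.mp v.2).1).2, (hVT _ (Finset.mem_filter.mp w.2).1).2]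
    · have h1 : ∏ v ∈ V.filter (fun v => ¬ v ∉ isolatedVerts G T), F v =
          ∏ v ∈ V.filter (fun v => ¬ v ∉ isolatedVerts G T),
            X (⟨0, Nat.lt_of_lt_of_le Nat.zero_lt_two hm⟩, v) := by
        refine Finset.prod_congr rfl fun v hv => dif_neg fun hv' => ?_
        exact (Finset.mem_filter.mp hv).2 (Finset.mem_filter.mp hv').2
      rw [h1]
      refine Finset.prod_dvd_prod_of_subset _ _ _ fun v hv => ?_
      exact not_not.mp (Finset.mem_filter.mp hv).2

theorem partitionPoly_notMem (h : IsCliqueChain G B) (hT : IsSparse B T) (hm : 2 ≤ m)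
    (hP : IsCompatible m P) : partitionPoly K hm P hP ∉ segreIdeal K m T := by
  have hp : (segreIdeal K m T).IsPrime := inferInstance
  rw [partitionPoly, hp.mul_mem_iff_mem_or_mem, hp.prod_mem_iff, hp.prod_mem_iff]
  rintro (⟨p, -, hmem⟩ | ⟨v, hv, hmem⟩)
  · exact sliceMinor_notMem_segreIdeal _ (fun v hv => h.notMem_of_mem_sliceVerts hT p.2 hv)
      (h.color_injOn_sliceVerts hT hP p.2) hmem
  · rw [mem_segreIdeal] at hmem
    simp [segreMap, segreEntry, ((h.mem_isolatedVerts_iff hT).mp hv).2.1] at hmem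

theorem colon_partitionPoly (h : IsCliqueChain G B) (hT : IsSparse B T) (hm : 2 ≤ m)
    (hP : IsCompatible m P) :
    (edgeIdeal K (⊤ : SimpleGraph (Fin m)) G).colon {partitionPoly K hm P hP} =
      primeOfCutSet K m G T := by
  refine le_antisymm (fun g hg => ?_) fun g hg =>
    Submodule.mem_colon_singleton.mpr (h.mul_partitionPoly_mem hT hm hP hg)
  rw [h.primeOfCutSet_eq_segreIdeal hT.subset]
  have hp : (segreIdeal K m T).IsPrime := inferInstance
  have := h.edgeIdeal_le_segreIdeal hT.subset (Submodule.mem_colon_singleton.mp hg)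
  exact (hp.mem_or_mem this).resolve_right (h.partitionPoly_notMem hT hm hP)

end IsCliqueChain

theorem isHomogeneous_partitionPoly {G : SimpleGraph (Fin n)} {T : Finset (Fin n)}
    {P : Finpartition (forestEdges G T)} (hm : 2 ≤ m) (hP : IsCompatible m P) :
    (partitionPoly K hm P hP).IsHomogeneous
      (∑ p ∈ P.parts, (sliceVerts p).card + (isolatedVerts G T).card) := by
  rw [partitionPoly]
  refine IsHomogeneous.mul ?_ ?_
  · rw [← Finset.sum_attach]
    exact IsHomogeneous.prod _ _ _ fun p _ => isHomogeneous_sliceMinor _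
  · rw [Finset.card_eq_sum_ones]
    exact IsHomogeneous.prod _ _ _ fun v _ => isHomogeneous_X _ _

end minors

/-! ### Chains of vectors and alternating functions -/

section alternating

variable {L : Type*} [Field L] {m : ℕ} {F : (ℕ → Fin m → L) → L} {a b : ℕ}

theorem eq_neg_of_swap (hlin : ∀ k, a < k → k < b → ∀ z, ∃ c : Fin m → L,
      ∀ v, F (Function.update z k v) = ∑ i, v i * c i)
    (halt : ∀ k, a ≤ k → k < b → ∀ z, z k = z (k + 1) → F z = 0)
    {k : ℕ} (hak : a < k) (hkb : k + 1 < b) (z : ℕ → Fin m → L) :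
    F z = - F (Function.update (Function.update z k (z (k + 1))) (k + 1) (z k)) := by
  let H (u v : Fin m → L) : L := F (Function.update (Function.update z k u) (k + 1) v)
  have hne : k ≠ k + 1 := by omega
  have h1 : ∀ u v v', H u (v + v') = H u v + H u v' := by
    intro u v v'
    obtain ⟨c, hc⟩ := hlin (k + 1) (by omega) hkb (Function.update z k u)
    simp only [H, hc, Pi.add_apply, add_mul, Finset.sum_add_distrib]
  have h2 : ∀ u u' v, H (u + u') v = H u v + H u' v := by
    intro u u' v
    obtain ⟨c, hc⟩ := hlin k hak (by omega) (Function.update z (k + 1) v)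
    simp only [H, Function.update_comm hne, hc, Pi.add_apply, add_mul, Finset.sum_add_distrib]
  have h3 : ∀ u, H u u = 0 := fun u => halt k hak.le (by omega) _ (by
    rw [Function.update_of_ne hne, Function.update_self, Function.update_self])
  have h4 : H (z k) (z (k + 1)) = F z := by
    simp only [H, Function.update_eq_self]
  have h5 := h3 (z k + z (k + 1))
  rw [h1, h2, h2, h3, h3, zero_add, add_zero] at h5
  rw [← h4]
  exact eq_neg_of_add_eq_zero_right h5

theorem eq_zero_of_eq (hlin : ∀ k, a < k → k < b → ∀ z, ∃ c : Fin m → L,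
      ∀ v, F (Function.update z k v) = ∑ i, v i * c i)
    (halt : ∀ k, a ≤ k → k < b → ∀ z, z k = z (k + 1) → F z = 0)
    {i j : ℕ} (hij : i < j) (hai : a ≤ i) (hjb : j ≤ b) (hne : ¬ (i = a ∧ j = b))
    (z : ℕ → Fin m → L) (hz : z i = z j) : F z = 0 := by
  obtain ⟨r, rfl⟩ : ∃ r, j = i + 1 + r := ⟨j - (i + 1), by omega⟩
  induction r generalizing i z with
  | zero => exact halt i hai (by omega) z hz
  | succ r ih =>
    rcases hjb.eq_or_lt with hb | hb
    · rw [eq_neg_of_swap hlin halt (k := i) (by omega) (by omega), neg_eq_zero]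
      have hj : i + 1 + (r + 1) = i + 1 + 1 + r := by omega
      rw [hj] at hz hjb
      refine ih (by omega) _ (by omega) hjb (by omega) ?_
      rw [Function.update_self, Function.update_of_ne (by omega), Function.update_of_ne (by omega),
        hz]
    · have hk : i + 1 + r + 1 = i + 1 + (r + 1) := by omega
      rw [eq_neg_of_swap hlin halt (k := i + 1 + r) (by omega) (by omega), neg_eq_zero]
      refine ih hai _ (by omega) (by omega) (by omega) ?_
      rw [Function.update_of_ne (by omega), Function.update_of_ne (by omega),
        Function.update_of_ne (by omega), Function.update_self, hk, hz]

/-- Let `F` be a function of a sequence of vectors in an `m`-dimensional space that is linear in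
the vectors strictly between positions `a` and `b` and vanishes when two consecutive vectors between
these positions agree. If `F z ≠ 0` with `z a`, `z b` independent, then there are at most `m`
positions: otherwise some inner vector is a combination of the others, and `F` vanishes on
each of the resulting sequences. -/
theorem sub_add_one_le_of_ne_zero (hab : a < b)
    (hlin : ∀ k, a < k → k < b → ∀ z, ∃ c : Fin m → L,
      ∀ v, F (Function.update z k v) = ∑ i, v i * c i)
    (halt : ∀ k, a ≤ k → k < b → ∀ z, z k = z (k + 1) → F z = 0)
    {z : ℕ → Fin m → L} (hz : F z ≠ 0) {i i' : Fin m}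
    (hind : z a i * z b i' - z a i' * z b i ≠ 0) : b - a + 1 ≤ m := by
  by_contra hm
  let w (t : Fin (b - a + 1)) : Fin m → L := z (a + t.val)
  have hdep : ¬ LinearIndependent L w := fun hw => by
    have := hw.fintype_card_le_finrank
    simp only [Fintype.card_fin, Module.finrank_fintype_fun_eq_card] at this
    omega
  obtain ⟨g, hg, t₁, ht₁⟩ := Fintype.not_linearIndependent_iff.mp hdep
  obtain ⟨t, ht0, htb, hgt⟩ : ∃ t : Fin (b - a + 1), 0 < t.val ∧ t.val < b - a ∧ g t ≠ 0 := by
    by_contra! hcon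
    let t₀ : Fin (b - a + 1) := ⟨0, by omega⟩
    let t₂ : Fin (b - a + 1) := ⟨b - a, by omega⟩
    have hsum := Fintype.sum_eq_add (f := fun t => g t • w t) t₀ t₂
      (by simp only [t₀, t₂, ne_eq, Fin.mk.injEq]; omega) (fun t ht => by
        have := t.isLt
        simp only [t₀, t₂, ne_eq, Fin.ext_iff] at ht
        rw [hcon t (by omega) (by omega), zero_smul])
    rw [hg] at hsum
    have h2 : w t₂ = z b := by simp only [w, t₂]; congr 1; omega
    have h0 : w t₀ = z a := rfl
    rw [h0, h2] at hsum
    have e := congrFun hsum i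
    have e' := congrFun hsum i'
    simp only [Pi.zero_apply, Pi.add_apply, Pi.smul_apply, smul_eq_mul] at e e'
    have g0 : g t₀ = 0 := by
      refine (mul_eq_zero.mp ?_).resolve_right hind
      linear_combination z b i * e' - z b i' * e
    have g2 : g t₂ = 0 := by
      refine (mul_eq_zero.mp ?_).resolve_right hind
      linear_combination z a i' * e - z a i * e'
    apply ht₁
    rcases Nat.eq_zero_or_pos t₁.val with h | h
    · rw [show t₁ = t₀ from Fin.ext h, g0]
    · rcases Nat.lt_or_ge t₁.val (b - a) with h' | h'
      · exact hcon t₁ h h'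
      · rw [show t₁ = t₂ from Fin.ext (by simp only [t₂]; omega), g2]
  obtain ⟨c, hc⟩ := hlin (a + t.val) (by omega) (by omega) z
  have hsum : ∑ s, g s * F (Function.update z (a + t.val) (w s)) = 0 := by
    have h1 : ∑ s, g s * F (Function.update z (a + t.val) (w s)) =
        ∑ j, (∑ s, g s • w s) j * c j := by
      simp only [hc, Finset.mul_sum, Finset.sum_apply, Finset.sum_mul, Pi.smul_apply, smul_eq_mul]
      rw [Finset.sum_comm]
      simp only [mul_assoc]
    rw [h1, hg]
    simp
  rw [Fintype.sum_eq_single t] at hsum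
  · simp only [w, Function.update_eq_self] at hsum
    exact (mul_ne_zero hgt hz) hsum
  · intro s hst
    have hs : a + s.val ≠ a + t.val := fun h => hst (Fin.ext (by omega))
    have heq : Function.update z (a + t.val) (w s) (a + s.val) =
        Function.update z (a + t.val) (w s) (a + t.val) := by
      rw [Function.update_self, Function.update_of_ne hs]
    have hsb := s.isLt
    rcases Nat.lt_or_gt_of_ne hs with hlt | hlt
    · rw [eq_zero_of_eq hlin halt hlt (by omega) (by omega) (by omega) _ heq, mul_zero]
    · rw [eq_zero_of_eq hlin halt hlt (by omega) (by omega) (by omega) _ heq.symm, mul_zero]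

end alternating

/-! ### Column degrees -/

/-- The weight recording the multidegree of a polynomial in the columns of the generic matrix. -/
noncomputable def colWeight (m n : ℕ) (p : Fin m × Fin n) : Fin n →₀ ℕ := Finsupp.single p.2 1

section columns

variable {K : Type*} [Field K] {m n : ℕ}

theorem sum_weight_colWeight (u : (Fin m × Fin n) →₀ ℕ) :
    ∑ j, Finsupp.weight (colWeight m n) u j = Finsupp.weight (1 : Fin m × Fin n → ℕ) u := by
  induction u using finsupp_nat_induction with
  | h0 => simp
  | h1 u p ih =>
    simp only [map_add, Finsupp.add_apply, Finset.sum_add_distrib, ih, Finsupp.weight_single]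
    simp [colWeight, Finsupp.single_apply]

theorem one_le_weight_of_mem_support {u : (Fin m × Fin n) →₀ ℕ} {p : Fin m × Fin n}
    (hp : p ∈ u.support) : 1 ≤ Finsupp.weight (colWeight m n) u p.2 := by
  obtain ⟨v, rfl⟩ := exists_eq_add_single hp
  simp [Finsupp.weight_single, colWeight]

/-- Scaling the columns of a matrix by independent variables separates the parts of a polynomial of
different column degrees. -/
theorem coeff_aeval_C_mul_X {A : Type*} [CommRing A] [Algebra K A] (x : Fin m × Fin n → A)
    (D : Fin n →₀ ℕ) (f : MvPolynomial (Fin m × Fin n) K) :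
    coeff D (aeval (fun p => (C (x p) * X p.2 : MvPolynomial (Fin n) A)) f) =
      aeval x (weightedHomogeneousComponent (colWeight m n) D f) := by
  induction f using MvPolynomial.induction_on' with
  | add p q hp hq => simp only [map_add, coeff_add, hp, hq]
  | monomial u c =>
    have key : aeval (fun p => (C (x p) * X p.2 : MvPolynomial (Fin n) A)) (monomial u (1 : K)) =
        C (aeval x (monomial u (1 : K))) * monomial (Finsupp.weight (colWeight m n) u) 1 := by
      induction u using finsupp_nat_induction with
      | h0 => simp
      | h1 u p ih =>
        rw [monomial_add_single_one, map_mul, map_mul, ih, map_add, Finsupp.weight_single, one_smul,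
          colWeight, monomial_add_single, aeval_X, aeval_X, map_mul, pow_one]
        ring
    have hc : (monomial u c : MvPolynomial (Fin m × Fin n) K) = c • monomial u 1 := by
      rw [smul_monomial, smul_eq_mul, mul_one]
    rw [hc, map_smul, map_smul, key, coeff_smul, coeff_C_mul, coeff_monomial]
    have hmon := isWeightedHomogeneous_monomial (colWeight m n) u (1 : K) rfl
    split_ifs with hD
    · rw [← hD, hmon.weightedHomogeneousComponent_same, mul_one, map_smul]
    · rw [hmon.weightedHomogeneousComponent_ne D (Ne.symm hD)]
      simp

variable {T : Finset (Fin n)} {f g : MvPolynomial (Fin m × Fin n) K} {D : Fin n →₀ ℕ}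

theorem weightedHomogeneousComponent_mem_segreIdeal (hf : f ∈ segreIdeal K m T) :
    weightedHomogeneousComponent (colWeight m n) D f ∈ segreIdeal K m T := by
  rw [mem_segreIdeal, segreMap, ← coeff_aeval_C_mul_X]
  have h := aeval_eq_zero_of_mem_segreIdeal hf
    (fun j i => (C (X (Sum.inl (color T j, i))) :
      MvPolynomial (Fin n) (MvPolynomial ((ℕ × Fin m) ⊕ Fin n) K)))
    (fun j => if j ∈ T then 0 else C (X (Sum.inr j)) * X j) (fun j hj => if_pos hj)
    (fun j j' hlt _ _ hT => by rw [(color_eq_iff hlt.le).mpr hT])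
  have hfun : (fun p : Fin m × Fin n => (C (segreEntry K m T p) * X p.2 :
      MvPolynomial (Fin n) (MvPolynomial ((ℕ × Fin m) ⊕ Fin n) K))) =
      fun p => C (X (Sum.inl (color T p.2, p.1))) *
        if p.2 ∈ T then 0 else C (X (Sum.inr p.2)) * X p.2 := by
    funext p
    by_cases hp : p.2 ∈ T
    · simp [segreEntry, hp]
    · simp [segreEntry, hp, mul_assoc]
  rw [hfun, h, coeff_zero]

theorem exists_weightedHomogeneousComponent_notMem (hf : f ∉ segreIdeal K m T) :
    ∃ D, weightedHomogeneousComponent (colWeight m n) D f ∉ segreIdeal K m T := by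
  by_contra! hcon
  apply hf
  let A := MvPolynomial ((ℕ × Fin m) ⊕ Fin n) K
  let e : MvPolynomial (Fin n) A →ₐ[K] A := (aeval fun _ => (1 : A) :
    MvPolynomial (Fin n) A →ₐ[A] A).restrictScalars K
  have he : segreMap K m T =
      e.comp (aeval fun p => (C (segreEntry K m T p) * X p.2 : MvPolynomial (Fin n) A)) := by
    ext p
    simp [segreMap, e]
  have h0 : aeval (fun p => (C (segreEntry K m T p) * X p.2 : MvPolynomial (Fin n) A)) f = 0 := by
    ext1 D
    rw [coeff_aeval_C_mul_X, coeff_zero]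
    exact mem_segreIdeal.mp (hcon D)
  rw [mem_segreIdeal, he, AlgHom.comp_apply, h0, map_zero]

theorem aeval_congr_of_colDegree {A : Type*} [CommRing A] [Algebra K A]
    (hg : IsWeightedHomogeneous (colWeight m n) g D) {x x' : Fin m × Fin n → A}
    (hx : ∀ p, D p.2 ≠ 0 → x p = x' p) : aeval x g = aeval x' g := by
  refine eval₂Hom_congr' rfl (fun p hp _ => hx p ?_) rfl
  obtain ⟨u, hu, hpu⟩ := (mem_vars_iff_mem_support p).mp hp
  rw [← hg (mem_support_iff.mp hu)]
  exact Nat.one_le_iff_ne_zero.mp (one_le_weight_of_mem_support hpu)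

/-- A polynomial of degree one in a column is linear in it. -/
theorem aeval_linear_of_colDegree {A : Type*} [CommRing A] [Algebra K A]
    (hg : IsWeightedHomogeneous (colWeight m n) g D) {j₀ : Fin n} (hD : D j₀ = 1)
    (x : Fin m × Fin n → A) (v : Fin m → A) :
    aeval (fun p => if p.2 = j₀ then v p.1 else x p) g =
      ∑ i, v i * aeval (fun p => if p.2 = j₀ then (if p.1 = i then 1 else 0) else x p) g := by
  have key : ∀ u ∈ g.support, aeval (fun p => if p.2 = j₀ then v p.1 else x p) (monomial u (1 : K)) =
      ∑ i, v i * aeval (fun p => if p.2 = j₀ then (if p.1 = i then 1 else 0) else x p)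
        (monomial u (1 : K)) := by
    intro u hu
    have hw := hg (mem_support_iff.mp hu)
    obtain ⟨p, hp, hpj⟩ : ∃ p ∈ u.support, p.2 = j₀ := by
      by_contra! hcon
      have : Finsupp.weight (colWeight m n) u j₀ = 0 := by
        rw [Finsupp.weight_apply, Finsupp.sum, Finset.sum_apply']
        refine Finset.sum_eq_zero fun p hp => ?_
        simp [colWeight, hcon p hp]
      rw [hw, hD] at this
      exact one_ne_zero this
    obtain ⟨u', rfl⟩ := exists_eq_add_single hp
    have hu' : ∀ q ∈ u'.support, q.2 ≠ j₀ := by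
      intro q hq hqj
      have h1 := one_le_weight_of_mem_support hq
      rw [← hw, map_add, Finsupp.add_apply, Finsupp.weight_single, one_smul, colWeight, hpj,
        Finsupp.single_eq_same] at hD
      rw [hqj] at h1
      omega
    have hind : ∀ y y' : Fin m → A,
        aeval (fun p => if p.2 = j₀ then y p.1 else x p) (monomial u' (1 : K)) =
        aeval (fun p => if p.2 = j₀ then y' p.1 else x p) (monomial u' (1 : K)) := by
      intro y y'
      refine eval₂Hom_congr' rfl (fun q hq _ => ?_) rfl
      rw [vars_monomial one_ne_zero] at hq
      simp [hu' q hq]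
    simp only [monomial_add_single_one, map_mul, aeval_X, hpj, if_true]
    rw [Finset.sum_eq_single p.1]
    · rw [hind v fun q => if q = p.1 then 1 else 0]
      simp [mul_comm]
    · intro i _ hi
      simp [hi.symm]
    · simp
  rw [← support_sum_monomial_coeff g]
  simp only [map_sum, Finset.mul_sum]
  rw [Finset.sum_comm]
  refine Finset.sum_congr rfl fun u hu => ?_
  have hc : (monomial u (coeff u g) : MvPolynomial (Fin m × Fin n) K) =
      coeff u g • monomial u 1 := by
    rw [smul_monomial, smul_eq_mul, mul_one]
  simp only [hc, map_smul, key u hu, mul_smul_comm, Finset.smul_sum]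

end columns

/-! ### Column degrees of the polynomials with colon ideal `P_T` -/

section lower

variable {K : Type*} [Field K] {m n : ℕ} {G : SimpleGraph (Fin n)} {B T : Finset (Fin n)}
  {f g : MvPolynomial (Fin m × Fin n) K}

/-- The total degree of the column degree `D` in the columns of the component of `G \ T` with
index `k`. -/
noncomputable def compDegree (T : Finset (Fin n)) (D : Fin n → ℕ) (k : ℕ) : ℕ :=
  ∑ j ∈ Finset.univ.filter (fun j => color T j = k ∧ j ∉ T), D j

theorem eq_zero_of_compDegree_eq_zero {D : Fin n → ℕ} {k : ℕ} (h : compDegree T D k = 0)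
    {j : Fin n} (hj : color T j = k) (hjT : j ∉ T) : D j = 0 :=
  (Finset.sum_eq_zero_iff.mp h) j (Finset.mem_filter.mpr ⟨Finset.mem_univ j, hj, hjT⟩)

/-- A matrix of the variety of `P_T` whose components on both sides of `τ` share their vector lies in
the variety of the cut set `T \ {τ}`. -/
theorem aeval_eq_zero_of_mem_erase {A : Type*} [CommRing A] [Algebra K A] {τ : Fin n} (hτ : τ ∈ T)
    (hg : g ∈ segreIdeal K m (T.erase τ)) (z : ℕ → Fin m → A) (y : Fin n → A)
    (hy : ∀ j ∈ T, y j = 0) (hz : z (color T τ) = z (color T τ + 1)) :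
    aeval (fun p : Fin m × Fin n => z (color T p.2) p.1 * y p.2) g = 0 := by
  refine aeval_eq_zero_of_mem_segreIdeal hg (fun j => z (color T j)) y
    (fun j hj => hy j (Finset.mem_of_mem_erase hj)) fun j j' hlt hj hj' hT => ?_
  have hT' : ∀ σ ∈ T, σ ≠ τ → j ≤ σ → j' ≤ σ := fun σ hσ hne =>
    hT σ (Finset.mem_erase.mpr ⟨hne, hσ⟩)
  by_cases hcase : j ≤ τ → j' ≤ τ
  · have : color T j = color T j' := (color_eq_iff hlt.le).mpr fun σ hσ => by
      rcases eq_or_ne σ τ with rfl | hne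
      · exact hcase
      · exact hT' σ hσ hne
    simp only [this]
  · push Not at hcase
    have h1 : color T j = color T τ := (color_eq_iff hcase.1).mpr fun σ hσ hle => by
      rcases eq_or_ne σ τ with rfl | hne
      · exact le_rfl
      · exact hcase.2.le.trans (hT' σ hσ hne hle)
    have h2 : color T j' = color T τ + 1 := color_succ hτ hcase.2 fun σ hσ hlt' =>
      hT' σ hσ hlt'.ne' (hcase.1.trans hlt'.le)
    simp only [h1, h2, hz]

namespace IsCliqueChain

theorem mem_segreIdeal_of_colon (h : IsCliqueChain G B)
    (hf : (edgeIdeal K (⊤ : SimpleGraph (Fin m)) G).colon {f} = primeOfCutSet K m G T)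
    {T' : Finset (Fin n)} (hT' : T' ⊆ B) {r : MvPolynomial (Fin m × Fin n) K}
    (hr : r ∈ primeOfCutSet K m G T) (hr' : r ∉ segreIdeal K m T') : f ∈ segreIdeal K m T' := by
  rw [← hf, Submodule.mem_colon_singleton, smul_eq_mul] at hr
  have hp : (segreIdeal K m T').IsPrime := inferInstance
  exact (hp.mem_or_mem (h.edgeIdeal_le_segreIdeal hT' hr)).resolve_left hr'

theorem X_notMem_segreIdeal (i : Fin m) {j : Fin n} (hj : j ∉ T) :
    (X (i, j) : MvPolynomial (Fin m × Fin n) K) ∉ segreIdeal K m T := by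
  rw [mem_segreIdeal]
  simp [segreMap, segreEntry, hj]

theorem minor_notMem_segreIdeal {i i' : Fin m} (hi : i ≠ i') {j j' : Fin n} (hj : j ∉ T)
    (hj' : j' ∉ T) (hc : color T j ≠ color T j') : minor K i i' j j' ∉ segreIdeal K m T := by
  intro hmem
  have h0 := aeval_eq_zero_of_mem_segreIdeal (A := K) hmem
    (fun l a => if (color T l = color T j ∧ a = i) ∨ (color T l = color T j' ∧ a = i') then 1 else 0)
    (fun l => if l ∈ T then 0 else 1) (fun l hl => if_pos hl)
    (fun l l' hlt _ _ hT => by rw [(color_eq_iff hlt.le).mpr hT])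
  simp [minor, hj, hj', hi, hi.symm, hc, hc.symm] at h0

/-- The ideals of the cut sets obtained from `T` by adding a gluing vertex `v`, and removing a
neighbouring integer if it lies in `T`, force the column of `v` to occur. -/
theorem exists_cutSet_insert (h : IsCliqueChain G B) (hT : IsSparse B T) (hm : 2 ≤ m)
    (hf : (edgeIdeal K (⊤ : SimpleGraph (Fin m)) G).colon {f} = primeOfCutSet K m G T)
    {v : Fin n} (hv : v ∈ B) (hvT : v ∉ T) :
    ∃ T', f ∈ segreIdeal K m T' ∧ ∀ (A : Type*) [CommRing A] [Algebra K A]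
      (g : MvPolynomial (Fin m × Fin n) K) (_ : g ∈ segreIdeal K m T')
      (z : ℕ → Fin m → A) (y : Fin n → A) (_ : ∀ j ∈ T, y j = 0) (_ : y v = 0),
      aeval (fun p : Fin m × Fin n => z (color T p.2) p.1 * y p.2) g = 0 := by
  by_cases hcase : ∃ τ ∈ T, τ.val + 1 = v.val ∨ v.val + 1 = τ.val
  · obtain ⟨τ, hτ, hvτ⟩ := hcase
    have hne : v ≠ τ := fun e => hvT (e ▸ hτ)
    refine ⟨insert v (T.erase τ), ?_, ?_⟩
    · refine h.mem_segreIdeal_of_colon hf (Finset.insert_subset hv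
        ((Finset.erase_subset _ _).trans hT.subset))
        (X_mem_primeOfCutSet G (⟨0, by omega⟩ : Fin m) hτ) (X_notMem_segreIdeal _ ?_)
      simp [hne.symm]
    · intro A _ _ g hg z y hy hyv
      refine aeval_eq_zero_of_mem_segreIdeal hg (fun j => z (color T j)) y ?_ ?_
      · intro j hj
        rcases Finset.mem_insert.mp hj with rfl | hj
        · exact hyv
        · exact hy j (Finset.mem_of_mem_erase hj)
      · intro j j' hlt hj hj' hT'
        have : color T j = color T j' := (color_eq_iff hlt.le).mpr fun σ hσ hle => by
          rcases eq_or_ne σ τ with rfl | hne'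
          · have h1 := hT' v (Finset.mem_insert_self _ _)
            have h2 : j ≠ σ := fun e => hj (hy j (e ▸ hσ))
            have h3 : j ≠ v := fun e => hj (e ▸ hyv)
            have h4 : j' ≠ v := fun e => hj' (e ▸ hyv)
            simp only [Fin.le_def, ne_eq, Fin.ext_iff] at *
            omega
          · exact hT' σ (Finset.mem_insert_of_mem (Finset.mem_erase.mpr ⟨hne', hσ⟩)) hle
        simp only [this]
  · push Not at hcase
    have hpos := h.pos v hv
    have hlt := h.lt v hv
    let u : Fin n := ⟨v.val - 1, by omega⟩
    let w : Fin n := ⟨v.val + 1, by omega⟩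
    have huv : u < v := by simp only [u, Fin.lt_def]; omega
    have hvw : v < w := by simp only [w, Fin.lt_def]; omega
    have huT : u ∉ T := fun hu => (hcase u hu).1 (by simp only [u]; omega)
    have hwT : w ∉ T := fun hw => (hcase w hw).2 rfl
    refine ⟨insert v T, ?_, ?_⟩
    · refine h.mem_segreIdeal_of_colon hf (Finset.insert_subset hv hT.subset)
        (h.minor_mem_primeOfCutSet hT.subset (⟨0, by omega⟩ : Fin m) ⟨1, by omega⟩ huT hwT ?_)
        (minor_notMem_segreIdeal (by simp) ?_ ?_ ?_)
      · refine (color_eq_iff (huv.trans hvw).le).mpr fun σ hσ hle => ?_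
        have h1 : σ ≠ u := fun e => huT (e ▸ hσ)
        have h2 : σ ≠ v := fun e => hvT (e ▸ hσ)
        simp only [u, w, Fin.le_def, ne_eq, Fin.ext_iff] at *
        omega
      · simp [huv.ne, huT]
      · simp [hvw.ne', hwT]
      · exact (color_lt (Finset.mem_insert_self _ _) huv.le hvw).ne
    · intro A _ _ g hg z y hy hyv
      refine aeval_eq_zero_of_mem_segreIdeal hg (fun j => z (color T j)) y ?_ ?_
      · intro j hj
        rcases Finset.mem_insert.mp hj with rfl | hj
        · exact hyv
        · exact hy j hj
      · intro j j' hlt _ _ hT'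
        have : color T j = color T j' := (color_eq_iff hlt.le).mpr fun σ hσ =>
          hT' σ (Finset.mem_insert_of_mem hσ)
        simp only [this]

/-- The constraints on the column degrees of a polynomial whose colon ideal is `P_T`: every gluing
vertex outside `T` occurs, both components next to an element of `T` occur, and a run of
components in which the inner ones have degree one has length at most `m`. -/
theorem exists_colDegree (h : IsCliqueChain G B) (hT : IsSparse B T) (hm : 2 ≤ m) {d : ℕ}
    (hd : f.IsHomogeneous d) (hfT : f ∉ segreIdeal K m T)
    (hf : (edgeIdeal K (⊤ : SimpleGraph (Fin m)) G).colon {f} = primeOfCutSet K m G T) :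
    ∃ D : Fin n → ℕ, ∑ j, D j = d ∧ (∀ v ∈ B, v ∉ T → 1 ≤ D v) ∧
      (∀ τ ∈ T, 1 ≤ compDegree T D (color T τ) ∧ 1 ≤ compDegree T D (color T τ + 1)) ∧
      ∀ a b, a < b → b ≤ T.card → (∀ k, a < k → k < b → compDegree T D k = 1) →
        b - a + 1 ≤ m := by
  obtain ⟨D, hD⟩ := exists_weightedHomogeneousComponent_notMem hfT
  set g := weightedHomogeneousComponent (colWeight m n) D f with hgdef
  have hg : IsWeightedHomogeneous (colWeight m n) g D :=
    weightedHomogeneousComponent_isWeightedHomogeneous D f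
  let R := MvPolynomial ((ℕ × Fin m) ⊕ Fin n) K
  let L := FractionRing R
  let z₀ : ℕ → Fin m → L := fun k i => algebraMap R L (X (Sum.inl (k, i)))
  let y₀ : Fin n → L := fun j => if j ∈ T then 0 else algebraMap R L (X (Sum.inr j))
  have hy₀ : ∀ j ∈ T, y₀ j = 0 := fun j hj => if_pos hj
  let F (z : ℕ → Fin m → L) : L :=
    aeval (fun p : Fin m × Fin n => z (color T p.2) p.1 * y₀ p.2) g
  -- The generic point of the variety of `P_T`.
  have hF₀ : F z₀ ≠ 0 := by
    have he : (aeval fun p : Fin m × Fin n => z₀ (color T p.2) p.1 * y₀ p.2) =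
        ((Algebra.ofId R L).restrictScalars K).comp (segreMap K m T) := by
      ext ⟨i, j⟩
      rw [aeval_X, AlgHom.comp_apply, segreMap, aeval_X]
      by_cases hj : j ∈ T
      · simp [segreEntry, hj, y₀]
      · simp [segreEntry, hj, y₀, z₀, Algebra.ofId_apply]
    simp only [F, he]
    intro h0
    exact hD (mem_segreIdeal.mpr ((FaithfulSMul.algebraMap_injective R L)
      (Eq.trans h0 (map_zero (algebraMap R L)).symm)))
  have hFeq : ∀ τ ∈ T, ∀ z, z (color T τ) = z (color T τ + 1) → F z = 0 := by
    intro τ hτ z hz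
    refine aeval_eq_zero_of_mem_erase hτ (weightedHomogeneousComponent_mem_segreIdeal ?_)
      z y₀ hy₀ hz
    exact h.mem_segreIdeal_of_colon hf ((Finset.erase_subset _ _).trans hT.subset)
      (X_mem_primeOfCutSet G (⟨0, by omega⟩ : Fin m) hτ) (X_notMem_segreIdeal _ (by simp))
  have hcongr : ∀ k, compDegree T D k = 0 → ∀ z v, F (Function.update z k v) = F z := by
    intro k hk z v
    refine aeval_congr_of_colDegree hg fun p hp => ?_
    by_cases hpk : color T p.2 = k
    · by_cases hpT : p.2 ∈ T
      · simp only [hy₀ _ hpT, mul_zero]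
      · exact absurd (eq_zero_of_compDegree_eq_zero hk hpk hpT) hp
    · rw [Function.update_of_ne hpk]
  refine ⟨D, ?_, ?_, ?_, ?_⟩
  · have hg0 : g ≠ 0 := fun h0 => hD (h0 ▸ zero_mem _)
    obtain ⟨u, hu⟩ := ne_zero_iff.mp hg0
    have hw := hg hu
    rw [← hw, sum_weight_colWeight]
    rw [hgdef, coeff_weightedHomogeneousComponent] at hu
    exact hd fun h0 => hu (by simp [h0])
  · intro v hv hvT
    by_contra hDv
    obtain ⟨T', hfT', hT'⟩ := h.exists_cutSet_insert hT hm hf hv hvT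
    have h1 := hT' L g (weightedHomogeneousComponent_mem_segreIdeal hfT') z₀
      (Function.update y₀ v 0) (fun j hj => by
        rw [Function.update_of_ne (by rintro rfl; exact hvT hj), hy₀ j hj]) (by simp)
    refine hF₀ (Eq.trans (aeval_congr_of_colDegree hg fun p hp => ?_) h1)
    rw [Function.update_of_ne]
    rintro hpv
    exact hp (by rw [hpv]; omega)
  · intro τ hτ
    constructor
    · by_contra hlt
      refine hF₀ ((hcongr (color T τ) (by omega) z₀ (z₀ (color T τ + 1))).symm.trans (hFeq τ hτ _ ?_))
      rw [Function.update_self, Function.update_of_ne (by omega)]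
    · by_contra hlt
      refine hF₀ ((hcongr (color T τ + 1) (by omega) z₀ (z₀ (color T τ))).symm.trans (hFeq τ hτ _ ?_))
      rw [Function.update_self, Function.update_of_ne (by omega)]
  · intro a b hab hb hrun
    refine sub_add_one_le_of_ne_zero (F := F) hab ?_ ?_ hF₀ (i := ⟨0, by omega⟩)
      (i' := ⟨1, by omega⟩) ?_
    · intro k hak hkb z
      -- Degree one in a component means degree one in exactly one of its columns.
      obtain ⟨j₀, hj₀, hj₀1, hrest⟩ : ∃ j₀, (color T j₀ = k ∧ j₀ ∉ T) ∧ D j₀ = 1 ∧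
          ∀ j, color T j = k → j ∉ T → j ≠ j₀ → D j = 0 := by
        have hk := hrun k hak hkb
        have hne : compDegree T D k ≠ 0 := by omega
        obtain ⟨j₀, hj₀, hne₀⟩ := Finset.exists_ne_zero_of_sum_ne_zero hne
        have hsum := Finset.add_sum_erase _ (fun j => D j) hj₀
        rw [compDegree] at hk
        refine ⟨j₀, (Finset.mem_filter.mp hj₀).2, by omega, fun j hj hjT hjj => ?_⟩
        have h0 : ∑ j ∈ (Finset.univ.filter (fun j => color T j = k ∧ j ∉ T)).erase j₀, D j = 0 := by
          omega
        exact Finset.sum_eq_zero_iff.mp h0 j (Finset.mem_erase.mpr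
          ⟨hjj, Finset.mem_filter.mpr ⟨Finset.mem_univ _, hj, hjT⟩⟩)
      refine ⟨fun i => y₀ j₀ * aeval (fun p => if p.2 = j₀ then (if p.1 = i then 1 else 0) else
        z (color T p.2) p.1 * y₀ p.2) g, fun v => ?_⟩
      have h1 : F (Function.update z k v) = aeval (fun p => if p.2 = j₀ then v p.1 * y₀ j₀ else
          z (color T p.2) p.1 * y₀ p.2) g := by
        refine aeval_congr_of_colDegree hg fun p hp => ?_
        by_cases hpj : p.2 = j₀
        · rw [if_pos hpj, hpj, hj₀.1, Function.update_self]
        · rw [if_neg hpj]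
          by_cases hpT : p.2 ∈ T
          · simp only [hy₀ _ hpT, mul_zero]
          · rw [Function.update_of_ne]
            exact fun hpk => hp (hrest _ hpk hpT hpj)
      rw [h1, aeval_linear_of_colDegree hg hj₀1 (fun p => z (color T p.2) p.1 * y₀ p.2)
        fun i => v i * y₀ j₀]
      exact Finset.sum_congr rfl fun i _ => mul_assoc _ _ _
    · intro k hak hkb z hz
      obtain ⟨τ, hτ, rfl⟩ := exists_color_eq (T := T) (k := k) (by omega)
      exact hFeq τ hτ z hz
    · simp only [z₀, ← map_mul, ← map_sub]
      intro h0
      have h1 := (FaithfulSMul.algebraMap_injective R L)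
        (Eq.trans h0 (map_zero (algebraMap R L)).symm)
      have h2 := congrArg (aeval (R := K) (Sum.elim (fun q : ℕ × Fin m =>
        if q = (a, ⟨0, by omega⟩) ∨ q = (b, ⟨1, by omega⟩) then (1 : K) else 0) fun _ => 0)) h1
      simp [hab.ne] at h2

end IsCliqueChain

end lower

/-! ### Compatible partitions from break points -/

section partitions

variable {m n : ℕ} {G : SimpleGraph (Fin n)} {B T : Finset (Fin n)} {δ : ℕ → ℕ}

/-- The edge of `L(T)` attached to `τ` begins a new block of the partition determined by the
component degrees `δ`: it is not glued to the preceding edge, or the component containing the common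
vertex has degree different from one. -/
def IsStart (G : SimpleGraph (Fin n)) (T : Finset (Fin n)) (δ : ℕ → ℕ) (τ : Fin n) : Prop :=
  ∀ σ ∈ T, color T σ + 1 = color T τ → beta G T σ = alpha G T τ → δ (color T τ) ≠ 1

/-- The number of the block containing the edge of `L(T)` attached to `τ`. -/
noncomputable def blockIndex (G : SimpleGraph (Fin n)) (T : Finset (Fin n)) (δ : ℕ → ℕ)
    (τ : Fin n) : ℕ :=
  ((T.filter (IsStart G T δ)).filter (· ≤ τ)).card

theorem blockIndex_lt {σ τ : Fin n} (hτ : τ ∈ T) (hs : IsStart G T δ τ) (hlt : σ < τ) :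
    blockIndex G T δ σ < blockIndex G T δ τ := by
  refine Finset.card_lt_card ⟨Finset.monotone_filter_right _ fun x _ hx => le_trans hx hlt.le,
    fun hle => ?_⟩
  have := Finset.mem_filter.mp (hle (Finset.mem_filter.mpr
    ⟨Finset.mem_filter.mpr ⟨hτ, hs⟩, le_rfl⟩))
  exact absurd this.2 hlt.not_ge

namespace IsCliqueChain

theorem edge_injOn (h : IsCliqueChain G B) (hT : IsSparse B T) {σ τ : Fin n} (hσ : σ ∈ T)
    (hτ : τ ∈ T) (he : s(alpha G T σ, beta G T σ) = s(alpha G T τ, beta G T τ)) : σ = τ := by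
  rcases Sym2.eq_iff.mp he with ⟨h1, -⟩ | ⟨h1, h2⟩
  · refine color_injOn hσ hτ ?_
    rw [← h.color_alpha hT hσ, h1, h.color_alpha hT hτ]
  · have h3 := h.alpha_lt_beta hT hσ
    have h4 := h.alpha_lt_beta hT hτ
    rw [h1, h2] at h3
    exact absurd h3 h4.not_gt

theorem card_forestEdges_le (h : IsCliqueChain G B) (hT : IsSparse B T) :
    (forestEdges G T).card ≤ T.card := by
  have : forestEdges G T = T.image fun τ => s(alpha G T τ, beta G T τ) := by
    ext e
    rw [h.mem_forestEdges_iff hT, Finset.mem_image]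
    simp only [eq_comm]
  rw [this]
  exact Finset.card_image_le

/-- The edges of the block of `τ` attached to elements up to `τ` form a path from left to right. -/
theorem exists_walk (h : IsCliqueChain G B) (hT : IsSparse B T) (δ : ℕ → ℕ) {τ : Fin n}
    (hτ : τ ∈ T) :
    ∃ σ ∈ T, IsStart G T δ σ ∧ σ ≤ τ ∧
      ∃ w : (pathForest G T).spanningCoe.Walk (alpha G T σ) (beta G T τ),
        w.IsPath ∧ (∀ x ∈ w.support, x ≤ beta G T τ) ∧
        (∀ e, e ∈ w.edges ↔ ∃ ρ ∈ T, ρ ≤ τ ∧ blockIndex G T δ ρ = blockIndex G T δ τ ∧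
          e = s(alpha G T ρ, beta G T ρ)) ∧
        w.length + color T σ = color T τ + 1 ∧
        ∀ k, color T σ < k → k ≤ color T τ → δ k = 1 := by
  induction hk : color T τ using Nat.strong_induction_on generalizing τ with
  | _ k ih =>
  have hadj : (pathForest G T).spanningCoe.Adj (alpha G T τ) (beta G T τ) :=
    (h.pathForest_adj_iff hT).mpr ⟨τ, hτ, rfl⟩
  have hlt := h.alpha_lt_beta hT hτ
  by_cases hs : IsStart G T δ τ
  · refine ⟨τ, hτ, hs, le_rfl, hadj.toWalk, ?_, ?_, ?_, ?_, ?_⟩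
    · simp [SimpleGraph.Adj.toWalk, hlt.ne]
    · intro x hx
      simp only [SimpleGraph.Adj.toWalk, SimpleGraph.Walk.support_cons,
        SimpleGraph.Walk.support_nil, List.mem_cons, List.not_mem_nil, or_false] at hx
      rcases hx with rfl | rfl
      · exact hlt.le
      · exact le_rfl
    · intro e
      simp only [SimpleGraph.Adj.toWalk, SimpleGraph.Walk.edges_cons,
        SimpleGraph.Walk.edges_nil, List.mem_cons, List.not_mem_nil, or_false]
      constructor
      · rintro rfl
        exact ⟨τ, hτ, le_rfl, rfl, rfl⟩
      · rintro ⟨ρ, -, hle, hb, rfl⟩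
        rcases hle.eq_or_lt with rfl | hl
        · rfl
        · exact absurd hb (blockIndex_lt hτ hs hl).ne
    · simp [SimpleGraph.Adj.toWalk, hk, add_comm]
    · intro i h1 h2
      omega
  · have hs' := hs
    simp only [IsStart] at hs
    push Not at hs
    obtain ⟨ρ, hρ, hc, hba, hδ⟩ := hs
    have hρτ : ρ < τ := lt_of_color_lt (T := T) (by omega)
    have hle : ∀ x ∈ T, x < τ → x ≤ ρ := by
      intro x hx hxτ
      by_contra hgt
      have h1 := color_lt hρ le_rfl (not_le.mp hgt)
      have h2 := color_lt hx le_rfl hxτ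
      omega
    have hblock : blockIndex G T δ ρ = blockIndex G T δ τ := by
      refine congrArg Finset.card (Finset.filter_congr fun x hx => ?_)
      obtain ⟨hxT, hxs⟩ := Finset.mem_filter.mp hx
      refine ⟨fun hxρ => hxρ.trans hρτ.le, fun hxτ => ?_⟩
      rcases hxτ.eq_or_lt with rfl | hxlt
      · exact absurd hxs hs'
      · exact hle x hxT hxlt
    obtain ⟨σ, hσ, hσs, hσρ, w, hw, hsupp, hedges, hlen, hrun⟩ :=
      ih (color T ρ) (by omega) hρ rfl
    refine ⟨σ, hσ, hσs, hσρ.trans hρτ.le, (w.copy rfl hba).concat hadj, ?_, ?_, ?_, ?_, ?_⟩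
    · refine SimpleGraph.Walk.IsPath.concat (by simpa using hw) ?_ hadj
      intro hmem
      rw [SimpleGraph.Walk.support_copy] at hmem
      have := hsupp _ hmem
      rw [hba] at this
      exact this.not_gt hlt
    · intro x hx
      simp only [SimpleGraph.Walk.support_concat, SimpleGraph.Walk.support_copy,
        List.mem_append, List.mem_singleton] at hx
      rcases hx with hx | rfl
      · exact ((hsupp x hx).trans hba.le).trans hlt.le
      · exact le_rfl
    · intro e
      simp only [SimpleGraph.Walk.edges_concat, SimpleGraph.Walk.edges_copy,
        List.concat_eq_append, List.mem_append, List.mem_singleton, hedges]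
      constructor
      · rintro (⟨x, hx, hxρ, hxb, rfl⟩ | rfl)
        · exact ⟨x, hx, hxρ.trans hρτ.le, hxb.trans hblock, rfl⟩
        · exact ⟨τ, hτ, le_rfl, rfl, rfl⟩
      · rintro ⟨x, hx, hxτ, hxb, rfl⟩
        rcases hxτ.eq_or_lt with rfl | hxlt
        · exact Or.inr rfl
        · exact Or.inl ⟨x, hx, hle x hx hxlt, hxb.trans hblock.symm, rfl⟩
    · rw [SimpleGraph.Walk.length_concat, SimpleGraph.Walk.length_copy]
      omega
    · intro i h1 h2
      rcases (show i ≤ color T ρ ∨ i = color T τ by omega) with h3 | rfl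
      · exact hrun i h1 h3
      · exact hδ

/-- If every run of components whose inner degrees are one has length at most `m`, then the blocks
form an `m`-compatible partition. -/
theorem exists_isCompatible (h : IsCliqueChain G B) (hT : IsSparse B T)
    (hrun : ∀ a b, a < b → b ≤ T.card → (∀ k, a < k → k < b → δ k = 1) → b - a + 1 ≤ m) :
    ∃ P : Finpartition (forestEdges G T), IsCompatible m P ∧
      P.parts.card ≤ (T.filter (IsStart G T δ)).card := by
  let edge (τ : Fin n) : Sym2 (Fin n) := s(alpha G T τ, beta G T τ)
  let block (q : ℕ) : Finset (Sym2 (Fin n)) :=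
    (T.filter fun τ => blockIndex G T δ τ = q).image edge
  have hmem : ∀ q e, e ∈ block q ↔ ∃ τ ∈ T, blockIndex G T δ τ = q ∧ edge τ = e := by
    intro q e
    simp only [block, Finset.mem_image, Finset.mem_filter, and_assoc]
  let parts : Finset (Finset (Sym2 (Fin n))) := (T.image (blockIndex G T δ)).image block
  have hparts : ∀ p, p ∈ parts ↔ ∃ τ ∈ T, block (blockIndex G T δ τ) = p := by
    intro p
    simp [parts]
  let P : Finpartition (forestEdges G T) := Finpartition.ofExistsUnique parts
    (by
      intro p hp e he
      obtain ⟨τ, -, rfl⟩ := (hparts p).mp hp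
      obtain ⟨ρ, hρ, -, rfl⟩ := (hmem _ _).mp he
      exact (h.mem_forestEdges_iff hT).mpr ⟨ρ, hρ, rfl⟩)
    (by
      intro e he
      obtain ⟨τ, hτ, rfl⟩ := (h.mem_forestEdges_iff hT).mp he
      refine ⟨block (blockIndex G T δ τ), ⟨(hparts _).mpr ⟨τ, hτ, rfl⟩,
        (hmem _ _).mpr ⟨τ, hτ, rfl, rfl⟩⟩, ?_⟩
      rintro p ⟨hp, hep⟩
      obtain ⟨ρ, hρ, rfl⟩ := (hparts p).mp hp
      obtain ⟨x, hx, hxb, hxe⟩ := (hmem _ _).mp hep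
      rw [← hxb, h.edge_injOn hT hx hτ hxe])
    (by
      intro hp
      obtain ⟨τ, hτ, hb⟩ := (hparts _).mp hp
      have := (hmem (blockIndex G T δ τ) (edge τ)).mpr ⟨τ, hτ, rfl, rfl⟩
      rw [hb] at this
      exact Finset.notMem_empty _ this)
  refine ⟨P, ?_, ?_⟩
  · intro p hp
    obtain ⟨τ₀, hτ₀, rfl⟩ := (hparts p).mp hp
    obtain ⟨τ, hτ, hmax⟩ := Finset.exists_max_image
      (T.filter fun τ => blockIndex G T δ τ = blockIndex G T δ τ₀) id
      ⟨τ₀, Finset.mem_filter.mpr ⟨hτ₀, rfl⟩⟩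
    obtain ⟨hτT, hτb⟩ := Finset.mem_filter.mp hτ
    obtain ⟨σ, hσ, -, hστ, w, hw, -, hedges, hlen, hδ⟩ := h.exists_walk hT δ hτT
    refine ⟨_, _, w, hw, ?_, ?_⟩
    · have hc := color_mono (T := T) hστ
      have := hrun (color T σ) (color T τ + 1) (by omega) (color_lt_card hτT)
        (fun k h1 h2 => hδ k h1 (by omega))
      omega
    · ext e
      rw [List.mem_toFinset, hedges, hmem]
      constructor
      · rintro ⟨ρ, hρ, -, hρb, rfl⟩
        exact ⟨ρ, hρ, hρb.trans hτb, rfl⟩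
      · rintro ⟨ρ, hρ, hρb, rfl⟩
        exact ⟨ρ, hρ, hmax ρ (Finset.mem_filter.mpr ⟨hρ, hρb⟩), hρb.trans hτb.symm, rfl⟩
  · refine (Finset.card_image_le (s := T.image (blockIndex G T δ)) (f := block)).trans ?_
    have hsub : T.image (blockIndex G T δ) ⊆ Finset.Icc 1 (T.filter (IsStart G T δ)).card := by
      intro q hq
      obtain ⟨τ, hτ, rfl⟩ := Finset.mem_image.mp hq
      obtain ⟨σ, hσ, hs, hle, -⟩ := h.exists_walk hT δ hτ
      refine Finset.mem_Icc.mpr ⟨Finset.card_pos.mpr ⟨σ, Finset.mem_filter.mpr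
        ⟨Finset.mem_filter.mpr ⟨hσ, hs⟩, hle⟩⟩, Finset.card_le_card (Finset.filter_subset _ _)⟩
    simpa using Finset.card_le_card hsub

end IsCliqueChain

theorem IsCompatible.card_sliceVerts_le_card_add_one {P : Finpartition (forestEdges G T)}
    (hP : IsCompatible m P) {p : Finset (Sym2 (Fin n))} (hp : p ∈ P.parts) :
    (sliceVerts p).card ≤ p.card + 1 := by
  obtain ⟨u, v, w, hw, -, rfl⟩ := hP p hp
  have hsub : sliceVerts w.edges.toFinset ⊆ w.support.toFinset := by
    intro x hx
    obtain ⟨e, he, hxe⟩ := (Finset.mem_filter.mp hx).2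
    rw [List.mem_toFinset] at he ⊢
    exact w.mem_support_of_mem_edges he hxe
  calc (sliceVerts w.edges.toFinset).card ≤ w.support.length :=
        (Finset.card_le_card hsub).trans (List.toFinset_card_le _)
    _ = w.edges.length + 1 := by rw [w.length_support, w.length_edges]
    _ = w.edges.toFinset.card + 1 := by
      rw [List.toFinset_card_of_nodup (SimpleGraph.Walk.edges_nodup_of_support_nodup
        hw.support_nodup)]

/-! ### Counting column degrees -/

namespace IsCliqueChain

variable {D : Fin n → ℕ}

theorem card_le_compDegree (hD : ∀ v ∈ B, v ∉ T → 1 ≤ D v) {q : ℕ} {W : Finset (Fin n)}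
    (hW : ∀ v ∈ W, v ∈ B ∧ v ∉ T ∧ color T v = q) : W.card ≤ compDegree T D q := by
  calc W.card = ∑ v ∈ W, 1 := Finset.card_eq_sum_ones W
    _ ≤ ∑ v ∈ W, D v := Finset.sum_le_sum fun v hv => hD v (hW v hv).1 (hW v hv).2.1
    _ ≤ compDegree T D q := Finset.sum_le_sum_of_subset fun v hv =>
        Finset.mem_filter.mpr ⟨Finset.mem_univ v, (hW v hv).2.2, (hW v hv).2.1⟩

theorem lt_of_color_eq {σ v : Fin n} (hv : v ∉ T) (hσ : σ ∈ T) (hc : color T v = color T σ) :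
    v < σ := by
  rcases lt_trichotomy v σ with h1 | rfl | h1
  · exact h1
  · exact absurd hσ hv
  · exact absurd hc (color_lt hσ le_rfl h1).ne'

/-- The isolated vertices of `L(T)` in the component to the left of `τ` are to the left of
`α_τ`. -/
theorem lt_alpha_of_isolated (h : IsCliqueChain G B) (hT : IsSparse B T) {τ v : Fin n}
    (hτ : τ ∈ T) (hv : v ∈ isolatedVerts G T) (hc : color T v = color T τ) :
    v < alpha G T τ := by
  obtain ⟨hB, hvT, hne⟩ := (h.mem_isolatedVerts_iff hT).mp hv
  have hvτ := lt_of_color_eq hvT hτ hc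
  rcases lt_trichotomy v (alpha G T τ) with h1 | h1 | h1
  · exact h1
  · exact absurd h1 (hne τ hτ).1
  · exact absurd ⟨h1, hvτ⟩ (h.alpha_gap hT hτ v hB)

theorem beta_lt_of_isolated (h : IsCliqueChain G B) (hT : IsSparse B T) {τ v : Fin n}
    (hτ : τ ∈ T) (hv : v ∈ isolatedVerts G T) (hc : color T v = color T τ + 1) :
    beta G T τ < v := by
  obtain ⟨hB, hvT, hne⟩ := (h.mem_isolatedVerts_iff hT).mp hv
  have hvτ : τ < v := lt_of_color_lt (T := T) (by omega)
  rcases lt_trichotomy v (beta G T τ) with h1 | h1 | h1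
  · exact absurd ⟨hvτ, h1⟩ (h.beta_gap hT hτ v hB)
  · exact absurd h1 (hne τ hτ).2
  · exact h1

/-- In each component of `G \ T`, the degree is at least the number of isolated vertices of `L(T)`,
plus one if there is an element of `T` to its left, plus one if the edge of `L(T)` attached to the
element of `T` to its right begins a block. -/
theorem card_add_card_add_card_le_compDegree (h : IsCliqueChain G B) (hT : IsSparse B T)
    (hD : ∀ v ∈ B, v ∉ T → 1 ≤ D v)
    (hpos : ∀ τ ∈ T, 1 ≤ compDegree T D (color T τ) ∧ 1 ≤ compDegree T D (color T τ + 1)) (q : ℕ) :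
    (T.filter fun τ => color T τ + 1 = q).card +
      ((T.filter (IsStart G T (compDegree T D))).filter fun τ => color T τ = q).card +
      ((isolatedVerts G T).filter fun v => color T v = q).card ≤ compDegree T D q := by
  set A := T.filter fun τ => color T τ + 1 = q
  set S := (T.filter (IsStart G T (compDegree T D))).filter fun τ => color T τ = q
  set I := (isolatedVerts G T).filter fun v => color T v = q
  have hI' : ∀ v ∈ I, v ∈ B ∧ v ∉ T ∧ color T v = q := fun v hv => by
    obtain ⟨hv, hc⟩ := Finset.mem_filter.mp hv
    obtain ⟨h1, h2, -⟩ := (h.mem_isolatedVerts_iff hT).mp hv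
    exact ⟨h1, h2, hc⟩
  have hA1 : A.card ≤ 1 := Finset.card_le_one.mpr fun σ hσ τ hτ => by
    obtain ⟨hσ, h1⟩ := Finset.mem_filter.mp hσ
    obtain ⟨hτ, h2⟩ := Finset.mem_filter.mp hτ
    exact color_injOn hσ hτ (by omega)
  have hS1 : S.card ≤ 1 := Finset.card_le_one.mpr fun σ hσ τ hτ => by
    obtain ⟨hσ, h1⟩ := Finset.mem_filter.mp hσ
    obtain ⟨hτ, h2⟩ := Finset.mem_filter.mp hτ
    exact color_injOn (Finset.mem_filter.mp hσ).1 (Finset.mem_filter.mp hτ).1 (by omega)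
  have hIc := card_le_compDegree hD hI'
  have hαI : ∀ τ ∈ T, alpha G T τ ∉ I := fun τ hτ hm =>
    (((h.mem_isolatedVerts_iff hT).mp (Finset.mem_filter.mp hm).1).2.2 τ hτ).1 rfl
  have hβI : ∀ τ ∈ T, beta G T τ ∉ I := fun τ hτ hm =>
    (((h.mem_isolatedVerts_iff hT).mp (Finset.mem_filter.mp hm).1).2.2 τ hτ).2 rfl
  -- A component whose two boundary edges are glued contains no isolated vertex.
  have hglued : ∀ σ ∈ T, ∀ τ ∈ T, color T σ + 1 = q → color T τ = q →
      beta G T σ = alpha G T τ → I.card = 0 := by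
    intro σ hσ τ hτ hσq hτq he
    rw [Finset.card_eq_zero, Finset.eq_empty_iff_forall_notMem]
    intro v hv
    obtain ⟨hv, hc⟩ := Finset.mem_filter.mp hv
    have h1 := h.lt_alpha_of_isolated hT hτ hv (by omega)
    have h2 := h.beta_lt_of_isolated hT hσ hv (by omega)
    rw [he] at h2
    exact lt_asymm h1 h2
  rcases A.eq_empty_or_nonempty with hA0 | ⟨σ, hσ⟩
  · rcases S.eq_empty_or_nonempty with hS0 | ⟨τ, hτ⟩
    · rw [hA0, hS0, Finset.card_empty, zero_add, zero_add]
      exact hIc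
    · rw [hA0, Finset.card_empty]
      obtain ⟨hτ, hτq⟩ := Finset.mem_filter.mp hτ
      have hτT := (Finset.mem_filter.mp hτ).1
      rcases h.alpha_cases hT hτT with hB | h0 | ⟨ρ, hρ, hρc, -⟩
      · have := card_le_compDegree hD (q := q) (W := insert (alpha G T τ) I) (fun v hv => by
          rcases Finset.mem_insert.mp hv with rfl | hv
          · exact ⟨hB, h.alpha_notMem hT hτT, (h.color_alpha hT hτT).trans hτq⟩
          · exact hI' v hv)
        rw [Finset.card_insert_of_notMem (hαI τ hτT)] at this
        omega
      · have hI0 : I.card = 0 := by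
          rw [Finset.card_eq_zero, Finset.eq_empty_iff_forall_notMem]
          intro v hv
          obtain ⟨hv, hc⟩ := Finset.mem_filter.mp hv
          have h1 := h.lt_alpha_of_isolated hT hτT hv (by omega)
          rw [Fin.lt_def] at h1
          omega
        have := (hpos τ hτT).1
        rw [hτq] at this
        omega
      · exfalso
        have : ρ ∈ A := Finset.mem_filter.mpr ⟨hρ, hρc.trans hτq⟩
        rw [hA0] at this
        exact Finset.notMem_empty _ this
  · obtain ⟨hσT, hσq⟩ := Finset.mem_filter.mp hσ
    have hβ := h.color_beta hT hσT
    have hpos' := (hpos σ hσT).2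
    rw [hσq] at hpos'
    rcases S.eq_empty_or_nonempty with hS0 | ⟨τ, hτ⟩
    · rw [hS0, Finset.card_empty]
      rcases h.beta_cases hT hσT with hB | h0 | ⟨ρ, hρ, hρc, he⟩
      · have := card_le_compDegree hD (q := q) (W := insert (beta G T σ) I) (fun v hv => by
          rcases Finset.mem_insert.mp hv with rfl | hv
          · exact ⟨hB, h.beta_notMem hT hσT, hβ.trans hσq⟩
          · exact hI' v hv)
        rw [Finset.card_insert_of_notMem (hβI σ hσT)] at this
        omega
      · have hI0 : I.card = 0 := by
          rw [Finset.card_eq_zero, Finset.eq_empty_iff_forall_notMem]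
          intro v hv
          obtain ⟨hv, hc⟩ := Finset.mem_filter.mp hv
          have h1 := h.beta_lt_of_isolated hT hσT hv (by omega)
          have := v.isLt
          rw [Fin.lt_def] at h1
          omega
        omega
      · have := hglued σ hσT ρ hρ hσq (by omega) he.symm
        omega
    · obtain ⟨hτ, hτq⟩ := Finset.mem_filter.mp hτ
      obtain ⟨hτT, hτs⟩ := Finset.mem_filter.mp hτ
      by_cases he : beta G T σ = alpha G T τ
      · have h1 := hglued σ hσT τ hτT hσq hτq he
        have h2 := hτs σ hσT (by omega) he
        rw [hτq] at h2
        omega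
      · have hβB : beta G T σ ∈ B := by
          rcases h.beta_cases hT hσT with hB | h0 | ⟨ρ, hρ, hρc, he'⟩
          · exact hB
          · have h1 := h.beta_le_alpha hT hσT hτT (lt_of_color_lt (T := T) (by omega))
            have h2 := h.alpha_lt hT hτT
            have := τ.isLt
            rw [Fin.le_def] at h1
            rw [Fin.lt_def] at h2
            omega
          · obtain rfl : ρ = τ := color_injOn hρ hτT (by omega)
            exact absurd he'.symm he
        have hαB : alpha G T τ ∈ B := by
          rcases h.alpha_cases hT hτT with hB | h0 | ⟨ρ, hρ, hρc, he'⟩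
          · exact hB
          · have h1 := h.lt_alpha hT hσT hτT (lt_of_color_lt (T := T) (by omega))
            rw [Fin.lt_def] at h1
            omega
          · obtain rfl : ρ = σ := color_injOn hρ hσT (by omega)
            exact absurd he' he
        have := card_le_compDegree hD (q := q) (W := insert (beta G T σ) (insert (alpha G T τ) I))
          (fun v hv => by
            rcases Finset.mem_insert.mp hv with rfl | hv
            · exact ⟨hβB, h.beta_notMem hT hσT, hβ.trans hσq⟩
            rcases Finset.mem_insert.mp hv with rfl | hv
            · exact ⟨hαB, h.alpha_notMem hT hτT, (h.color_alpha hT hτT).trans hτq⟩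
            · exact hI' v hv)
        rw [Finset.card_insert_of_notMem, Finset.card_insert_of_notMem (hαI τ hτT)] at this
        · omega
        · rw [Finset.mem_insert]
          rintro (h1 | h1)
          · exact he h1
          · exact hβI σ hσT h1

theorem card_add_card_add_card_le_sum (h : IsCliqueChain G B) (hT : IsSparse B T)
    (hD : ∀ v ∈ B, v ∉ T → 1 ≤ D v)
    (hpos : ∀ τ ∈ T, 1 ≤ compDegree T D (color T τ) ∧ 1 ≤ compDegree T D (color T τ + 1)) :
    T.card + (T.filter (IsStart G T (compDegree T D))).card + (isolatedVerts G T).card ≤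
      ∑ j, D j := by
  have hcol : ∀ j, color T j ≤ T.card := fun j => Finset.card_filter_le _ _
  have h1 := Finset.card_eq_sum_card_fiberwise (s := T) (t := Finset.range (T.card + 1))
    (f := fun τ => color T τ + 1) fun τ hτ =>
      Finset.mem_coe.mpr (Finset.mem_range.mpr (Nat.succ_lt_succ (color_lt_card hτ)))
  have h2 := Finset.card_eq_sum_card_fiberwise (s := T.filter (IsStart G T (compDegree T D)))
    (t := Finset.range (T.card + 1)) (f := color T) fun τ _ =>
      Finset.mem_coe.mpr (Finset.mem_range.mpr (Nat.lt_succ_of_le (hcol τ)))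
  have h3 := Finset.card_eq_sum_card_fiberwise (s := isolatedVerts G T)
    (t := Finset.range (T.card + 1)) (f := color T) fun τ _ =>
      Finset.mem_coe.mpr (Finset.mem_range.mpr (Nat.lt_succ_of_le (hcol τ)))
  rw [h1, h2, h3, ← Finset.sum_add_distrib, ← Finset.sum_add_distrib]
  calc _ ≤ ∑ q ∈ Finset.range (T.card + 1), compDegree T D q :=
        Finset.sum_le_sum fun q _ => h.card_add_card_add_card_le_compDegree hT hD hpos q
    _ = ∑ j ∈ Finset.univ.filter (· ∉ T), D j := by
        rw [← Finset.sum_fiberwise_of_maps_to (s := Finset.univ.filter (· ∉ T))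
          (t := Finset.range (T.card + 1)) (g := color T) fun j _ =>
          Finset.mem_range.mpr (Nat.lt_succ_of_le (hcol j))]
        refine Finset.sum_congr rfl fun q _ => Finset.sum_congr ?_ fun _ _ => rfl
        ext j
        simp [and_comm]
    _ ≤ ∑ j, D j := Finset.sum_le_sum_of_subset (Finset.filter_subset _ _)

end IsCliqueChain

end partitions

end GenBinomialEdge

open GenBinomialEdge in
theorem mainTheorem2 {K : Type*} [Field K] {m n : ℕ} (hm : 2 ≤ m) (hn : 2 ≤ n)
    (G : SimpleGraph (Fin n)) (hconn : G.Connected)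
    (hclosed : GenBinomialEdge.IsClosedGraph G)
    (hCM : GenBinomialEdge.IsCohenMacaulayRing
      (MvPolynomial (Fin 2 × Fin n) K ⧸
        GenBinomialEdge.edgeIdeal K (⊤ : SimpleGraph (Fin 2)) G))
    (T : Finset (Fin n)) (hT : GenBinomialEdge.IsCutSet G T) :
    (GenBinomialEdge.vDegrees (GenBinomialEdge.edgeIdeal K (⊤ : SimpleGraph (Fin m)) G)
      (GenBinomialEdge.primeOfCutSet K m G T)).Nonempty ∧
    IsLeast {d : ℕ | ∃ (P : Finpartition (GenBinomialEdge.forestEdges G T))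
        (hP : GenBinomialEdge.IsCompatible m P),
        d = (GenBinomialEdge.partitionPoly K hm P hP).totalDegree}
      (GenBinomialEdge.localVNumber (GenBinomialEdge.edgeIdeal K (⊤ : SimpleGraph (Fin m)) G)
        (GenBinomialEdge.primeOfCutSet K m G T)) := by
  obtain ⟨B, h⟩ := hclosed.exists_isCliqueChain hconn fun a b c d hab hbc hcd hac hbd =>
    hclosed.adj_of_isCohenMacaulayRing hconn hCM hab hbc hcd hac hbd
  have hS := h.isSparse_of_isCutSet hT
  have hdeg : ∀ (P : Finpartition (forestEdges G T)) (hP : IsCompatible m P),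
      (partitionPoly K hm P hP).totalDegree =
        ∑ p ∈ P.parts, (sliceVerts p).card + (isolatedVerts G T).card := fun P hP =>
    (isHomogeneous_partitionPoly hm hP).totalDegree fun h0 =>
      h.partitionPoly_notMem (K := K) hS hm hP (h0 ▸ zero_mem _)
  have hmem : ∀ (P : Finpartition (forestEdges G T)) (hP : IsCompatible m P),
      (partitionPoly K hm P hP).totalDegree ∈
        vDegrees (edgeIdeal K (⊤ : SimpleGraph (Fin m)) G) (primeOfCutSet K m G T) :=
    fun P hP => ⟨partitionPoly K hm P hP, by
      rw [hdeg]; exact isHomogeneous_partitionPoly hm hP, h.colon_partitionPoly hS hm hP⟩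
  -- With all component degrees equal to two, every edge is a block.
  obtain ⟨P₀, hP₀, -⟩ := h.exists_isCompatible (m := m) (δ := fun _ => 2) hS
    fun a b hab _ hrun => by
      by_contra hgt
      exact absurd (hrun (a + 1) (by omega) (by omega)) (by norm_num)
  have hne := Set.nonempty_of_mem (hmem P₀ hP₀)
  refine ⟨hne, ?_, ?_⟩
  · obtain ⟨f, hfd, hf⟩ := Nat.sInf_mem hne
    have hfT : f ∉ segreIdeal K m T := by
      intro hfT
      rw [← h.primeOfCutSet_eq_segreIdeal hS.subset] at hfT
      have h1 := h.mul_partitionPoly_mem hS hm hP₀ hfT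
      rw [mul_comm, ← smul_eq_mul, ← Submodule.mem_colon_singleton, hf,
        h.primeOfCutSet_eq_segreIdeal hS.subset] at h1
      exact h.partitionPoly_notMem hS hm hP₀ h1
    obtain ⟨D, hDsum, hD, hpos, hrun⟩ := h.exists_colDegree hS hm hfd hfT hf
    obtain ⟨P, hP, hcard⟩ := h.exists_isCompatible hS hrun
    refine ⟨P, hP, le_antisymm (Nat.sInf_le (hmem P hP)) ?_⟩
    rw [hdeg]
    refine le_trans ?_ hDsum.le
    refine le_trans ?_ (h.card_add_card_add_card_le_sum hS hD hpos)
    have h1 : ∑ p ∈ P.parts, (sliceVerts p).card ≤ ∑ p ∈ P.parts, (p.card + 1) :=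
      Finset.sum_le_sum fun p hp => hP.card_sliceVerts_le_card_add_one hp
    rw [Finset.sum_add_distrib, P.sum_card_parts, Finset.sum_const, smul_eq_mul, mul_one] at h1
    have h2 := h.card_forestEdges_le hS
    omega
  · rintro d ⟨P, hP, rfl⟩
    exact Nat.sInf_le (hmem P hP)
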